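/- **Setting.** Let $\Gamma=(V,E,s,t)$ be a finite oriented graph with finite vertex set $V$, finite edge set $E$ and source and target maps $s,t:E\to V$ (loops and multiple edges are allowed). Let $G$ be a compact connected Lie group, let $\mathfrak g$ be the complexification of its Lie algebra, and let $U(\cdot)$ denote universal enveloping algebras over $\mathbb C$. For $v\in V$ let $K_v\subseteq G$ be a subgroup and let $\sigma_v:K_v\to \mathrm{GL}(S_v)$ be a finite dimensional complex representation. Put $\mathbf K=\prod_{v}K_v$ and $\mathbf S=\bigotimes_{v} S_v$, with $\mathbf K$ acting on $\mathbf S$ by $\boldsymbol\sigma=\bigotimes_v\sigma_v$. For $e\in E$ let $\pi_e:G\to\mathrm{GL}(M_e)$ be an irreducible finite dimensional continuous complex representation. **Spin graph functions.** Let $\mathcal R^{\pi}$ be the space of functions on $G^E$ spanned by the matrix coefficients $c_{\varphi,m}(\mathbf g)=\varphi\bigl((\bigotimes_e\pi_e(g_e))m\bigr)$, where $m\in\bigotimes_e M_e$ and $\varphi\in(\bigotimes_e M_e)^*$. The group $\mathbf K$ acts on $G^E$ by $(k\cdot\mathbf g)_e=k_{s(e)}\,g_e\,k_{t(e)}^{-1}$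 and on $\mathcal R^\pi\otimes\mathbf S$ by $(k\cdot f)(\mathbf g)=\boldsymbol\sigma(k)f(k^{-1}\cdot \mathbf g)$. The space of $\pi$-elementary spin graph functions is $\mathcal H^\pi=(\mathcal R^\pi\otimes\mathbf S)^{\mathbf K}$. The algebra $U((\mathfrak g^E)^{\times 2})$ acts on $\mathcal R^\pi\otimes\mathbf S$ through the first tensor factor, by the algebra homomorphism $X\mapsto D_X$ that is determined by $$(D_{(x,y)}f)(\mathbf g)=\tfrac{d}{d\tau}\Big|_{\tau=0}f\bigl(\exp(-\tau x)\,\mathbf g\,\exp(\tau y)\bigr)$$ for $x,y$ in the real Lie algebra of $G^E$ and by complex linearity. The group $\mathbf K$ acts on $U((\mathfrak g^E)^{\times 2})$ by the algebra automorphisms that extend $(x,y)\mapsto\bigl((\mathrm{Ad}(k_{s(e)})x_e)_e,(\mathrm{Ad}(k_{t(e)})y_e)_e\bigr)$. The subalgebra $U((\mathfrak g^E)^{\times 2})^{\mathbf K}$ of invariants preserves $\mathcal H^\pi$. **Local intertwiners.** For $v\in V$ put $$\mathbf M^{\pi_{\mathcal S(v)}}=\bigotimes_{s(e)=v}M_e^*\otimes\bigotimes_{t(e)=v}M_e,\qquad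 U(\mathfrak g)^{(v)}=\bigotimes_{s(e)=v}U(\mathfrak g)\otimes\bigotimes_{t(e)=v}U(\mathfrak g).$$ Here $K_v$ acts on $\mathbf M^{\pi_{\mathcal S(v)}}$ by the diagonal action ($\pi_e^*$ on $M_e^*$ and $\pi_e$ on $M_e$), $U(\mathfrak g)^{(v)}$ acts on it factor by factor through the differentiated representations, and $K_v$ acts on $U(\mathfrak g)^{(v)}$ by the diagonal adjoint action. The algebra $U(\mathfrak g)^{(v)}$ acts on $\mathrm{Hom}(S_v^*,\mathbf M^{\pi_{\mathcal S(v)}})$ through the codomain, by $(X\cdot T)(\xi)=X\cdot T(\xi)$. This makes the space of intertwiners $\mathrm{Hom}_{K_v}(S_v^*,\mathbf M^{\pi_{\mathcal S(v)}})$ a module over $(U(\mathfrak g)^{(v)})^{K_v}$. The algebra isomorphism $$U((\mathfrak g^E)^{\times2})\xrightarrow{\ \sim\ }\bigotimes_{v}U(\mathfrak g)^{(v)}$$ that sends the $e$-th component of the first (respectively second) copy of $\mathfrak g^E$ to the factor of $e$ in the source part of $U(\mathfrak g)^{(s(e))}$ (respectively in the target part of $U(\mathfrak g)^{(t(e))}$)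 defines an action of $U((\mathfrak g^E)^{\times 2})$ on $\bigotimes_v\mathrm{Hom}(S_v^*,\mathbf M^{\pi_{\mathcal S(v)}})$. The subalgebra $U((\mathfrak g^E)^{\times 2})^{\mathbf K}$ preserves $\bigotimes_v\mathrm{Hom}_{K_v}(S_v^*,\mathbf M^{\pi_{\mathcal S(v)}})$. **The map $\Upsilon^\pi$.** Let $\tau_v:\mathrm{Hom}(S_v^*,\mathbf M^{\pi_{\mathcal S(v)}})\to\mathbf M^{\pi_{\mathcal S(v)}}\otimes S_v$ be given by $\tau_v(\phi)=\sum_r\phi(u_r^*)\otimes u_r$ for a basis $(u_r)$ of $S_v$ with dual basis $(u_r^*)$. Let $\Psi^\pi:\bigotimes_v(\mathbf M^{\pi_{\mathcal S(v)}}\otimes S_v)\to\mathcal R^\pi\otimes\mathbf S$ be the linear map with $$\Psi^\pi\Bigl(\bigotimes_v\Bigl(\bigotimes_{s(e)=v}\varphi_e\otimes\bigotimes_{t(e)=v}m_e\otimes u_v\Bigr)\Bigr)=c_{\otimes_e\varphi_e,\;\otimes_e m_e}\otimes\bigotimes_v u_v ,$$ and put $\Upsilon^\pi=\Psi^\pi\circ\bigotimes_v\tau_v:\bigotimes_v\mathrm{Hom}(S_v^*,\mathbf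 M^{\pi_{\mathcal S(v)}})\to\mathcal R^\pi\otimes\mathbf S$. **Statement.** The map $\Upsilon^\pi$ is a linear isomorphism, and the following hold. (a) $\Upsilon^\pi$ restricts to an isomorphism of $U((\mathfrak g^E)^{\times 2})^{\mathbf K}$-modules $$\bigotimes_{v\in V}\mathrm{Hom}_{K_v}\bigl(S_v^*,\mathbf M^{\pi_{\mathcal S(v)}}\bigr)\xrightarrow{\ \sim\ }\mathcal H^\pi .$$ (b) $\mathcal H^\pi$ is an irreducible $U((\mathfrak g^E)^{\times 2})^{\mathbf K}$-module if and only if, for every $v\in V$, $\mathrm{Hom}_{K_v}(S_v^*,\mathbf M^{\pi_{\mathcal S(v)}})$ is an irreducible $(U(\mathfrak g)^{(v)})^{K_v}$-module. (Irreducible modules are nonzero.) -/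

import Mathlib

open scoped Manifold ContDiff TensorProduct
open MeasureTheory

set_option linter.unusedSectionVars false

namespace SpinGraph

instance minSmoothness_real_three_leInfty : ENat.LEInfty (minSmoothness ℝ 3) := by
  refine ⟨?_⟩
  rw [minSmoothness_of_isRCLikeNormedField]
  exact ENat.LEInfty.out

section Smoothness

variable {𝔼 : Type*} [NormedAddCommGroup 𝔼] [NormedSpace ℝ 𝔼] [FiniteDimensional ℝ 𝔼]
  {G : Type*} [TopologicalSpace G] [ChartedSpace 𝔼 G]

lemma contMDiffOn_fderiv_param {V : Type*} [NormedAddCommGroup V] [NormedSpace ℝ V]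
    [IsManifold 𝓘(ℝ, 𝔼) ∞ G]
    {U : Set 𝔼} (hU : IsOpen U) {F : 𝔼 → G → V}
    (hF : ContMDiffOn (𝓘(ℝ, 𝔼).prod 𝓘(ℝ, 𝔼)) 𝓘(ℝ, V) ∞ (Function.uncurry F) (U ×ˢ Set.univ)) :
    ContMDiffOn (𝓘(ℝ, 𝔼).prod 𝓘(ℝ, 𝔼)) 𝓘(ℝ, 𝔼 →L[ℝ] V) ∞
      (Function.uncurry fun z h => fderiv ℝ (fun z' => F z' h) z) (U ×ˢ Set.univ) := by
  rintro ⟨z, h⟩ ⟨hz, -⟩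
  have hF' : ContMDiffAt (𝓘(ℝ, 𝔼).prod 𝓘(ℝ, 𝔼)) 𝓘(ℝ, V) ∞ (Function.uncurry F) (z, h) :=
    (hF (z, h) ⟨hz, trivial⟩).contMDiffAt ((hU.prod isOpen_univ).mem_nhds ⟨hz, trivial⟩)
  have key := ContMDiffAt.mfderiv (J := 𝓘(ℝ, 𝔼).prod 𝓘(ℝ, 𝔼)) (I := 𝓘(ℝ, 𝔼)) (I' := 𝓘(ℝ, V))
    (m := ∞) (n := ∞) (x₀ := ((z, h) : 𝔼 × G))
    (fun (p : 𝔼 × G) (z' : 𝔼) => F z' p.2) (fun p => p.1) ?_ contMDiffAt_fst (by simp)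
  · simp only [inTangentCoordinates_model_space, mfderiv_eq_fderiv] at key
    exact key.contMDiffWithinAt
  · have : (Function.uncurry fun (p : 𝔼 × G) (z' : 𝔼) => F z' p.2) =
        Function.uncurry F ∘ (fun q : (𝔼 × G) × 𝔼 => (q.2, q.1.2)) := rfl
    rw [this]
    refine ContMDiffAt.comp (I' := 𝓘(ℝ, 𝔼).prod 𝓘(ℝ, 𝔼)) _ hF' ?_
    exact contMDiffAt_snd.prodMk (contMDiffAt_snd.comp _ contMDiffAt_fst)

lemma hasFDerivAt_integral_param {V : Type*} [NormedAddCommGroup V] [NormedSpace ℝ V]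
    [FiniteDimensional ℝ V] [IsManifold 𝓘(ℝ, 𝔼) ∞ G] [CompactSpace G]
    [MeasurableSpace G] [BorelSpace G] {μ : Measure G} [IsFiniteMeasure μ]
    {U : Set 𝔼} (hU : IsOpen U) {F : 𝔼 → G → V}
    (hF : ContMDiffOn (𝓘(ℝ, 𝔼).prod 𝓘(ℝ, 𝔼)) 𝓘(ℝ, V) ∞ (Function.uncurry F) (U ×ˢ Set.univ))
    {r : G → ℝ} (hr : Continuous r) {z : 𝔼} (hz : z ∈ U) :
    HasFDerivAt (fun z => ∫ h, r h • F z h ∂μ)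
      (∫ h, r h • fderiv ℝ (fun z' => F z' h) z ∂μ) z := by
  have hF' := contMDiffOn_fderiv_param hU hF
  have slice : ∀ z ∈ U, Continuous (fun h : G => F z h) := fun z hz => by
    have := hF.continuousOn.comp_continuous (f := fun h : G => (z, h)) (by fun_prop)
      (fun h => ⟨hz, trivial⟩)
    exact this
  have slice' : ∀ z ∈ U, Continuous (fun h : G => fderiv ℝ (fun z' => F z' h) z) := fun z hz => by
    have := hF'.continuousOn.comp_continuous (f := fun h : G => (z, h)) (by fun_prop)
      (fun h => ⟨hz, trivial⟩)
    exact this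
  obtain ⟨ε, hε, hball⟩ := Metric.isOpen_iff.1 hU z hz
  have hC : Metric.closedBall z (ε / 2) ⊆ U :=
    (Metric.closedBall_subset_ball (by linarith)).trans hball
  have hcomp : IsCompact (Metric.closedBall z (ε / 2) ×ˢ (Set.univ : Set G)) :=
    (isCompact_closedBall z (ε / 2)).prod isCompact_univ
  have hcont : ContinuousOn (fun p : 𝔼 × G => r p.2 • fderiv ℝ (fun z' => F z' p.2) p.1)
      (Metric.closedBall z (ε / 2) ×ˢ (Set.univ : Set G)) := by
    refine ContinuousOn.smul (hr.comp continuous_snd).continuousOn (hF'.continuousOn.mono ?_)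
    exact Set.prod_mono hC le_rfl
  obtain ⟨C, hCb⟩ := hcomp.exists_bound_of_continuousOn hcont
  have hd : ∀ h : G, ∀ x ∈ U, HasFDerivAt (fun z' => F z' h) (fderiv ℝ (fun z' => F z' h) x) x := by
    intro h x hx
    apply DifferentiableAt.hasFDerivAt
    have h1 : ContMDiffAt (𝓘(ℝ, 𝔼).prod 𝓘(ℝ, 𝔼)) 𝓘(ℝ, V) ∞ (Function.uncurry F) (x, h) :=
      (hF (x, h) ⟨hx, trivial⟩).contMDiffAt ((hU.prod isOpen_univ).mem_nhds ⟨hx, trivial⟩)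
    have h2 : ContMDiffAt 𝓘(ℝ, 𝔼) 𝓘(ℝ, V) ∞ (Function.uncurry F ∘ fun z' : 𝔼 => (z', h)) x :=
      ContMDiffAt.comp (I' := 𝓘(ℝ, 𝔼).prod 𝓘(ℝ, 𝔼)) _ h1
        (contMDiffAt_id.prodMk contMDiffAt_const)
    exact h2.contDiffAt.differentiableAt (by simp)
  refine hasFDerivAt_integral_of_dominated_of_fderiv_le (𝕜 := ℝ) (bound := fun _ => C)
    (s := Metric.closedBall z (ε / 2))
    (F' := fun z h => r h • fderiv ℝ (fun z' => F z' h) z)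
    (Metric.closedBall_mem_nhds z (by linarith)) ?_ ?_ ?_ ?_ ?_ ?_
  · filter_upwards [hU.mem_nhds hz] with x hx
    exact (hr.smul (slice x hx)).aestronglyMeasurable
  · have := (hr.smul (slice z hz))
    exact this.integrable_of_hasCompactSupport (HasCompactSupport.of_compactSpace _)
  · exact (hr.smul (slice' z hz)).aestronglyMeasurable
  · exact Filter.Eventually.of_forall fun h x hx => hCb (x, h) ⟨hx, trivial⟩
  · exact integrable_const _
  · exact Filter.Eventually.of_forall fun h x hx => (hd h x (hC hx)).const_smul (r h)

lemma contDiffOn_integral_param {V : Type*} [NormedAddCommGroup V] [NormedSpace ℝ V]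
    [FiniteDimensional ℝ V] [IsManifold 𝓘(ℝ, 𝔼) ∞ G] [CompactSpace G]
    [MeasurableSpace G] [BorelSpace G] {μ : Measure G} [IsFiniteMeasure μ]
    {U : Set 𝔼} (hU : IsOpen U) {F : 𝔼 → G → V}
    (hF : ContMDiffOn (𝓘(ℝ, 𝔼).prod 𝓘(ℝ, 𝔼)) 𝓘(ℝ, V) ∞ (Function.uncurry F) (U ×ˢ Set.univ))
    {r : G → ℝ} (hr : Continuous r) :
    ContDiffOn ℝ 2 (fun z => ∫ h, r h • F z h ∂μ) U := by
  have hF1 := contMDiffOn_fderiv_param hU hF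
  have hF2 := contMDiffOn_fderiv_param hU hF1
  have d0 := fun z hz => hasFDerivAt_integral_param (μ := μ) hU hF hr (z := z) hz
  have d1 := fun z hz => hasFDerivAt_integral_param (μ := μ) hU hF1 hr (z := z) hz
  have d2 := fun z hz => hasFDerivAt_integral_param (μ := μ) hU hF2 hr (z := z) hz
  have e2 : (2 : ℕ∞ω) = 1 + 1 := by norm_num
  rw [e2, contDiffOn_succ_iff_fderiv_of_isOpen hU]
  refine ⟨fun z hz => (d0 z hz).differentiableAt.differentiableWithinAt, by simp, ?_⟩
  have c0 : Set.EqOn (fderiv ℝ fun z => ∫ h, r h • F z h ∂μ)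
      (fun z => ∫ h, r h • fderiv ℝ (fun z' => F z' h) z ∂μ) U := fun z hz => (d0 z hz).fderiv
  refine ContDiffOn.congr ?_ c0
  have e1 : (1 : ℕ∞ω) = 0 + 1 := by norm_num
  rw [e1, contDiffOn_succ_iff_fderiv_of_isOpen hU]
  refine ⟨fun z hz => (d1 z hz).differentiableAt.differentiableWithinAt, by simp, ?_⟩
  rw [contDiffOn_zero]
  exact ContinuousOn.congr (fun z hz => (d2 z hz).continuousAt.continuousWithinAt)
    fun z hz => (d1 z hz).fderiv

end Smoothness

section ContinuousHom

variable {𝔼 : Type*} [NormedAddCommGroup 𝔼] [NormedSpace ℝ 𝔼] [FiniteDimensional ℝ 𝔼]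
  {G : Type*} [TopologicalSpace G] [ChartedSpace 𝔼 G] [Group G] [LieGroup 𝓘(ℝ, 𝔼) ∞ G]
  [T2Space G] [CompactSpace G]
  {𝒜 : Type*} [NormedRing 𝒜] [NormedAlgebra ℝ 𝒜] [FiniteDimensional ℝ 𝒜]

/-- A continuous homomorphism from a compact Lie group to a finite dimensional algebra is
twice continuously differentiable at the identity. -/
lemma contMDiffAt_one_of_continuous (R : G →* 𝒜) (hR : Continuous R) :
    ContMDiffAt 𝓘(ℝ, 𝔼) 𝓘(ℝ, 𝒜) 2 R 1 := by
  classical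
  have : IsTopologicalGroup G := topologicalGroup_of_lieGroup 𝓘(ℝ, 𝔼) ∞
  have : CompleteSpace 𝒜 := FiniteDimensional.complete ℝ 𝒜
  let _ : MeasurableSpace G := borel G
  have : BorelSpace G := ⟨rfl⟩
  set μ : Measure G := Measure.haar with hμ
  -- a bump function concentrated where `R` is close to `1`
  obtain ⟨f, hf⟩ : ∃ f : SmoothBumpFunction 𝓘(ℝ, 𝔼) (1 : G),
      tsupport f ⊆ {g | ‖R g - 1‖ < 1 / 2} := by
    have hopen : {g : G | ‖R g - 1‖ < 1 / 2} ∈ nhds (1 : G) := by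
      apply (isOpen_lt (by fun_prop) continuous_const).mem_nhds
      simp
    obtain ⟨f, -, hf⟩ := (SmoothBumpFunction.nhds_basis_tsupport (I := 𝓘(ℝ, 𝔼)) (1 : G)).mem_iff.1
      hopen
    exact ⟨f, hf⟩
  have hfs : ContMDiff 𝓘(ℝ, 𝔼) 𝓘(ℝ) ∞ f := f.contMDiff
  have hfc : Continuous f := hfs.continuous
  have int : ∀ k : G → 𝒜, Continuous k → Integrable k μ := fun k hk =>
    hk.integrable_of_hasCompactSupport (HasCompactSupport.of_compactSpace _)
  have int' : ∀ k : G → ℝ, Continuous k → Integrable k μ := fun k hk =>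
    hk.integrable_of_hasCompactSupport (HasCompactSupport.of_compactSpace _)
  set P : 𝒜 := ∫ h, f h • R h ∂μ with hP
  set c : ℝ := ∫ h, f h ∂μ with hc
  have hcpos : 0 < c := by
    refine hfc.integral_pos_of_hasCompactSupport_nonneg_nonzero
      (HasCompactSupport.of_compactSpace _) (fun g => f.nonneg) (x := 1) ?_
    simp
  have hPu : IsUnit P := by
    have h1 : P - c • 1 = ∫ h, f h • (R h - 1) ∂μ := by
      have e1 : Integrable (fun h => f h • R h) μ := int _ (hfc.smul hR)
      have e2 : Integrable (fun h => f h • (1 : 𝒜)) μ := int _ (hfc.smul continuous_const)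
      simp only [smul_sub]
      rw [integral_sub e1 e2, integral_smul_const]
    have h2 : ‖P - c • 1‖ ≤ c / 2 := by
      rw [h1]
      calc ‖∫ h, f h • (R h - 1) ∂μ‖ ≤ ∫ h, f h * (1 / 2) ∂μ := by
            refine norm_integral_le_of_norm_le (int' _ (hfc.mul continuous_const)) ?_
            refine Filter.Eventually.of_forall fun h => ?_
            rw [norm_smul, Real.norm_of_nonneg f.nonneg]
            by_cases hh : f h = 0
            · simp [hh]
            · have := hf (subset_tsupport _ (Function.mem_support.2 hh))
              exact mul_le_mul_of_nonneg_left (le_of_lt this) f.nonneg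
        _ = c / 2 := by rw [integral_mul_const]; ring
    have h3 : ‖1 - c⁻¹ • P‖ < 1 := by
      have : 1 - c⁻¹ • P = - (c⁻¹ • (P - c • 1)) := by
        rw [smul_sub, smul_smul, inv_mul_cancel₀ hcpos.ne', one_smul]; abel
      rw [this, norm_neg, norm_smul, norm_inv, Real.norm_of_nonneg hcpos.le]
      calc c⁻¹ * ‖P - c • 1‖ ≤ c⁻¹ * (c / 2) := by gcongr
        _ = 1 / 2 := by field_simp
        _ < 1 := by norm_num
    have h4 : IsUnit (c⁻¹ • P) := by
      have := isUnit_one_sub_of_norm_lt_one h3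
      simpa using this
    have h5 : P = (algebraMap ℝ 𝒜 c) * (c⁻¹ • P) := by
      rw [← Algebra.smul_def, smul_smul, mul_inv_cancel₀ hcpos.ne', one_smul]
    rw [h5]
    exact ((isUnit_iff_ne_zero.2 hcpos.ne').map (algebraMap ℝ 𝒜)).mul h4
  obtain ⟨u, hu⟩ := hPu
  have hconv : ∀ g, R g * P = ∫ h, f (g⁻¹ * h) • R h ∂μ := by
    intro g
    rw [← integral_mul_left_eq_self (fun h => f (g⁻¹ * h) • R h) g]
    simp only [inv_mul_cancel_left, map_mul]
    have e1 : Integrable (fun h => f h • R h) μ := int _ (hfc.smul hR)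
    rw [hP, ← integral_const_mul_of_integrable e1]
    congr 1 with h
    rw [mul_smul_comm]
  have hReq : ∀ g, R g = (∫ h, f (g⁻¹ * h) • R h ∂μ) * (↑u⁻¹ : 𝒜) := by
    intro g
    rw [← hconv, ← hu, mul_assoc, Units.mul_inv, mul_one]
  -- the convolution in the chart at `1`
  set φ := chartAt 𝔼 (1 : G)
  set U : Set 𝔼 := φ.target
  have hU : IsOpen U := φ.open_target
  have hφ : ContMDiffOn 𝓘(ℝ, 𝔼) 𝓘(ℝ, 𝔼) ∞ φ.symm U := contMDiffOn_chart_symm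
  have hF : ContMDiffOn (𝓘(ℝ, 𝔼).prod 𝓘(ℝ, 𝔼)) 𝓘(ℝ) ∞
      (Function.uncurry fun (z : 𝔼) (h : G) => f ((φ.symm z)⁻¹ * h)) (U ×ˢ Set.univ) := by
    refine hfs.comp_contMDiffOn (f := fun p : 𝔼 × G => (φ.symm p.1)⁻¹ * p.2) ?_
    refine ContMDiffOn.mul (ContMDiffOn.inv ?_) contMDiffOn_snd
    exact hφ.comp contMDiffOn_fst fun p hp => hp.1
  have hQ : ContDiffOn ℝ 2 (fun z => ∫ h, f ((φ.symm z)⁻¹ * h) • R h ∂μ) U := by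
    let b := Module.finBasis ℝ 𝒜
    have hb : ∀ z, (∫ h, f ((φ.symm z)⁻¹ * h) • R h ∂μ) =
        ∑ i, (∫ h, (b.coord i (R h)) • f ((φ.symm z)⁻¹ * h) ∂μ) • b i := by
      intro z
      have hi : ∀ i, (∫ h, (b.coord i (R h)) • f ((φ.symm z)⁻¹ * h) ∂μ) =
          b.coord i (∫ h, f ((φ.symm z)⁻¹ * h) • R h ∂μ) := by
        intro i
        have := ((b.coord i).toContinuousLinearMap).integral_comp_comm
          (int (fun h => f ((φ.symm z)⁻¹ * h) • R h) (by fun_prop))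
        simp only [LinearMap.coe_toContinuousLinearMap', map_smul, smul_eq_mul] at this
        rw [← this]
        congr 1 with h
        simp [mul_comm]
      simp only [hi]
      exact (b.sum_repr _).symm
    rw [funext hb]
    refine ContDiffOn.sum fun i _ => ?_
    have e1 := contDiffOn_integral_param (μ := μ) hU hF
      (((b.coord i).continuous_of_finiteDimensional).comp hR)
    exact e1.smul contDiffOn_const
  have hfin : ContMDiffOn 𝓘(ℝ, 𝔼) 𝓘(ℝ, 𝒜) 2
      ((fun z => (∫ h, f ((φ.symm z)⁻¹ * h) • R h ∂μ) * (↑u⁻¹ : 𝒜)) ∘ φ) φ.source := by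
    refine ContMDiffOn.comp (t := U) (I' := 𝓘(ℝ, 𝔼)) ?_ contMDiffOn_chart φ.mapsTo
    exact (hQ.mul contDiffOn_const).contMDiffOn
  have hmem : φ.source ∈ nhds (1 : G) := φ.open_source.mem_nhds (mem_chart_source 𝔼 (1 : G))
  refine (hfin.contMDiffAt hmem).congr_of_eventuallyEq ?_
  filter_upwards [hmem] with g hg
  simp only [Function.comp, φ.left_inv hg]
  exact hReq g

lemma contMDiff_of_continuous (R : G →* 𝒜) (hR : Continuous R) :
    ContMDiff 𝓘(ℝ, 𝔼) 𝓘(ℝ, 𝒜) 2 R := by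
  intro g
  have h1 : (R : G → 𝒜) = (fun a => R g * a) ∘ R ∘ (fun h => g⁻¹ * h) := by
    ext h; simp [← map_mul]
  rw [h1]
  have h2 : ContMDiffAt 𝓘(ℝ, 𝔼) 𝓘(ℝ, 𝒜) 2 (R ∘ fun h => g⁻¹ * h) g := by
    refine ContMDiffAt.comp (I' := 𝓘(ℝ, 𝔼)) g ?_ contMDiff_mul_left.contMDiffAt
    simpa using contMDiffAt_one_of_continuous R hR
  have h3 : ContMDiffAt 𝓘(ℝ, 𝒜) 𝓘(ℝ, 𝒜) 2 (fun a : 𝒜 => R g * a) ((R ∘ fun h => g⁻¹ * h) g) :=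
    (contDiff_const.mul contDiff_id).contMDiff.contMDiffAt
  exact h3.comp g h2

end ContinuousHom

section Bracket

open VectorField

variable {𝔼 : Type*} [NormedAddCommGroup 𝔼] [NormedSpace ℝ 𝔼]
  {G : Type*} [TopologicalSpace G] [ChartedSpace 𝔼 G]

/-- The derivative at `g` of a function `f` with values in a normed space, as a linear map on the
tangent space at `g`. -/
noncomputable def dirDeriv {F : Type*} [NormedAddCommGroup F] [NormedSpace ℝ F]
    (f : G → F) (g : G) : TangentSpace 𝓘(ℝ, 𝔼) g →L[ℝ] F :=
  mfderiv 𝓘(ℝ, 𝔼) 𝓘(ℝ, F) f g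

/-- The Lie bracket of vector fields acts on functions as a commutator. -/
lemma dirDeriv_mlieBracket [FiniteDimensional ℝ 𝔼] [IsManifold 𝓘(ℝ, 𝔼) ∞ G]
    {F : Type*} [NormedAddCommGroup F] [NormedSpace ℝ F]
    {f fV fW : G → F} {V W : (g : G) → TangentSpace 𝓘(ℝ, 𝔼) g} {x : G}
    (hf : ContMDiff 𝓘(ℝ, 𝔼) 𝓘(ℝ, F) 2 f)
    (hV : MDifferentiableAt 𝓘(ℝ, 𝔼) 𝓘(ℝ, 𝔼).tangent
      (fun g => (V g : TangentBundle 𝓘(ℝ, 𝔼) G)) x)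
    (hW : MDifferentiableAt 𝓘(ℝ, 𝔼) 𝓘(ℝ, 𝔼).tangent
      (fun g => (W g : TangentBundle 𝓘(ℝ, 𝔼) G)) x)
    (hdV : MDifferentiableAt 𝓘(ℝ, 𝔼) 𝓘(ℝ, F) fV x)
    (hdW : MDifferentiableAt 𝓘(ℝ, 𝔼) 𝓘(ℝ, F) fW x)
    (hfV : ∀ g, dirDeriv f g (V g) = fV g)
    (hfW : ∀ g, dirDeriv f g (W g) = fW g) :
    dirDeriv f x (mlieBracket 𝓘(ℝ, 𝔼) V W x) = dirDeriv fW x (V x) - dirDeriv fV x (W x) := by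
  have : CompleteSpace 𝔼 := FiniteDimensional.complete ℝ 𝔼
  have : IsManifold 𝓘(ℝ, 𝔼) 2 G := IsManifold.of_le (n := ∞) (by exact ENat.LEInfty.out)
  set φ := extChartAt 𝓘(ℝ, 𝔼) x with hφ
  let V' : 𝔼 → 𝔼 := mpullbackWithin 𝓘(ℝ, 𝔼) 𝓘(ℝ, 𝔼) φ.symm V (Set.range 𝓘(ℝ, 𝔼))
  let W' : 𝔼 → 𝔼 := mpullbackWithin 𝓘(ℝ, 𝔼) 𝓘(ℝ, 𝔼) φ.symm W (Set.range 𝓘(ℝ, 𝔼))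
  set z := φ x with hz
  have hx : φ.symm z = x := extChartAt_to_inv x
  have hU : IsOpen φ.target := isOpen_extChartAt_target x
  have hzU : z ∈ φ.target := mem_extChartAt_target x
  have dφ : ∀ w ∈ φ.target, ContMDiffAt 𝓘(ℝ, 𝔼) 𝓘(ℝ, 𝔼) 2 φ.symm w := fun w hw =>
    (contMDiffOn_extChartAt_symm x w hw).contMDiffAt (hU.mem_nhds hw)
  -- directional derivatives in the chart
  have transport : ∀ (k : G → F) (w : 𝔼), w ∈ φ.target →
      MDifferentiableAt 𝓘(ℝ, 𝔼) 𝓘(ℝ, F) k (φ.symm w) →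
      ∀ Y : (g : G) → TangentSpace 𝓘(ℝ, 𝔼) g,
      fderiv ℝ (k ∘ φ.symm) w (mpullbackWithin 𝓘(ℝ, 𝔼) 𝓘(ℝ, 𝔼) φ.symm Y
        (Set.range 𝓘(ℝ, 𝔼)) w) = dirDeriv k (φ.symm w) (Y (φ.symm w)) := by
    intro k w hw hk Y
    have h1 : fderiv ℝ (k ∘ φ.symm) w = (mfderiv 𝓘(ℝ, 𝔼) 𝓘(ℝ, F) k (φ.symm w)).comp
        (mfderiv 𝓘(ℝ, 𝔼) 𝓘(ℝ, 𝔼) φ.symm w) := by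
      rw [← mfderiv_eq_fderiv]
      exact mfderiv_comp w hk ((dφ w hw).mdifferentiableAt (by simp))
    rw [h1, mpullbackWithin_apply]
    have hinv := isInvertible_mfderivWithin_extChartAt_symm (I := 𝓘(ℝ, 𝔼)) (x := x) hw
    rw [ModelWithCorners.range_eq_univ, mfderivWithin_univ] at hinv ⊢
    obtain ⟨e, he⟩ := hinv
    rw [← hφ] at he
    rw [← he, ContinuousLinearMap.inverse_equiv]
    show mfderiv 𝓘(ℝ, 𝔼) 𝓘(ℝ, F) k (φ.symm w) (e (e.symm (Y (φ.symm w)))) = _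
    rw [e.apply_symm_apply]
    rfl
  have hmf : ∀ g, MDifferentiableAt 𝓘(ℝ, 𝔼) 𝓘(ℝ, F) f g := fun g =>
    (hf g).mdifferentiableAt (by simp)
  set fc : 𝔼 → F := f ∘ φ.symm with hfc
  have hfc2 : ContDiffAt ℝ 2 fc z :=
    (ContMDiffAt.comp (I' := 𝓘(ℝ, 𝔼)) z (hf _) (dφ z hzU)).contDiffAt
  have hsymm : IsSymmSndFDerivAt ℝ fc z :=
    hfc2.isSymmSndFDerivAt (by rw [minSmoothness_of_isRCLikeNormedField])
  have hDfc : DifferentiableAt ℝ (fderiv ℝ fc) z :=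
    (hfc2.fderiv_right (m := 1) (by norm_num)).differentiableAt (by simp)
  have hVd : DifferentiableAt ℝ V' z := by
    have := MDifferentiableWithinAt.differentiableWithinAt_mpullbackWithin_vectorField
      (s := Set.univ) hV.mdifferentiableWithinAt
    rw [Set.preimage_univ, Set.univ_inter] at this
    rw [← differentiableWithinAt_univ, ← ModelWithCorners.range_eq_univ 𝓘(ℝ, 𝔼)]
    exact this
  have hWd : DifferentiableAt ℝ W' z := by
    have := MDifferentiableWithinAt.differentiableWithinAt_mpullbackWithin_vectorField
      (s := Set.univ) hW.mdifferentiableWithinAt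
    rw [Set.preimage_univ, Set.univ_inter] at this
    rw [← differentiableWithinAt_univ, ← ModelWithCorners.range_eq_univ 𝓘(ℝ, 𝔼)]
    exact this
  have evV : (fun w => fderiv ℝ fc w (V' w)) =ᶠ[nhds z] fV ∘ φ.symm := by
    filter_upwards [hU.mem_nhds hzU] with w hw
    exact (transport f w hw (hmf _) V).trans (hfV _)
  have evW : (fun w => fderiv ℝ fc w (W' w)) =ᶠ[nhds z] fW ∘ φ.symm := by
    filter_upwards [hU.mem_nhds hzU] with w hw
    exact (transport f w hw (hmf _) W).trans (hfW _)
  have dV : ∀ u, fderiv ℝ (fV ∘ φ.symm) z u =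
      fderiv ℝ (fderiv ℝ fc) z u (V' z) + fderiv ℝ fc z (fderiv ℝ V' z u) := by
    intro u
    rw [← evV.fderiv_eq, fderiv_clm_apply hDfc hVd]
    simp only [add_apply, ContinuousLinearMap.comp_apply,
      ContinuousLinearMap.flip_apply]
    exact add_comm _ _
  have dW : ∀ u, fderiv ℝ (fW ∘ φ.symm) z u =
      fderiv ℝ (fderiv ℝ fc) z u (W' z) + fderiv ℝ fc z (fderiv ℝ W' z u) := by
    intro u
    rw [← evW.fderiv_eq, fderiv_clm_apply hDfc hWd]
    simp only [add_apply, ContinuousLinearMap.comp_apply,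
      ContinuousLinearMap.flip_apply]
    exact add_comm _ _
  have tV : fderiv ℝ (fW ∘ φ.symm) z (V' z) = dirDeriv fW x (V x) := by
    have := transport fW z hzU (by rw [hx]; exact hdW) V
    exact this.trans (by rw [hx])
  have tW : fderiv ℝ (fV ∘ φ.symm) z (W' z) = dirDeriv fV x (W x) := by
    have := transport fV z hzU (by rw [hx]; exact hdV) W
    exact this.trans (by rw [hx])
  have tB : dirDeriv f x (mlieBracket 𝓘(ℝ, 𝔼) V W x) =
      fderiv ℝ fc z (lieBracket ℝ V' W' z) := by
    have h1 : dirDeriv f x = (fderiv ℝ fc z).comp (mfderiv 𝓘(ℝ, 𝔼) 𝓘(ℝ, 𝔼) φ x) := by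
      have e1 : f =ᶠ[nhds x] fc ∘ φ := by
        filter_upwards [extChartAt_source_mem_nhds (I := 𝓘(ℝ, 𝔼)) x] with g hg
        simp only [hfc, Function.comp, φ.left_inv hg]
      have e2 : MDifferentiableAt 𝓘(ℝ, 𝔼) 𝓘(ℝ, 𝔼) φ x :=
        mdifferentiableAt_extChartAt (mem_chart_source 𝔼 x)
      have e3 : MDifferentiableAt 𝓘(ℝ, 𝔼) 𝓘(ℝ, F) fc z :=
        (hfc2.differentiableAt (by simp)).mdifferentiableAt
      rw [dirDeriv, e1.mfderiv_eq]
      refine (mfderiv_comp x e3 e2).trans ?_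
      rw [mfderiv_eq_fderiv]
      rfl
    obtain ⟨e, he⟩ := isInvertible_mfderiv_extChartAt (I := 𝓘(ℝ, 𝔼)) (x := x)
      (mem_extChartAt_source x)
    rw [h1, ← mlieBracketWithin_univ, mlieBracketWithin_apply]
    rw [← hφ] at he ⊢
    rw [← he, ContinuousLinearMap.inverse_equiv]
    refine (congrArg (fderiv ℝ fc z) (e.apply_symm_apply _)).trans ?_
    show fderiv ℝ fc z (lieBracketWithin ℝ V' W'
      (φ.symm ⁻¹' Set.univ ∩ Set.range 𝓘(ℝ, 𝔼)) z) = fderiv ℝ fc z (lieBracket ℝ V' W' z)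
    rw [Set.preimage_univ, Set.univ_inter, ModelWithCorners.range_eq_univ, lieBracketWithin_univ]
  rw [tB, lieBracket_eq, ← tV, ← tW, dV, dW, map_sub, hsymm.eq]
  abel

end Bracket

section LieGroups

open VectorField

variable {𝔼 : Type*} [NormedAddCommGroup 𝔼] [NormedSpace ℝ 𝔼] [FiniteDimensional ℝ 𝔼]
  {G : Type*} [TopologicalSpace G] [ChartedSpace 𝔼 G] [Group G] [LieGroup 𝓘(ℝ, 𝔼) ∞ G]

/-- The adjoint action `Ad(k)` of a Lie group on its Lie algebra: the derivative at the identity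
of conjugation by `k`. -/
noncomputable def adLin (k : G) : GroupLieAlgebra 𝓘(ℝ, 𝔼) G →ₗ[ℝ] GroupLieAlgebra 𝓘(ℝ, 𝔼) G :=
  (show 𝔼 →L[ℝ] 𝔼 from mfderiv 𝓘(ℝ, 𝔼) 𝓘(ℝ, 𝔼) (fun g : G => k * g * k⁻¹) 1).toLinearMap

lemma contMDiff_conj (k : G) : ContMDiff 𝓘(ℝ, 𝔼) 𝓘(ℝ, 𝔼) ∞ (fun g : G => k * g * k⁻¹) :=
  (contMDiff_mul_left (a := k)).mul contMDiff_const

lemma mdifferentiable_conj (k : G) :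
    MDifferentiable 𝓘(ℝ, 𝔼) 𝓘(ℝ, 𝔼) (fun g : G => k * g * k⁻¹) :=
  (contMDiff_conj k).mdifferentiable (by simp)

lemma mdifferentiable_mulLeft (k : G) :
    MDifferentiable 𝓘(ℝ, 𝔼) 𝓘(ℝ, 𝔼) (fun g : G => k * g) :=
  (contMDiff_mul_left (a := k) (n := ∞)).mdifferentiable (by simp)

/-- Directional derivatives of `f ∘ u` at the identity, for `u` fixing the identity. -/
lemma dirDeriv_comp_conj {F : Type*} [NormedAddCommGroup F] [NormedSpace ℝ F] {f : G → F}
    (hf : MDifferentiableAt 𝓘(ℝ, 𝔼) 𝓘(ℝ, F) f 1) (k : G) (x : GroupLieAlgebra 𝓘(ℝ, 𝔼) G) :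
    dirDeriv (fun g => f (k * g * k⁻¹)) 1 x = dirDeriv f 1 (adLin k x) := by
  have h1 : (k * 1 * k⁻¹ : G) = 1 := by simp
  have h2 : MDifferentiableAt 𝓘(ℝ, 𝔼) 𝓘(ℝ, F) f (k * 1 * k⁻¹) := by rwa [h1]
  have h3 := mfderiv_comp (1 : G) h2 (mdifferentiable_conj k 1)
  have h4 : ∀ g : G, g = 1 → ∀ y : 𝔼,
      (mfderiv 𝓘(ℝ, 𝔼) 𝓘(ℝ, F) f g : 𝔼 →L[ℝ] F) y =
        (mfderiv 𝓘(ℝ, 𝔼) 𝓘(ℝ, F) f 1 : 𝔼 →L[ℝ] F) y := by rintro g rfl y; rfl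
  exact (congrArg (fun T : 𝔼 →L[ℝ] F => T x) h3).trans (h4 _ h1 _)

lemma mpullback_conj_mulInvariantVectorField (k : G) (x : GroupLieAlgebra 𝓘(ℝ, 𝔼) G) :
    mpullback 𝓘(ℝ, 𝔼) 𝓘(ℝ, 𝔼) (fun g : G => k⁻¹ * g * k⁻¹⁻¹) (mulInvariantVectorField x) =
      mulInvariantVectorField (adLin k x) := by
  ext g
  rw [mpullback_apply]
  set c : G → G := fun g => k * g * k⁻¹
  set d : G → G := fun g => k⁻¹ * g * k⁻¹⁻¹
  have hcd : c ∘ d = id := by ext h; simp [c, d, mul_assoc]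
  have hdc : d ∘ c = id := by ext h; simp [c, d, mul_assoc]
  have hc : MDifferentiable 𝓘(ℝ, 𝔼) 𝓘(ℝ, 𝔼) c := mdifferentiable_conj k
  have hd : MDifferentiable 𝓘(ℝ, 𝔼) 𝓘(ℝ, 𝔼) d := mdifferentiable_conj k⁻¹
  -- everything takes place in the model space
  have key : ∀ y : 𝔼, (mfderiv 𝓘(ℝ, 𝔼) 𝓘(ℝ, 𝔼) d g : 𝔼 →L[ℝ] 𝔼).inverse y =
      (mfderiv 𝓘(ℝ, 𝔼) 𝓘(ℝ, 𝔼) c (d g) : 𝔼 →L[ℝ] 𝔼) y := by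
    have A : (mfderiv 𝓘(ℝ, 𝔼) 𝓘(ℝ, 𝔼) c (d g) : 𝔼 →L[ℝ] 𝔼).comp
        (mfderiv 𝓘(ℝ, 𝔼) 𝓘(ℝ, 𝔼) d g : 𝔼 →L[ℝ] 𝔼) = ContinuousLinearMap.id ℝ 𝔼 := by
      have := mfderiv_comp g (hc (d g)) (hd g)
      rw [hcd, mfderiv_id] at this
      exact this.symm
    have B : (mfderiv 𝓘(ℝ, 𝔼) 𝓘(ℝ, 𝔼) d g : 𝔼 →L[ℝ] 𝔼).comp
        (mfderiv 𝓘(ℝ, 𝔼) 𝓘(ℝ, 𝔼) c (d g) : 𝔼 →L[ℝ] 𝔼) = ContinuousLinearMap.id ℝ 𝔼 := by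
      have hg : c (d g) = g := congrFun hcd g
      have h2 : MDifferentiableAt 𝓘(ℝ, 𝔼) 𝓘(ℝ, 𝔼) d (c (d g)) := hd _
      have := mfderiv_comp (d g) h2 (hc (d g))
      rw [hdc, mfderiv_id] at this
      have h4 : ∀ h : G, h = g →
        (mfderiv 𝓘(ℝ, 𝔼) 𝓘(ℝ, 𝔼) d h : 𝔼 →L[ℝ] 𝔼) =
          (mfderiv 𝓘(ℝ, 𝔼) 𝓘(ℝ, 𝔼) d g : 𝔼 →L[ℝ] 𝔼) := by rintro h rfl; rfl
      rw [← h4 _ hg]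
      exact this.symm
    intro y
    rw [ContinuousLinearMap.inverse_eq B A]
    rfl
  refine (key _).trans ?_
  have e1 : c ∘ (fun h => d g * h) = (fun h => g * h) ∘ c := by
    ext h; simp [c, d, mul_assoc]
  have hdg : MDifferentiableAt 𝓘(ℝ, 𝔼) 𝓘(ℝ, 𝔼) c (d g * 1) := hc _
  have e2 := mfderiv_comp (1 : G) hdg (mdifferentiable_mulLeft (𝔼 := 𝔼) (d g) 1)
  have hc1 : MDifferentiableAt 𝓘(ℝ, 𝔼) 𝓘(ℝ, 𝔼) (fun h => g * h) (c 1) :=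
    mdifferentiable_mulLeft g _
  have e3 := mfderiv_comp (1 : G) hc1 (hc 1)
  rw [e1, e3] at e2
  have h5 : ∀ h h' : G, h = h' →
        (mfderiv 𝓘(ℝ, 𝔼) 𝓘(ℝ, 𝔼) c h : 𝔼 →L[ℝ] 𝔼) =
          (mfderiv 𝓘(ℝ, 𝔼) 𝓘(ℝ, 𝔼) c h' : 𝔼 →L[ℝ] 𝔼) := by rintro h _ rfl; rfl
  have h6 : ∀ h h' : G, h = h' →
        (mfderiv 𝓘(ℝ, 𝔼) 𝓘(ℝ, 𝔼) (fun a => g * a) h : 𝔼 →L[ℝ] 𝔼) =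
          (mfderiv 𝓘(ℝ, 𝔼) 𝓘(ℝ, 𝔼) (fun a => g * a) h' : 𝔼 →L[ℝ] 𝔼) := by rintro h _ rfl; rfl
  have e4 := congrArg (fun T : 𝔼 →L[ℝ] 𝔼 => T x) e2
  have e5 : (mfderiv 𝓘(ℝ, 𝔼) 𝓘(ℝ, 𝔼) c (d g) : 𝔼 →L[ℝ] 𝔼)
      ((mfderiv 𝓘(ℝ, 𝔼) 𝓘(ℝ, 𝔼) (fun h => d g * h) 1 : 𝔼 →L[ℝ] 𝔼) x) =
      (mfderiv 𝓘(ℝ, 𝔼) 𝓘(ℝ, 𝔼) (fun a => g * a) (1 : G) : 𝔼 →L[ℝ] 𝔼)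
        ((mfderiv 𝓘(ℝ, 𝔼) 𝓘(ℝ, 𝔼) c 1 : 𝔼 →L[ℝ] 𝔼) x) := by
    rw [h5 (d g) (d g * 1) (by simp), h6 1 (c 1) (by simp [c])]
    exact e4.symm
  exact e5

lemma adLin_lie (k : G) (x y : GroupLieAlgebra 𝓘(ℝ, 𝔼) G) :
    adLin k ⁅x, y⁆ = ⁅adLin k x, adLin k y⁆ := by
  have h0 : (k⁻¹ * 1 * k⁻¹⁻¹ : G) = 1 := by simp
  have h := mpullback_mlieBracket (I := 𝓘(ℝ, 𝔼)) (I' := 𝓘(ℝ, 𝔼)) (n := ∞) (x₀ := (1 : G))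
    (f := fun g : G => k⁻¹ * g * k⁻¹⁻¹)
    (V := mulInvariantVectorField x) (W := mulInvariantVectorField y)
    (mdifferentiableAt_mulInvariantVectorField _) (mdifferentiableAt_mulInvariantVectorField _)
    (contMDiff_conj k⁻¹ 1) (by rw [minSmoothness_of_isRCLikeNormedField]; exact ENat.LEInfty.out)
  rw [mpullback_conj_mulInvariantVectorField, mpullback_conj_mulInvariantVectorField,
    ← mulInvariantVector_mlieBracket, mpullback_conj_mulInvariantVectorField] at h
  rw [GroupLieAlgebra.bracket_def, GroupLieAlgebra.bracket_def, ← h]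
  have h1 : ∀ z : GroupLieAlgebra 𝓘(ℝ, 𝔼) G, mulInvariantVectorField z (1 : G) = z := by
    intro z
    have : (fun h : G => 1 * h) = id := by ext; simp
    rw [mulInvariantVectorField]
    have e : (mfderiv 𝓘(ℝ, 𝔼) 𝓘(ℝ, 𝔼) (fun h : G => 1 * h) 1 : 𝔼 →L[ℝ] 𝔼) =
        ContinuousLinearMap.id ℝ 𝔼 := by
      rw [this]; exact mfderiv_id
    exact congrArg (fun T : 𝔼 →L[ℝ] 𝔼 => T z) e
  exact (h1 _).symm

variable [T2Space G] [CompactSpace G]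
  {𝒜 : Type*} [NormedRing 𝒜] [NormedAlgebra ℝ 𝒜] [FiniteDimensional ℝ 𝒜]

/-- The differential at the identity of a continuous homomorphism from a compact Lie group to a
finite dimensional algebra is a Lie algebra homomorphism. -/
lemma dirDeriv_one_lie (R : G →* 𝒜) (hR : Continuous R) (x y : GroupLieAlgebra 𝓘(ℝ, 𝔼) G) :
    dirDeriv R 1 ⁅x, y⁆ = dirDeriv R 1 x * dirDeriv R 1 y - dirDeriv R 1 y * dirDeriv R 1 x := by
  have hs := contMDiff_of_continuous (𝔼 := 𝔼) R hR
  have hd : MDifferentiable 𝓘(ℝ, 𝔼) 𝓘(ℝ, 𝒜) R := hs.mdifferentiable (by simp)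
  have inv : ∀ (z : GroupLieAlgebra 𝓘(ℝ, 𝔼) G) (g : G),
      dirDeriv R g (mulInvariantVectorField z g) = R g * dirDeriv R 1 z := by
    intro z g
    have e0 : R ∘ (fun h => g * h) = (fun a => R g * a) ∘ R := by ext h; simp
    have hg : MDifferentiableAt 𝓘(ℝ, 𝔼) 𝓘(ℝ, 𝒜) R (g * 1) := hd _
    have e1 := mfderiv_comp (1 : G) hg (mdifferentiable_mulLeft (𝔼 := 𝔼) g 1)
    have hm : MDifferentiableAt 𝓘(ℝ, 𝒜) 𝓘(ℝ, 𝒜) (fun a : 𝒜 => R g * a) (R 1) :=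
      (((ContinuousLinearMap.mul ℝ 𝒜) (R g)).differentiableAt).mdifferentiableAt
    have e2 := mfderiv_comp (1 : G) hm (hd 1)
    have e3 : mfderiv 𝓘(ℝ, 𝒜) 𝓘(ℝ, 𝒜) (fun a : 𝒜 => R g * a) (R 1) =
        (ContinuousLinearMap.mul ℝ 𝒜) (R g) := by
      rw [mfderiv_eq_fderiv]
      exact ((ContinuousLinearMap.mul ℝ 𝒜) (R g)).fderiv
    rw [e3] at e2
    rw [e0, e2] at e1
    have h6 : ∀ h : G, h = g →
        (mfderiv 𝓘(ℝ, 𝔼) 𝓘(ℝ, 𝒜) R h : 𝔼 →L[ℝ] 𝒜) =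
          (mfderiv 𝓘(ℝ, 𝔼) 𝓘(ℝ, 𝒜) R g : 𝔼 →L[ℝ] 𝒜) := by rintro h rfl; rfl
    have e4 := congrArg (fun T : 𝔼 →L[ℝ] 𝒜 => T z) e1
    refine Eq.trans ?_ e4.symm
    refine Eq.trans ?_ (congrArg (fun T : 𝔼 →L[ℝ] 𝒜 =>
      T ((mfderiv 𝓘(ℝ, 𝔼) 𝓘(ℝ, 𝔼) (fun h => g * h) 1 : 𝔼 →L[ℝ] 𝔼) z)) (h6 _ (mul_one g))).symm
    rfl
  have hmul : ∀ a : 𝒜, MDifferentiableAt 𝓘(ℝ, 𝔼) 𝓘(ℝ, 𝒜) (fun g => R g * a) (1 : G) ∧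
      ∀ u : GroupLieAlgebra 𝓘(ℝ, 𝔼) G,
        dirDeriv (fun g => R g * a) (1 : G) u = dirDeriv R 1 u * a := by
    intro a
    have hm : MDifferentiableAt 𝓘(ℝ, 𝒜) 𝓘(ℝ, 𝒜) (fun b : 𝒜 => b * a) (R 1) :=
      (((ContinuousLinearMap.mul ℝ 𝒜).flip a).differentiableAt).mdifferentiableAt
    have e2 := mfderiv_comp (1 : G) hm (hd 1)
    have e3 : mfderiv 𝓘(ℝ, 𝒜) 𝓘(ℝ, 𝒜) (fun b : 𝒜 => b * a) (R 1) =
        (ContinuousLinearMap.mul ℝ 𝒜).flip a := by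
      rw [mfderiv_eq_fderiv]
      exact ((ContinuousLinearMap.mul ℝ 𝒜).flip a).fderiv
    rw [e3] at e2
    exact ⟨hm.comp (1 : G) (hd 1), fun u => congrArg (fun T : 𝔼 →L[ℝ] 𝒜 => T u) e2⟩
  have h1 : ∀ z : GroupLieAlgebra 𝓘(ℝ, 𝔼) G, dirDeriv R 1 (mulInvariantVectorField z (1 : G)) =
      dirDeriv R 1 z := fun z => by rw [inv z 1, map_one, one_mul]
  rw [GroupLieAlgebra.bracket_def, dirDeriv_mlieBracket (fV := fun g => R g * dirDeriv R 1 x)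
    (fW := fun g => R g * dirDeriv R 1 y) hs (mdifferentiableAt_mulInvariantVectorField _)
    (mdifferentiableAt_mulInvariantVectorField _) (hmul _).1 (hmul _).1 (inv x) (inv y)]
  have h2 : ∀ z : GroupLieAlgebra 𝓘(ℝ, 𝔼) G, mulInvariantVectorField z (1 : G) = z := by
    intro z
    have : (fun h : G => 1 * h) = id := by ext; simp
    have e : (mfderiv 𝓘(ℝ, 𝔼) 𝓘(ℝ, 𝔼) (fun h : G => 1 * h) 1 : 𝔼 →L[ℝ] 𝔼) =
        ContinuousLinearMap.id ℝ 𝔼 := by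
      rw [this]; exact mfderiv_id
    exact congrArg (fun T : 𝔼 →L[ℝ] 𝔼 => T z) e
  rw [h2, h2, (hmul _).2, (hmul _).2]

end LieGroups

section Operators

/-- The normed algebra of operators on the standard complex space of the dimension of `W`. -/
abbrev OpAlg (W : Type*) [AddCommGroup W] [Module ℂ W] : Type :=
  (Fin (Module.finrank ℂ W) → ℂ) →L[ℂ] (Fin (Module.finrank ℂ W) → ℂ)

/-- The algebra of operators on a finite dimensional complex vector space, identified with a
normed algebra by means of a basis. -/
noncomputable def opEquiv (W : Type*) [AddCommGroup W] [Module ℂ W] [FiniteDimensional ℂ W] :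
    Module.End ℂ W ≃ₐ[ℂ] OpAlg W :=
  (LinearEquiv.conjAlgEquiv ℂ (Module.finBasis ℂ W).equivFun).trans
    (Module.End.toContinuousLinearMap _)

/-- A representation on a finite dimensional space is continuous if its matrix coefficients are
continuous functions. -/
class IsContinuousRep {Γ : Type*} [TopologicalSpace Γ] [Monoid Γ] {W : Type*} [AddCommGroup W]
    [Module ℂ W] (ρ : Representation ℂ Γ W) : Prop where
  continuous_coeff : ∀ (φ : Module.Dual ℂ W) (w : W), Continuous fun g => φ (ρ g w)

variable {W : Type*} [AddCommGroup W] [Module ℂ W] [FiniteDimensional ℂ W]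

/-- A representation as a homomorphism to a normed algebra. -/
noncomputable def opHom {Γ : Type*} [Monoid Γ] (ρ : Representation ℂ Γ W) : Γ →* OpAlg W :=
  ((opEquiv W : Module.End ℂ W →* _)).comp ρ

lemma opHom_apply {Γ : Type*} [Monoid Γ] (ρ : Representation ℂ Γ W) (g : Γ) :
    opHom ρ g = opEquiv W (ρ g) := rfl

/-- The matrix coefficient functional on the operator algebra. -/
noncomputable def opCoeff (φ : Module.Dual ℂ W) (w : W) :
    OpAlg W →L[ℂ] ℂ :=
  LinearMap.toContinuousLinearMap
    (φ ∘ₗ (LinearMap.applyₗ w) ∘ₗ (opEquiv W).symm.toLinearMap)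

lemma opCoeff_apply (φ : Module.Dual ℂ W) (w : W) (T) :
    opCoeff φ w T = φ ((opEquiv W).symm T w) := rfl

lemma opEquiv_apply (T : Module.End ℂ W) (v) (i) :
    opEquiv W T v i = (Module.finBasis ℂ W).coord i
      (T ((Module.finBasis ℂ W).equivFun.symm v)) := rfl

lemma continuous_opHom {Γ : Type*} [TopologicalSpace Γ] [Monoid Γ] (ρ : Representation ℂ Γ W)
    [h : IsContinuousRep ρ] : Continuous (opHom ρ) := by
  rw [continuous_clm_apply]
  intro v
  rw [continuous_pi_iff]
  intro i
  exact h.continuous_coeff ((Module.finBasis ℂ W).coord i) _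

lemma isContinuousRep_of_opHom {Γ : Type*} [TopologicalSpace Γ] [Monoid Γ]
    (ρ : Representation ℂ Γ W) (h : Continuous (opHom ρ)) : IsContinuousRep ρ := by
  refine ⟨fun φ w => ?_⟩
  have := (opCoeff φ w).continuous.comp h
  refine this.congr fun g => ?_
  show opCoeff φ w (opEquiv W (ρ g)) = _
  rw [opCoeff_apply, AlgEquiv.symm_apply_apply]

instance {Γ : Type*} [TopologicalSpace Γ] [Group Γ] (ρ : Representation ℂ Γ W)
    [h : IsContinuousRep ρ] : IsContinuousRep ρ.dual := by
  refine ⟨fun Φ φ => ?_⟩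
  obtain ⟨w, rfl⟩ := (Module.evalEquiv ℂ W).surjective Φ
  have hc : Continuous fun g => opHom ρ g⁻¹ := by
    have h1 : ∀ g, opHom ρ g⁻¹ = Ring.inverse (opHom ρ g) := by
      intro g
      have h2 : opHom ρ g⁻¹ * opHom ρ g = 1 := by rw [← map_mul, inv_mul_cancel, map_one]
      have h3 : opHom ρ g * opHom ρ g⁻¹ = 1 := by rw [← map_mul, mul_inv_cancel, map_one]
      exact (Ring.inverse_unit (⟨_, _, h3, h2⟩ : Units _)).symm
    simp only [h1]
    rw [continuous_iff_continuousAt]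
    intro g
    refine ContinuousAt.comp (g := Ring.inverse) ?_ (continuous_opHom ρ).continuousAt
    have h2 : opHom ρ g⁻¹ * opHom ρ g = 1 := by rw [← map_mul, inv_mul_cancel, map_one]
    have h3 : opHom ρ g * opHom ρ g⁻¹ = 1 := by rw [← map_mul, mul_inv_cancel, map_one]
    exact NormedRing.inverse_continuousAt (⟨_, _, h3, h2⟩ : Units _)
  refine ((opCoeff φ w).continuous.comp hc).congr fun g => ?_
  show opCoeff φ w (opEquiv W (ρ g⁻¹)) = _
  rw [opCoeff_apply, AlgEquiv.symm_apply_apply]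
  rfl

instance {Γ Δ : Type*} [TopologicalSpace Γ] [Monoid Γ] [TopologicalSpace Δ]
    (ρ : Representation ℂ Γ W) [h : IsContinuousRep ρ] [Monoid Δ] (f : Δ →ₜ* Γ) :
    IsContinuousRep (ρ.comp (f : Δ →* Γ)) :=
  ⟨fun φ w => (h.continuous_coeff φ w).comp f.continuous_toFun⟩

end Operators

section Differential

variable {𝔼 : Type*} [NormedAddCommGroup 𝔼] [NormedSpace ℝ 𝔼] [FiniteDimensional ℝ 𝔼]
  {G : Type*} [TopologicalSpace G] [ChartedSpace 𝔼 G] [Group G] [LieGroup 𝓘(ℝ, 𝔼) ∞ G]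
  {W : Type*} [AddCommGroup W] [Module ℂ W] [FiniteDimensional ℂ W]

/-- The differential of a representation of a Lie group: `x ↦ d/ds ρ(exp(s x))` at `s = 0`. -/
noncomputable def diffRep (ρ : Representation ℂ G W) :
    GroupLieAlgebra 𝓘(ℝ, 𝔼) G →ₗ[ℝ] Module.End ℂ W :=
  ((opEquiv W).symm.toLinearMap.restrictScalars ℝ) ∘ₗ
    (show 𝔼 →L[ℝ] _ from dirDeriv (𝔼 := 𝔼) (opHom ρ) (1 : G)).toLinearMap

lemma opEquiv_diffRep (ρ : Representation ℂ G W) (x : GroupLieAlgebra 𝓘(ℝ, 𝔼) G) :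
    opEquiv W (diffRep ρ x) = dirDeriv (opHom ρ) 1 x :=
  (opEquiv W).apply_symm_apply _

variable [T2Space G] [CompactSpace G]

lemma mdifferentiable_opHom (ρ : Representation ℂ G W) [IsContinuousRep ρ] :
    MDifferentiable 𝓘(ℝ, 𝔼) 𝓘(ℝ, OpAlg W) (opHom ρ) :=
  (contMDiff_of_continuous (𝔼 := 𝔼) (opHom ρ) (continuous_opHom ρ)).mdifferentiable (by simp)

/-- The differential of a representation is given by differentiating matrix coefficients. -/
lemma coeff_diffRep (ρ : Representation ℂ G W) [IsContinuousRep ρ]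
    (x : GroupLieAlgebra 𝓘(ℝ, 𝔼) G) (φ : Module.Dual ℂ W) (w : W) :
    MDifferentiableAt 𝓘(ℝ, 𝔼) 𝓘(ℝ, ℂ) (fun g => φ (ρ g w)) (1 : G) ∧
    dirDeriv (fun g => φ (ρ g w)) 1 x = φ (diffRep ρ x w) := by
  have e : (fun g => φ (ρ g w)) = (opCoeff φ w) ∘ opHom ρ := by
    ext g
    show _ = opCoeff φ w (opEquiv W (ρ g))
    rw [opCoeff_apply, AlgEquiv.symm_apply_apply]
  have hd := mdifferentiable_opHom (𝔼 := 𝔼) ρ (1 : G)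
  have hm : MDifferentiableAt 𝓘(ℝ, OpAlg W) 𝓘(ℝ, ℂ) (opCoeff φ w) (opHom ρ (1 : G)) :=
    (((opCoeff φ w).restrictScalars ℝ).differentiableAt).mdifferentiableAt
  refine ⟨by rw [e]; exact hm.comp (1 : G) hd, ?_⟩
  have e2 := mfderiv_comp (1 : G) hm hd
  have e3 : mfderiv 𝓘(ℝ, OpAlg W) 𝓘(ℝ, ℂ) (opCoeff φ w) (opHom ρ (1 : G)) =
      (opCoeff φ w).restrictScalars ℝ := by
    rw [mfderiv_eq_fderiv]
    exact ((opCoeff φ w).restrictScalars ℝ).fderiv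
  rw [e3, ← e] at e2
  exact congrArg (fun T : 𝔼 →L[ℝ] ℂ => T x) e2

lemma diffRep_lie (ρ : Representation ℂ G W) [IsContinuousRep ρ]
    (x y : GroupLieAlgebra 𝓘(ℝ, 𝔼) G) :
    diffRep ρ ⁅x, y⁆ = diffRep ρ x * diffRep ρ y - diffRep ρ y * diffRep ρ x := by
  apply (opEquiv W).injective
  rw [map_sub, map_mul, map_mul, opEquiv_diffRep, opEquiv_diffRep, opEquiv_diffRep]
  exact dirDeriv_one_lie (opHom ρ) (continuous_opHom ρ) x y

/-- An intertwiner between representations, up to conjugation by `k`, intertwines the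
differentials up to `Ad(k)`. -/
lemma intertwine_diffRep {W' : Type*} [AddCommGroup W'] [Module ℂ W'] [FiniteDimensional ℂ W']
    (ρ : Representation ℂ G W) [IsContinuousRep ρ] (ρ' : Representation ℂ G W')
    [IsContinuousRep ρ'] (T : W →ₗ[ℂ] W') (k : G)
    (hT : ∀ h w, T (ρ h w) = ρ' (k * h * k⁻¹) (T w)) (x : GroupLieAlgebra 𝓘(ℝ, 𝔼) G) (w : W) :
    T (diffRep ρ x w) = diffRep ρ' (adLin k x) (T w) := by
  rw [← sub_eq_zero, ← Module.forall_dual_apply_eq_zero_iff ℂ]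
  intro φ
  rw [map_sub, sub_eq_zero, ← (coeff_diffRep ρ' (adLin k x) φ (T w)).2,
    ← dirDeriv_comp_conj (coeff_diffRep ρ' x φ (T w)).1,
    ← LinearMap.comp_apply, ← (coeff_diffRep ρ x (φ ∘ₗ T) w).2]
  congr 1
  simp [hT]

end Differential

section PiLie

variable {ι : Type*} {L : ι → Type*} [∀ i, LieRing (L i)]

/-- A product of Lie rings, with the componentwise bracket. -/
instance instLieRingPi : LieRing (∀ i, L i) where
  bracket x y := fun i => ⁅x i, y i⁆
  add_lie x y z := funext fun i => add_lie (x i) (y i) (z i)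
  lie_add x y z := funext fun i => lie_add (x i) (y i) (z i)
  lie_self x := funext fun i => lie_self (x i)
  leibniz_lie x y z := funext fun i => leibniz_lie (x i) (y i) (z i)

/-- A product of Lie algebras, with the componentwise bracket. -/
instance instLieAlgebraPi {R : Type*} [CommRing R] [∀ i, LieAlgebra R (L i)] :
    LieAlgebra R (∀ i, L i) where
  lie_smul c x y := funext fun i => lie_smul c (x i) (y i)

lemma pi_lie_apply (x y : ∀ i, L i) (i : ι) : ⁅x, y⁆ i = ⁅x i, y i⁆ := rfl

end PiLie

section Enveloping

/-- A linear map from a Lie algebra to an associative algebra that takes brackets to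
commutators. -/
def IsLieMap {R L A : Type*} [CommRing R] [LieRing L] [LieAlgebra R L] [Ring A] [Module R A]
    (f : L →ₗ[R] A) : Prop :=
  ∀ x y, f ⁅x, y⁆ = f x * f y - f y * f x

section

attribute [local instance 100] LieRing.ofAssociativeRing

/-- The canonical map from a Lie algebra to its universal enveloping algebra. -/
noncomputable def envι (L : Type*) [LieRing L] [LieAlgebra ℂ L] :
    L →ₗ[ℂ] UniversalEnvelopingAlgebra ℂ L :=
  (UniversalEnvelopingAlgebra.ι ℂ : L →ₗ⁅ℂ⁆ UniversalEnvelopingAlgebra ℂ L)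

lemma isLieMap_envι (L : Type*) [LieRing L] [LieAlgebra ℂ L] : IsLieMap (envι L) := by
  intro x y
  exact (LieHom.map_lie (UniversalEnvelopingAlgebra.ι ℂ) x y).trans
    (LieRing.of_associative_ring_bracket _ _)

/-- The extension of a Lie map to the universal enveloping algebra. -/
noncomputable def envLift {L A : Type*} [LieRing L] [LieAlgebra ℂ L] [Ring A] [Algebra ℂ A]
    (f : L →ₗ[ℂ] A) (hf : IsLieMap f) : UniversalEnvelopingAlgebra ℂ L →ₐ[ℂ] A :=
  UniversalEnvelopingAlgebra.lift ℂ
    { f with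
      map_lie' := fun {x y} => (hf x y).trans (LieRing.of_associative_ring_bracket _ _).symm }

lemma envLift_ι {L A : Type*} [LieRing L] [LieAlgebra ℂ L] [Ring A] [Algebra ℂ A]
    (f : L →ₗ[ℂ] A) (hf : IsLieMap f) (x : L) : envLift f hf (envι L x) = f x :=
  UniversalEnvelopingAlgebra.lift_ι_apply ℂ _ x

lemma env_hom_ext {L A : Type*} [LieRing L] [LieAlgebra ℂ L] [Ring A] [Algebra ℂ A]
    {F F' : UniversalEnvelopingAlgebra ℂ L →ₐ[ℂ] A} (h : ∀ x, F (envι L x) = F' (envι L x)) :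
    F = F' := by
  apply UniversalEnvelopingAlgebra.hom_ext
  ext x
  exact h x

end

lemma IsLieMap.algHom_comp {R L A B : Type*} [CommRing R] [LieRing L] [LieAlgebra R L] [Ring A]
    [Algebra R A] [Ring B] [Algebra R B] {f : L →ₗ[R] A} (hf : IsLieMap f) (F : A →ₐ[R] B) :
    IsLieMap (F.toLinearMap ∘ₗ f) := by
  intro x y
  simp [hf x y]

lemma IsLieMap.comp_lie {R L L' A : Type*} [CommRing R] [LieRing L] [LieAlgebra R L] [LieRing L']
    [LieAlgebra R L'] [Ring A] [Algebra R A] {f : L →ₗ[R] A} (hf : IsLieMap f) (u : L' →ₗ[R] L)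
    (hu : ∀ x y, u ⁅x, y⁆ = ⁅u x, u y⁆) : IsLieMap (f ∘ₗ u) := by
  intro x y
  simp [hu, hf (u x) (u y)]

lemma IsLieMap.coprod {R L L' A : Type*} [CommRing R] [LieRing L] [LieAlgebra R L] [LieRing L']
    [LieAlgebra R L'] [Ring A] [Algebra R A] {f : L →ₗ[R] A} {f' : L' →ₗ[R] A} (hf : IsLieMap f)
    (hf' : IsLieMap f') (hc : ∀ x y, Commute (f x) (f' y)) : IsLieMap (f.coprod f') := by
  rintro ⟨x, x'⟩ ⟨y, y'⟩
  have h1 := (hc x y').eq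
  have h2 := (hc y x').eq
  show f ⁅x, y⁆ + f' ⁅x', y'⁆ = (f x + f' x') * (f y + f' y') - (f y + f' y') * (f x + f' x')
  rw [hf, hf']
  simp only [add_mul, mul_add, h1, h2]
  abel

/-- The sum of maps `f i` out of the factors of a finite product. -/
noncomputable def sumMap {R ι A : Type*} [CommRing R] [Fintype ι] {L : ι → Type*}
    [∀ i, AddCommGroup (L i)] [∀ i, Module R (L i)] [AddCommGroup A] [Module R A]
    (f : ∀ i, L i →ₗ[R] A) : (∀ i, L i) →ₗ[R] A :=
  ∑ i, f i ∘ₗ LinearMap.proj i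

lemma sumMap_apply {R ι A : Type*} [CommRing R] [Fintype ι] {L : ι → Type*}
    [∀ i, AddCommGroup (L i)] [∀ i, Module R (L i)] [AddCommGroup A] [Module R A]
    (f : ∀ i, L i →ₗ[R] A) (x : ∀ i, L i) : sumMap f x = ∑ i, f i (x i) := by
  simp [sumMap]

lemma IsLieMap.sumMap {R ι A : Type*} [CommRing R] [Fintype ι] {L : ι → Type*}
    [∀ i, LieRing (L i)] [∀ i, LieAlgebra R (L i)] [Ring A] [Algebra R A]
    {f : ∀ i, L i →ₗ[R] A} (hf : ∀ i, IsLieMap (f i))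
    (hc : ∀ i j, i ≠ j → ∀ x y, Commute (f i x) (f j y)) : IsLieMap (sumMap f) := by
  classical
  intro x y
  have h : ∀ i j, f i (x i) * f j (y j) - f j (y j) * f i (x i) =
      if i = j then f i ⁅x i, y i⁆ else 0 := by
    intro i j
    split_ifs with hij
    · subst hij; exact (hf i _ _).symm
    · exact sub_eq_zero.2 (hc i j hij _ _).eq
  simp only [sumMap_apply, Finset.sum_mul_sum]
  rw [Finset.sum_comm (f := fun i j => f i (y i) * f j (x j)), ← Finset.sum_sub_distrib]
  simp only [← Finset.sum_sub_distrib, h, Finset.sum_ite_eq, Finset.mem_univ, if_true]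
  rfl

lemma IsLieMap.complexify {L A : Type*} [LieRing L] [LieAlgebra ℝ L] [Ring A] [Algebra ℂ A]
    [Algebra ℝ A] [IsScalarTower ℝ ℂ A] {f : L →ₗ[ℝ] A} (hf : IsLieMap f) :
    IsLieMap (f.liftBaseChange ℂ) := by
  intro x y
  induction x with
  | zero => simp
  | add x₁ x₂ h₁ h₂ => rw [add_lie, map_add, h₁, h₂, map_add]; noncomm_ring
  | tmul a x =>
    induction y with
    | zero => simp
    | add y₁ y₂ h₁ h₂ => rw [lie_add, map_add, h₁, h₂, map_add]; noncomm_ring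
    | tmul b y =>
      rw [LieAlgebra.ExtendScalars.bracket_tmul]
      simp [hf x y, smul_sub, smul_smul, mul_comm]

lemma baseChange_lie {L L' : Type*} [LieRing L] [LieAlgebra ℝ L] [LieRing L'] [LieAlgebra ℝ L']
    (u : L →ₗ[ℝ] L') (hu : ∀ x y, u ⁅x, y⁆ = ⁅u x, u y⁆) (x y : ℂ ⊗[ℝ] L) :
    u.baseChange ℂ ⁅x, y⁆ = ⁅u.baseChange ℂ x, u.baseChange ℂ y⁆ := by
  induction x with
  | zero => simp
  | add x₁ x₂ h₁ h₂ => rw [add_lie, map_add, h₁, h₂, map_add, add_lie]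
  | tmul a x =>
    induction y with
    | zero =>
      refine (congrArg _ (lie_zero (a ⊗ₜ[ℝ] x))).trans ?_
      rw [map_zero, lie_zero]
    | add y₁ y₂ h₁ h₂ =>
      refine (congrArg _ (lie_add (a ⊗ₜ[ℝ] x) y₁ y₂)).trans ?_
      rw [map_add, h₁, h₂, map_add, lie_add]
    | tmul b y =>
      simp [LieAlgebra.ExtendScalars.bracket_tmul, hu]

end Enveloping

section LieGroupEnveloping

variable (𝔼 : Type*) [NormedAddCommGroup 𝔼] [NormedSpace ℝ 𝔼] [FiniteDimensional ℝ 𝔼]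
  (G : Type*) [TopologicalSpace G] [ChartedSpace 𝔼 G] [Group G] [LieGroup 𝓘(ℝ, 𝔼) ∞ G]

/-- The complexified Lie algebra of the Lie group `G`. -/
abbrev LieC : Type _ := ℂ ⊗[ℝ] GroupLieAlgebra 𝓘(ℝ, 𝔼) G

/-- The universal enveloping algebra of the complexified Lie algebra of `G`. -/
abbrev EnvG : Type _ := UniversalEnvelopingAlgebra ℂ (LieC 𝔼 G)

variable {G}

/-- The complexified adjoint action. -/
noncomputable def adC (k : G) : LieC 𝔼 G →ₗ[ℂ] LieC 𝔼 G := (adLin (𝔼 := 𝔼) k).baseChange ℂ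

lemma adC_lie (k : G) (x y : LieC 𝔼 G) : adC 𝔼 k ⁅x, y⁆ = ⁅adC 𝔼 k x, adC 𝔼 k y⁆ :=
  baseChange_lie _ (adLin_lie k) x y

/-- The adjoint action on the enveloping algebra. -/
noncomputable def envAd (k : G) : EnvG 𝔼 G →ₐ[ℂ] EnvG 𝔼 G :=
  envLift (envι _ ∘ₗ adC 𝔼 k) ((isLieMap_envι _).comp_lie _ (adC_lie 𝔼 k))

variable [T2Space G] [CompactSpace G]
  {W : Type*} [AddCommGroup W] [Module ℂ W] [FiniteDimensional ℂ W]

/-- The complexified differential of a representation. -/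
noncomputable def diffRepC (ρ : Representation ℂ G W) : LieC 𝔼 G →ₗ[ℂ] Module.End ℂ W :=
  (diffRep (𝔼 := 𝔼) ρ).liftBaseChange ℂ

lemma isLieMap_diffRepC (ρ : Representation ℂ G W) [IsContinuousRep ρ] :
    IsLieMap (diffRepC 𝔼 ρ) :=
  IsLieMap.complexify fun x y => diffRep_lie ρ x y

/-- The action of the enveloping algebra on a finite dimensional continuous representation. -/
noncomputable def envRep (ρ : Representation ℂ G W) [IsContinuousRep ρ] :
    EnvG 𝔼 G →ₐ[ℂ] Module.End ℂ W :=
  envLift (diffRepC 𝔼 ρ) (isLieMap_diffRepC 𝔼 ρ)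

lemma intertwine_diffRepC {W' : Type*} [AddCommGroup W'] [Module ℂ W'] [FiniteDimensional ℂ W']
    (ρ : Representation ℂ G W) [IsContinuousRep ρ] (ρ' : Representation ℂ G W')
    [IsContinuousRep ρ'] (T : W →ₗ[ℂ] W') (k : G)
    (hT : ∀ h w, T (ρ h w) = ρ' (k * h * k⁻¹) (T w)) (x : LieC 𝔼 G) (w : W) :
    T (diffRepC 𝔼 ρ x w) = diffRepC 𝔼 ρ' (adC 𝔼 k x) (T w) := by
  induction x using TensorProduct.induction_on with
  | zero => simp
  | add x₁ x₂ h₁ h₂ => simp [h₁, h₂]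
  | tmul a x => simp [diffRepC, adC, intertwine_diffRep ρ ρ' T k hT]

lemma adLin_one (x : GroupLieAlgebra 𝓘(ℝ, 𝔼) G) : adLin (1 : G) x = x := by
  have e : (fun g : G => 1 * g * 1⁻¹) = id := by ext; simp
  have e' : (mfderiv 𝓘(ℝ, 𝔼) 𝓘(ℝ, 𝔼) (fun g : G => 1 * g * 1⁻¹) 1 : 𝔼 →L[ℝ] 𝔼) =
      ContinuousLinearMap.id ℝ 𝔼 := by
    rw [e]; exact mfderiv_id
  exact congrArg (fun T : 𝔼 →L[ℝ] 𝔼 => T x) e'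

/-- An operator that commutes with a representation commutes with its differential. -/
lemma commute_diffRepC (ρ : Representation ℂ G W) [IsContinuousRep ρ] (T : Module.End ℂ W)
    (hT : ∀ h, Commute T (ρ h)) (x : LieC 𝔼 G) : Commute T (diffRepC 𝔼 ρ x) := by
  ext w
  have h1 : adC 𝔼 (1 : G) x = x := by
    have : adLin (𝔼 := 𝔼) (1 : G) = LinearMap.id := LinearMap.ext (adLin_one 𝔼)
    rw [adC, this]; simp
  have := intertwine_diffRepC 𝔼 ρ ρ T 1
    (fun h w => by simpa using LinearMap.congr_fun (hT h).eq w) x w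
  rwa [h1] at this

/-- Commuting representations have commuting differentials. -/
lemma commute_diffRepC_diffRepC (ρ ρ' : Representation ℂ G W) [IsContinuousRep ρ]
    [IsContinuousRep ρ'] (h : ∀ g g', Commute (ρ g) (ρ' g')) (x y : LieC 𝔼 G) :
    Commute (diffRepC 𝔼 ρ x) (diffRepC 𝔼 ρ' y) :=
  commute_diffRepC 𝔼 ρ' _ (fun g' =>
    (commute_diffRepC 𝔼 ρ _ (fun g => (h g g').symm) x).symm) y

end LieGroupEnveloping

section Algebra

/-- An enveloping algebra is generated by its Lie algebra. -/
lemma env_induction {L : Type*} [LieRing L] [LieAlgebra ℂ L]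
    (S : Subalgebra ℂ (UniversalEnvelopingAlgebra ℂ L)) (h : ∀ x, envι L x ∈ S)
    (X : UniversalEnvelopingAlgebra ℂ L) : X ∈ S := by
  let f : L →ₗ[ℂ] S := (envι L).codRestrict (Subalgebra.toSubmodule S) h
  have hf : IsLieMap f := fun x y => Subtype.ext (isLieMap_envι L x y)
  have e : S.val.comp (envLift f hf) = AlgHom.id ℂ _ := by
    apply env_hom_ext
    intro x
    rw [AlgHom.comp_apply, envLift_ι]
    rfl
  have := congrArg (fun F : _ →ₐ[ℂ] _ => F X) e
  have h2 : ((envLift f hf X : S) : UniversalEnvelopingAlgebra ℂ L) = X := this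
  rw [← h2]
  exact (envLift f hf X).2

/-- A twisted intertwining property that holds on generators of an enveloping algebra holds
everywhere. -/
lemma env_intertwine {L : Type*} [LieRing L] [LieAlgebra ℂ L] {A W W' : Type*} [Ring A]
    [Algebra ℂ A] [AddCommGroup W] [Module ℂ W] [AddCommGroup W'] [Module ℂ W']
    (F : UniversalEnvelopingAlgebra ℂ L →ₐ[ℂ] Module.End ℂ W)
    (F' : A →ₐ[ℂ] Module.End ℂ W') (u : UniversalEnvelopingAlgebra ℂ L →ₐ[ℂ] A) (T : W →ₗ[ℂ] W')
    (h : ∀ x w, T (F (envι L x) w) = F' (u (envι L x)) (T w))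
    (X : UniversalEnvelopingAlgebra ℂ L) (w : W) : T (F X w) = F' (u X) (T w) := by
  let S : Subalgebra ℂ (UniversalEnvelopingAlgebra ℂ L) :=
    { carrier := {X | ∀ w, T (F X w) = F' (u X) (T w)}
      mul_mem' := by
        intro X Y hX hY w
        simp only [Set.mem_ofPred_eq] at hX hY
        rw [map_mul, map_mul, map_mul, Module.End.mul_apply, Module.End.mul_apply, hX, hY]
      add_mem' := by
        intro X Y hX hY w
        simp only [Set.mem_ofPred_eq] at hX hY
        simp [hX, hY]
      algebraMap_mem' := by
        intro r w
        simp [Module.algebraMap_end_apply] }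
  exact env_induction S h X w

/-- The module structure over a subalgebra `B` on a `B`-stable subspace. -/
@[reducible]
noncomputable def stableModule {A W : Type*} [Ring A] [Algebra ℂ A] [AddCommMonoid W] [Module ℂ W]
    (F : A →ₐ[ℂ] Module.End ℂ W) (B : Subalgebra ℂ A) (N : Submodule ℂ W)
    (h : ∀ b ∈ B, ∀ w ∈ N, F b w ∈ N) : Module B N where
  smul b w := ⟨F b w, h b b.2 w w.2⟩
  one_smul w := Subtype.ext (by show F 1 (w : W) = w; simp)
  mul_smul a b w := Subtype.ext (by show F (a * b : A) (w : W) = F a (F b w); simp)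
  smul_zero a := Subtype.ext (by show F a ((0 : N) : W) = (0 : N); simp)
  smul_add a w w' := Subtype.ext (by show F a ((w + w' : N) : W) = F a w + F a w'; simp)
  add_smul a b w := Subtype.ext (by show F (a + b : A) (w : W) = F a w + F b w; simp)
  zero_smul w := Subtype.ext (by show F ((0 : B) : A) (w : W) = (0 : N); simp)

end Algebra

section TensorReps

variable {ι : Type*} {Γ : ι → Type*} [∀ i, Group (Γ i)] {W : ι → Type*}
  [∀ i, AddCommGroup (W i)] [∀ i, Module ℂ (W i)]

/-- The exterior tensor product of representations of the groups `Γ i`, a representation of their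
product. -/
noncomputable def extTensorRep (ρ : ∀ i, Representation ℂ (Γ i) (W i)) :
    Representation ℂ (∀ i, Γ i) (⨂[ℂ] i, W i) where
  toFun g := PiTensorProduct.map fun i => ρ i (g i)
  map_one' := by
    simp only [Pi.one_apply, map_one]
    exact PiTensorProduct.map_one
  map_mul' g h := by
    simp only [Pi.mul_apply, map_mul]
    exact PiTensorProduct.map_mul _ _

lemma extTensorRep_tprod (ρ : ∀ i, Representation ℂ (Γ i) (W i)) (g : ∀ i, Γ i) (w : ∀ i, W i) :
    extTensorRep ρ g (⨂ₜ[ℂ] i, w i) = ⨂ₜ[ℂ] i, ρ i (g i) (w i) :=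
  PiTensorProduct.map_tprod _ _

instance [Fintype ι] [DecidableEq ι] [∀ i, FiniteDimensional ℂ (W i)]
    [∀ i, TopologicalSpace (Γ i)] (ρ : ∀ i, Representation ℂ (Γ i) (W i))
    [h : ∀ i, IsContinuousRep (ρ i)] : IsContinuousRep (extTensorRep ρ) := by
  refine ⟨fun φ w => ?_⟩
  induction w using PiTensorProduct.induction_on with
  | add x y hx hy => exact (hx.add hy).congr fun g => by simp
  | smul_tprod r w =>
    simp only [map_smul, extTensorRep_tprod, smul_eq_mul]
    refine continuous_const.mul ?_
    have e : ∀ g : ∀ i, Γ i, φ (⨂ₜ[ℂ] i, ρ i (g i) (w i)) =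
        ∑ r : ∀ i, Fin (Module.finrank ℂ (W i)),
          (∏ i, (Module.finBasis ℂ (W i)).coord (r i) (ρ i (g i) (w i))) *
            φ (⨂ₜ[ℂ] i, Module.finBasis ℂ (W i) (r i)) := by
      intro g
      have e1 : (fun i => ρ i (g i) (w i)) = fun i => ∑ j,
          (Module.finBasis ℂ (W i)).coord j (ρ i (g i) (w i)) • Module.finBasis ℂ (W i) j := by
        ext i
        exact ((Module.finBasis ℂ (W i)).sum_repr _).symm
      rw [e1, MultilinearMap.map_sum, map_sum]
      simp only [MultilinearMap.map_smul_univ, map_smul, smul_eq_mul]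
    simp only [e]
    refine continuous_finsetSum _ fun r _ => Continuous.mul ?_ continuous_const
    refine continuous_finsetProd _ fun i _ => ?_
    exact ((h i).continuous_coeff _ _).comp (continuous_apply i)

end TensorReps

section ReprFun

variable {Γ : Type*} [Group Γ] {W : Type*} [AddCommGroup W] [Module ℂ W]

/-- The matrix coefficient `c_{φ,w} : g ↦ φ(ρ(g) w)`. -/
def matrixCoeff (ρ : Representation ℂ Γ W) (φ : Module.Dual ℂ W) (w : W) : Γ → ℂ :=
  fun g => φ (ρ g w)

/-- The matrix coefficients of a representation span the space of its representative functions. -/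
def reprFun (ρ : Representation ℂ Γ W) : Submodule ℂ (Γ → ℂ) :=
  Submodule.span ℂ (Set.range fun p : Module.Dual ℂ W × W => matrixCoeff ρ p.1 p.2)

/-- Matrix coefficients as a bilinear map to the representative functions. -/
def coeffMap (ρ : Representation ℂ Γ W) : Module.Dual ℂ W →ₗ[ℂ] W →ₗ[ℂ] reprFun ρ :=
  LinearMap.mk₂ ℂ (fun φ w => ⟨matrixCoeff ρ φ w, Submodule.subset_span ⟨(φ, w), rfl⟩⟩)
    (fun φ φ' w => Subtype.ext (funext fun g => by simp [matrixCoeff]))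
    (fun c φ w => Subtype.ext (funext fun g => by simp [matrixCoeff]))
    (fun φ w w' => Subtype.ext (funext fun g => by simp [matrixCoeff]))
    (fun c φ w => Subtype.ext (funext fun g => by simp [matrixCoeff]))

lemma coeffMap_apply (ρ : Representation ℂ Γ W) (φ : Module.Dual ℂ W) (w : W) (g : Γ) :
    (coeffMap ρ φ w : Γ → ℂ) g = φ (ρ g w) := rfl

lemma reprFun_induction (ρ : Representation ℂ Γ W) {p : reprFun ρ → Prop} (f : reprFun ρ)
    (coeff : ∀ φ w, p (coeffMap ρ φ w)) (zero : p 0) (add : ∀ f f', p f → p f' → p (f + f'))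
    (smul : ∀ (c : ℂ) f, p f → p (c • f)) : p f := by
  obtain ⟨f, hf⟩ := f
  refine Submodule.span_induction (p := fun f hf => p ⟨f, hf⟩) ?_ ?_ ?_ ?_ hf
  · rintro _ ⟨⟨φ, w⟩, rfl⟩
    exact coeff φ w
  · exact zero
  · intro f f' _ _ h h'
    exact add _ _ h h'
  · intro c f _ h
    exact smul c _ h

instance [FiniteDimensional ℂ W] (ρ : Representation ℂ Γ W) :
    FiniteDimensional ℂ (reprFun ρ) := by
  have : Function.Surjective (TensorProduct.lift (coeffMap ρ)) := by
    rw [← LinearMap.range_eq_top, eq_top_iff]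
    intro f _
    refine reprFun_induction ρ f ?_ ?_ ?_ ?_
    · exact fun φ w => ⟨φ ⊗ₜ w, by simp⟩
    · exact Submodule.zero_mem _
    · exact fun _ _ => Submodule.add_mem _
    · exact fun c _ => Submodule.smul_mem _ c
  exact Module.Finite.of_surjective _ this

/-- The two-sided translation `f ↦ f(h⁻¹ · h')`. -/
def biReg (ρ : Representation ℂ Γ W) : Representation ℂ (Γ × Γ) (reprFun ρ) where
  toFun h := LinearMap.restrict
    (LinearMap.funLeft ℂ ℂ fun g => h.1⁻¹ * g * h.2) (by
      intro f hf
      have : reprFun ρ ≤ (reprFun ρ).comap (LinearMap.funLeft ℂ ℂ fun g => h.1⁻¹ * g * h.2) := by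
        refine Submodule.span_le.2 ?_
        rintro _ ⟨⟨φ, w⟩, rfl⟩
        refine Submodule.subset_span ⟨(ρ.dual h.1 φ, ρ h.2 w), ?_⟩
        ext g
        simp [matrixCoeff, LinearMap.funLeft, map_mul, Module.Dual.transpose_apply]
      exact this hf)
  map_one' := by
    ext f g
    simp [LinearMap.funLeft, LinearMap.restrict_apply]
  map_mul' h h' := by
    ext f g
    simp [LinearMap.funLeft, LinearMap.restrict_apply, mul_assoc]

lemma biReg_apply (ρ : Representation ℂ Γ W) (h : Γ × Γ) (f : reprFun ρ) (g : Γ) :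
    (biReg ρ h f : Γ → ℂ) g = (f : Γ → ℂ) (h.1⁻¹ * g * h.2) := rfl

lemma biReg_coeffMap (ρ : Representation ℂ Γ W) (h : Γ × Γ) (φ : Module.Dual ℂ W) (w : W) :
    biReg ρ h (coeffMap ρ φ w) = coeffMap ρ (ρ.dual h.1 φ) (ρ h.2 w) := by
  ext g
  simp [biReg_apply, coeffMap_apply, Module.Dual.transpose_apply]

instance [TopologicalSpace Γ] [FiniteDimensional ℂ W] (ρ : Representation ℂ Γ W)
    [hρ : IsContinuousRep ρ] : IsContinuousRep (biReg ρ) := by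
  refine ⟨fun Φ f => ?_⟩
  refine reprFun_induction ρ (p := fun f => Continuous fun g => Φ (biReg ρ g f)) f ?_ ?_ ?_ ?_
  · intro φ w
    have e : ∀ h : Γ × Γ, Φ (biReg ρ h (coeffMap ρ φ w)) = ∑ i,
        (Module.finBasis ℂ W).coord i (ρ h.2 w) *
          (Φ ∘ₗ (coeffMap ρ).flip (Module.finBasis ℂ W i)) (ρ.dual h.1 φ) := by
      intro h
      rw [biReg_coeffMap]
      conv_lhs => rw [← (Module.finBasis ℂ W).sum_repr (ρ h.2 w)]
      simp only [map_sum, map_smul, smul_eq_mul]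
      rfl
    simp only [e]
    refine continuous_finsetSum _ fun i _ => Continuous.mul ?_ ?_
    · exact (hρ.continuous_coeff _ _).comp continuous_snd
    · exact (IsContinuousRep.continuous_coeff (ρ := ρ.dual) _ _).comp continuous_fst
  · simpa using continuous_const
  · intro f f' h h'
    exact (h.add h').congr fun g => by simp
  · intro c f h
    exact ((continuous_const (y := c)).mul h).congr fun g => by simp

end ReprFun

section Global

variable (𝔼 : Type*) [NormedAddCommGroup 𝔼] [NormedSpace ℝ 𝔼] [FiniteDimensional ℝ 𝔼]
  {G : Type*} [TopologicalSpace G] [ChartedSpace 𝔼 G] [Group G] [LieGroup 𝓘(ℝ, 𝔼) ∞ G]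
  {V E : Type*} [Fintype E] [DecidableEq E]

/-- The inclusion `h ↦ (h at e, 1)` of `G` in `G^E × G^E`. -/
def edgeLeft (G : Type*) [Group G] [TopologicalSpace G] (e : E) : G →ₜ* (E → G) × (E → G) where
  toFun h := (Pi.mulSingle e h, 1)
  map_one' := by simp
  map_mul' h h' := by simp [Pi.mulSingle_mul]
  continuous_toFun := (continuous_mulSingle (A := fun _ => G) e).prodMk continuous_const

/-- The inclusion `h ↦ (1, h at e)` of `G` in `G^E × G^E`. -/
def edgeRight (G : Type*) [Group G] [TopologicalSpace G] (e : E) : G →ₜ* (E → G) × (E → G) where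
  toFun h := (1, Pi.mulSingle e h)
  map_one' := by simp
  map_mul' h h' := by simp [Pi.mulSingle_mul]
  continuous_toFun := continuous_const.prodMk (continuous_mulSingle (A := fun _ => G) e)

/-- The Lie algebra `𝔤^E × 𝔤^E`. -/
abbrev LieE (𝔼 : Type*) [NormedAddCommGroup 𝔼] [NormedSpace ℝ 𝔼] [FiniteDimensional ℝ 𝔼]
    (G : Type*) [TopologicalSpace G] [ChartedSpace 𝔼 G] [Group G] [LieGroup 𝓘(ℝ, 𝔼) ∞ G]
    (E : Type*) : Type _ :=
  (E → LieC 𝔼 G) × (E → LieC 𝔼 G)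

/-- The universal enveloping algebra of `𝔤^E × 𝔤^E`. -/
abbrev EnvE (𝔼 : Type*) [NormedAddCommGroup 𝔼] [NormedSpace ℝ 𝔼] [FiniteDimensional ℝ 𝔼]
    (G : Type*) [TopologicalSpace G] [ChartedSpace 𝔼 G] [Group G] [LieGroup 𝓘(ℝ, 𝔼) ∞ G]
    (E : Type*) : Type _ :=
  UniversalEnvelopingAlgebra ℂ (LieE 𝔼 G E)

section Derivatives

variable [T2Space G] [CompactSpace G]
  {W : Type*} [AddCommGroup W] [Module ℂ W] [FiniteDimensional ℂ W]
  (ρ : Representation ℂ (E → G) W) [IsContinuousRep ρ]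

/-- The translations `f ↦ f(h⁻¹ · )` in the variable `g_e`. -/
noncomputable def leftEdgeRep (e : E) : Representation ℂ G (reprFun ρ) :=
  (biReg ρ).comp (edgeLeft G e : G →* (E → G) × (E → G))

/-- The translations `f ↦ f( · h)` in the variable `g_e`. -/
noncomputable def rightEdgeRep (e : E) : Representation ℂ G (reprFun ρ) :=
  (biReg ρ).comp (edgeRight G e : G →* (E → G) × (E → G))

instance (e : E) : IsContinuousRep (leftEdgeRep ρ e) := by
  unfold leftEdgeRep; infer_instance

instance (e : E) : IsContinuousRep (rightEdgeRep ρ e) := by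
  unfold rightEdgeRep; infer_instance

lemma leftEdgeRep_apply (e : E) (h : G) (f : reprFun ρ) (g : E → G) :
    (leftEdgeRep ρ e h f : (E → G) → ℂ) g = (f : (E → G) → ℂ) ((Pi.mulSingle e h)⁻¹ * g) := by
  show (f : (E → G) → ℂ) ((Pi.mulSingle e h)⁻¹ * g * 1) = _
  rw [mul_one]

lemma rightEdgeRep_apply (e : E) (h : G) (f : reprFun ρ) (g : E → G) :
    (rightEdgeRep ρ e h f : (E → G) → ℂ) g = (f : (E → G) → ℂ) (g * Pi.mulSingle e h) := by
  show (f : (E → G) → ℂ) (1⁻¹ * g * Pi.mulSingle e h) = _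
  rw [inv_one, one_mul]

/-- The function `D_{(x,y)} f`, with `D_{(x,y)} f (g) = d/ds f(exp(-s x) g exp(s y))` at `s = 0`
for real `x` and `y`, extended complex linearly to the complexified Lie algebra. It is the sum of
the derivatives in the two arguments of `f(h⁻¹ g h')`, edge by edge. -/
noncomputable def twoSidedDeriv : LieE 𝔼 G E →ₗ[ℂ] Module.End ℂ (reprFun ρ) :=
  (sumMap fun e => diffRepC 𝔼 (leftEdgeRep ρ e)).coprod
    (sumMap fun e => diffRepC 𝔼 (rightEdgeRep ρ e))

/-- Pointwise description of the derivatives in the edge variables. -/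
lemma diffRep_edgeRep_apply (e : E) (x : GroupLieAlgebra 𝓘(ℝ, 𝔼) G) (f : reprFun ρ) (g : E → G) :
    (diffRep (leftEdgeRep ρ e) x f : (E → G) → ℂ) g =
        dirDeriv (fun h : G => (f : (E → G) → ℂ) ((Pi.mulSingle e h)⁻¹ * g)) 1 x ∧
      (diffRep (rightEdgeRep ρ e) x f : (E → G) → ℂ) g =
        dirDeriv (fun h : G => (f : (E → G) → ℂ) (g * Pi.mulSingle e h)) 1 x := by
  let ev : Module.Dual ℂ (reprFun ρ) := (LinearMap.proj g) ∘ₗ (reprFun ρ).subtype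
  have h1 := (coeff_diffRep (leftEdgeRep ρ e) x ev f).2
  have h2 := (coeff_diffRep (rightEdgeRep ρ e) x ev f).2
  have e1 : (fun h => ev (leftEdgeRep ρ e h f)) =
      fun h : G => (f : (E → G) → ℂ) ((Pi.mulSingle e h)⁻¹ * g) :=
    funext fun h => leftEdgeRep_apply ρ e h f g
  have e2 : (fun h => ev (rightEdgeRep ρ e h f)) =
      fun h : G => (f : (E → G) → ℂ) (g * Pi.mulSingle e h) :=
    funext fun h => rightEdgeRep_apply ρ e h f g
  rw [e1] at h1
  rw [e2] at h2
  exact ⟨h1.symm, h2.symm⟩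

lemma isLieMap_twoSidedDeriv : IsLieMap (R := ℂ) (L := LieE 𝔼 G E)
    (A := Module.End ℂ (reprFun ρ)) (twoSidedDeriv 𝔼 ρ) := by
  have hcomm : ∀ a b : (E → G) × (E → G), Commute a b → Commute (biReg ρ a) (biReg ρ b) :=
    fun a b h => by rw [commute_iff_eq, ← map_mul, h.eq, map_mul]
  have hs : ∀ {i j : E}, i ≠ j → ∀ h h' : G,
      Commute (Pi.mulSingle i h : E → G) (Pi.mulSingle j h') :=
    fun hij h h' => Pi.mulSingle_commute (f := fun _ => G) hij h h'
  have hL : ∀ e e', e ≠ e' → ∀ x y, Commute (diffRepC 𝔼 (leftEdgeRep ρ e) x)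
      (diffRepC 𝔼 (leftEdgeRep ρ e') y) := by
    intro e e' he x y
    refine commute_diffRepC_diffRepC 𝔼 (leftEdgeRep ρ e) (leftEdgeRep ρ e') (fun h h' => ?_) x y
    exact hcomm (Pi.mulSingle e h, 1) (Pi.mulSingle e' h', 1)
      (Prod.ext (hs he h h') (Commute.one_left 1))
  have hR : ∀ e e', e ≠ e' → ∀ x y, Commute (diffRepC 𝔼 (rightEdgeRep ρ e) x)
      (diffRepC 𝔼 (rightEdgeRep ρ e') y) := by
    intro e e' he x y
    refine commute_diffRepC_diffRepC 𝔼 (rightEdgeRep ρ e) (rightEdgeRep ρ e') (fun h h' => ?_) x y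
    exact hcomm (1, Pi.mulSingle e h) (1, Pi.mulSingle e' h')
      (Prod.ext (Commute.one_left 1) (hs he h h'))
  have hLR : ∀ e e', ∀ x y, Commute (diffRepC 𝔼 (leftEdgeRep ρ e) x)
      (diffRepC 𝔼 (rightEdgeRep ρ e') y) := by
    intro e e' x y
    refine commute_diffRepC_diffRepC 𝔼 (leftEdgeRep ρ e) (rightEdgeRep ρ e') (fun h h' => ?_) x y
    exact hcomm (Pi.mulSingle e h, 1) (1, Pi.mulSingle e' h')
      (Prod.ext (Commute.one_right _) (Commute.one_left _))
  refine IsLieMap.coprod (IsLieMap.sumMap (fun e => isLieMap_diffRepC 𝔼 _) hL)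
    (IsLieMap.sumMap (fun e => isLieMap_diffRepC 𝔼 _) hR) fun x y => ?_
  rw [sumMap_apply, sumMap_apply]
  exact Commute.sum_left _ _ _ fun i _ => Commute.sum_right _ _ _ fun j _ => hLR i j _ _

/-- The action of `U(𝔤^E × 𝔤^E)` on representative functions by differential operators. -/
noncomputable def envFun : EnvE 𝔼 G E →ₐ[ℂ] Module.End ℂ (reprFun ρ) :=
  envLift (L := LieE 𝔼 G E) (A := Module.End ℂ (reprFun ρ)) (twoSidedDeriv 𝔼 ρ)
    (isLieMap_twoSidedDeriv 𝔼 ρ)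

end Derivatives

section Gauge

variable (s t : E → V) (K : V → Subgroup G)

/-- The homomorphism `k ↦ ((k_{s(e)})_e, (k_{t(e)})_e)` from the gauge group to `G^E × G^E`. -/
def gaugePair : (∀ v, K v) →* (E → G) × (E → G) where
  toFun k := (fun e => k (s e), fun e => k (t e))
  map_one' := rfl
  map_mul' _ _ := rfl

/-- The gauge action `(k · f)(g) = f(k⁻¹ · g)` on representative functions, where
`(k · g)_e = k_{s(e)} g_e k_{t(e)}⁻¹`. -/
noncomputable def gaugeRep {W : Type*} [AddCommGroup W] [Module ℂ W]
    (ρ : Representation ℂ (E → G) W) : Representation ℂ (∀ v, K v) (reprFun ρ) :=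
  (biReg ρ).comp (gaugePair s t K)

lemma gaugeRep_apply {W : Type*} [AddCommGroup W] [Module ℂ W]
    (ρ : Representation ℂ (E → G) W) (k : ∀ v, K v) (f : reprFun ρ) (g : E → G) :
    (gaugeRep s t K ρ k f : (E → G) → ℂ) g =
      (f : (E → G) → ℂ) fun e => (k (s e) : G)⁻¹ * g e * (k (t e) : G) := rfl

/-- The action of `k` on `𝔤^E × 𝔤^E` by `Ad(k_{s(e)})` and `Ad(k_{t(e)})`. -/
noncomputable def gaugeLie (k : ∀ v, K v) : LieE 𝔼 G E →ₗ[ℂ] LieE 𝔼 G E :=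
  LinearMap.prodMap (LinearMap.pi fun e => adC 𝔼 (k (s e) : G) ∘ₗ LinearMap.proj e)
    (LinearMap.pi fun e => adC 𝔼 (k (t e) : G) ∘ₗ LinearMap.proj e)

lemma gaugeLie_lie (k : ∀ v, K v) (x y : LieE 𝔼 G E) :
    gaugeLie 𝔼 s t K k ⁅x, y⁆ = ⁅gaugeLie 𝔼 s t K k x, gaugeLie 𝔼 s t K k y⁆ :=
  Prod.ext (funext fun e => adC_lie 𝔼 (k (s e) : G) (x.1 e) (y.1 e))
    (funext fun e => adC_lie 𝔼 (k (t e) : G) (x.2 e) (y.2 e))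

/-- The gauge action on `U(𝔤^E × 𝔤^E)` by algebra automorphisms. -/
noncomputable def envGauge (k : ∀ v, K v) : EnvE 𝔼 G E →ₐ[ℂ] EnvE 𝔼 G E :=
  envLift (envι _ ∘ₗ gaugeLie 𝔼 s t K k)
    ((isLieMap_envι _).comp_lie _ (gaugeLie_lie 𝔼 s t K k))

/-- The algebra `U(𝔤^E × 𝔤^E)^K` of gauge invariant elements. -/
noncomputable def envInv : Subalgebra ℂ (EnvE 𝔼 G E) :=
  ⨅ k : ∀ v, K v, AlgHom.equalizer (envGauge 𝔼 s t K k) (AlgHom.id ℂ _)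

lemma mem_envInv {X : EnvE 𝔼 G E} : X ∈ envInv 𝔼 s t K ↔ ∀ k, envGauge 𝔼 s t K k X = X := by
  simp [envInv, Algebra.mem_iInf]

variable [T2Space G] [CompactSpace G]
  {W : Type*} [AddCommGroup W] [Module ℂ W] [FiniteDimensional ℂ W]
  (ρ : Representation ℂ (E → G) W) [IsContinuousRep ρ]

lemma gaugeRep_envFun (k : ∀ v, K v) (X : EnvE 𝔼 G E) (f : reprFun ρ) :
    gaugeRep s t K ρ k (envFun 𝔼 ρ X f) =
      envFun 𝔼 ρ (envGauge 𝔼 s t K k X) (gaugeRep s t K ρ k f) := by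
  refine env_intertwine (envFun 𝔼 ρ) (envFun 𝔼 ρ) (envGauge 𝔼 s t K k)
    (gaugeRep s t K ρ k) ?_ X f
  rintro ⟨x, y⟩ f
  rw [envGauge, envLift_ι, LinearMap.comp_apply, envFun, envLift_ι, envLift_ι]
  have hconj : ∀ (c : E → G) (e : E) (h : G),
      c * Pi.mulSingle e h = Pi.mulSingle e (c e * h * (c e)⁻¹) * c := by
    intro c e h
    ext i
    by_cases hi : i = e
    · subst hi; simp
    · simp [Pi.mulSingle_eq_of_ne hi]
  have hL : ∀ e, gaugeRep s t K ρ k (diffRepC 𝔼 (leftEdgeRep ρ e) (x e) f) =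
      diffRepC 𝔼 (leftEdgeRep ρ e) (adC 𝔼 (k (s e) : G) (x e)) (gaugeRep s t K ρ k f) := by
    intro e
    refine intertwine_diffRepC 𝔼 _ _ (gaugeRep s t K ρ k) (k (s e) : G) (fun h w => ?_) _ _
    have : gaugePair s t K k * edgeLeft G e h =
        edgeLeft G e ((k (s e) : G) * h * (k (s e) : G)⁻¹) * gaugePair s t K k :=
      Prod.ext (hconj _ e h) ((mul_one _).trans (one_mul _).symm)
    have h2 := congrArg (biReg ρ) this
    rw [map_mul, map_mul] at h2
    exact LinearMap.congr_fun h2 w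
  have hR : ∀ e, gaugeRep s t K ρ k (diffRepC 𝔼 (rightEdgeRep ρ e) (y e) f) =
      diffRepC 𝔼 (rightEdgeRep ρ e) (adC 𝔼 (k (t e) : G) (y e)) (gaugeRep s t K ρ k f) := by
    intro e
    refine intertwine_diffRepC 𝔼 _ _ (gaugeRep s t K ρ k) (k (t e) : G) (fun h w => ?_) _ _
    have : gaugePair s t K k * edgeRight G e h =
        edgeRight G e ((k (t e) : G) * h * (k (t e) : G)⁻¹) * gaugePair s t K k :=
      Prod.ext ((mul_one _).trans (one_mul _).symm) (hconj _ e h)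
    have h2 := congrArg (biReg ρ) this
    rw [map_mul, map_mul] at h2
    exact LinearMap.congr_fun h2 w
  simp only [twoSidedDeriv, LinearMap.coprod_apply, sumMap_apply, LinearMap.add_apply,
    LinearMap.sum_apply, map_add, map_sum, hL, hR]
  rfl

variable {S : V → Type*} [∀ v, AddCommGroup (S v)] [∀ v, Module ℂ (S v)]
  (σ : ∀ v, Representation ℂ (K v) (S v))

/-- The space `R ⊗ ⨂_v S_v`, where `R` is the space of representative functions of `ρ`. -/
def SpinSpace {W : Type*} [AddCommGroup W] [Module ℂ W] (ρ : Representation ℂ (E → G) W)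
    (S : V → Type*) [∀ v, AddCommGroup (S v)] [∀ v, Module ℂ (S v)] : Type _ :=
  reprFun ρ ⊗[ℂ] (⨂[ℂ] v, S v)

noncomputable instance instAddCommGroupSpinSpace : AddCommGroup (SpinSpace ρ S) :=
  inferInstanceAs (AddCommGroup (reprFun ρ ⊗[ℂ] (⨂[ℂ] v, S v)))

noncomputable instance instModuleSpinSpace : Module ℂ (SpinSpace ρ S) :=
  inferInstanceAs (Module ℂ (reprFun ρ ⊗[ℂ] (⨂[ℂ] v, S v)))

/-- The identity map between `SpinSpace ρ S` and the underlying tensor product. -/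
noncomputable def spinEquiv (S : V → Type*) [∀ v, AddCommGroup (S v)] [∀ v, Module ℂ (S v)] :
    (reprFun ρ ⊗[ℂ] (⨂[ℂ] v, S v)) ≃ₗ[ℂ] SpinSpace ρ S :=
  LinearEquiv.refl ℂ (reprFun ρ ⊗[ℂ] (⨂[ℂ] v, S v))

/-- The gauge action on `R ⊗ ⨂_v S_v`. -/
noncomputable def gaugeSpinRep : Representation ℂ (∀ v, K v) (SpinSpace ρ S) :=
  ((spinEquiv ρ S).conjAlgEquiv ℂ : _ →* Module.End ℂ (SpinSpace ρ S)).comp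
    (Representation.tprod (gaugeRep s t K ρ) (extTensorRep σ))

lemma gaugeSpinRep_tmul (k : ∀ v, K v) (f : reprFun ρ) (u : ⨂[ℂ] v, S v) :
    gaugeSpinRep s t K ρ σ k (spinEquiv ρ S (f ⊗ₜ[ℂ] u)) =
      spinEquiv ρ S (gaugeRep s t K ρ k f ⊗ₜ[ℂ] extTensorRep σ k u) := rfl

/-- The gauge invariant elements of `R ⊗ ⨂_v S_v`. -/
noncomputable def gaugeInvariants : Submodule ℂ (SpinSpace ρ S) :=
  Representation.invariants (V := SpinSpace ρ S) (gaugeSpinRep s t K ρ σ)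

/-- The action of `U(𝔤^E × 𝔤^E)` on `R ⊗ ⨂_v S_v` through the first factor. -/
noncomputable def envFunTensor (S : V → Type*) [∀ v, AddCommGroup (S v)] [∀ v, Module ℂ (S v)] :
    EnvE 𝔼 G E →ₐ[ℂ] Module.End ℂ (SpinSpace ρ S) :=
  ((spinEquiv ρ S).conjAlgEquiv ℂ).toAlgHom.comp <|
    (Module.End.rTensorAlgHom ℂ (reprFun ρ) (⨂[ℂ] v, S v)).comp (envFun 𝔼 ρ)

lemma envFunTensor_tmul (X : EnvE 𝔼 G E) (f : reprFun ρ) (u : ⨂[ℂ] v, S v) :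
    envFunTensor 𝔼 ρ S X (spinEquiv ρ S (f ⊗ₜ[ℂ] u)) =
      spinEquiv ρ S ((envFun 𝔼 ρ X f) ⊗ₜ[ℂ] u) := rfl

lemma envFunTensor_mem (X : EnvE 𝔼 G E) (hX : X ∈ envInv 𝔼 s t K) (f : SpinSpace ρ S)
    (hf : f ∈ gaugeInvariants s t K ρ σ) :
    envFunTensor 𝔼 ρ S X f ∈ gaugeInvariants s t K ρ σ := by
  intro k
  have key : ∀ f : SpinSpace ρ S,
      gaugeSpinRep s t K ρ σ k (envFunTensor 𝔼 ρ S X f) =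
        envFunTensor 𝔼 ρ S X (gaugeSpinRep s t K ρ σ k f) := by
    intro f
    obtain ⟨f, rfl⟩ := (spinEquiv ρ S).surjective f
    induction f using TensorProduct.induction_on with
    | zero => simp
    | add f f' h h' => simp only [map_add, h, h']
    | tmul f u =>
      rw [envFunTensor_tmul, gaugeSpinRep_tmul, gaugeSpinRep_tmul, envFunTensor_tmul,
        gaugeRep_envFun, (mem_envInv 𝔼 s t K).1 hX k]
  rw [key, hf k]

noncomputable instance instModuleGaugeInvariants :
    Module (envInv 𝔼 s t K) (gaugeInvariants s t K ρ σ) :=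
  stableModule (envFunTensor 𝔼 ρ S) (envInv 𝔼 s t K) (gaugeInvariants s t K ρ σ)
    (envFunTensor_mem 𝔼 s t K ρ σ)

noncomputable instance instSMulGaugeInvariants :
    SMul (envInv 𝔼 s t K) (gaugeInvariants s t K ρ σ) :=
  (instModuleGaugeInvariants 𝔼 s t K ρ σ).toSMul

lemma coe_envInv_smul (X : envInv 𝔼 s t K) (f : gaugeInvariants s t K ρ σ) :
    ((X • f : gaugeInvariants s t K ρ σ) : SpinSpace ρ S) =
      envFunTensor 𝔼 ρ S (X : EnvE 𝔼 G E) f := rfl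

end Gauge

end Global

section TensorAlgebra

variable {ι : Type*} {A B : ι → Type*} [∀ i, Ring (A i)] [∀ i, Algebra ℂ (A i)]
  [∀ i, Ring (B i)] [∀ i, Algebra ℂ (B i)] {W : ι → Type*} [∀ i, AddCommGroup (W i)]
  [∀ i, Module ℂ (W i)]

/-- The factorwise action of a tensor product of algebras on a tensor product of modules. -/
noncomputable def piAct (F : ∀ i, A i →ₐ[ℂ] Module.End ℂ (W i)) :
    (⨂[ℂ] i, A i) →ₐ[ℂ] Module.End ℂ (⨂[ℂ] i, W i) :=
  PiTensorProduct.liftAlgHom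
    ((PiTensorProduct.mapMultilinear ℂ W W).compLinearMap fun i => (F i).toLinearMap)
    (by
      show PiTensorProduct.map (fun i => F i 1) = 1
      simp only [map_one]
      exact PiTensorProduct.map_one)
    (fun x y => by
      show PiTensorProduct.map (fun i => F i (x i * y i)) =
        PiTensorProduct.map (fun i => F i (x i)) * PiTensorProduct.map (fun i => F i (y i))
      simp only [map_mul]
      exact PiTensorProduct.map_mul _ _)

lemma piAct_tprod (F : ∀ i, A i →ₐ[ℂ] Module.End ℂ (W i)) (a : ∀ i, A i) (w : ∀ i, W i) :
    piAct F (⨂ₜ[ℂ] i, a i) (⨂ₜ[ℂ] i, w i) = ⨂ₜ[ℂ] i, F i (a i) (w i) := by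
  have : piAct F (⨂ₜ[ℂ] i, a i) = PiTensorProduct.map (fun i => F i (a i)) :=
    PiTensorProduct.lift.tprod _
  rw [this, PiTensorProduct.map_tprod]

/-- The tensor product of algebra homomorphisms. -/
noncomputable def piMapAlg (u : ∀ i, A i →ₐ[ℂ] B i) : (⨂[ℂ] i, A i) →ₐ[ℂ] (⨂[ℂ] i, B i) :=
  PiTensorProduct.liftAlgHom
    ((PiTensorProduct.tprod ℂ).compLinearMap fun i => (u i).toLinearMap)
    (by
      show (⨂ₜ[ℂ] i, u i 1) = 1
      simp only [map_one]
      rfl)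
    (fun x y => by
      show (⨂ₜ[ℂ] i, u i (x i * y i)) = (⨂ₜ[ℂ] i, u i (x i)) * (⨂ₜ[ℂ] i, u i (y i))
      simp only [map_mul]
      exact (PiTensorProduct.tprod_mul_tprod _ _).symm)

lemma piMapAlg_tprod (u : ∀ i, A i →ₐ[ℂ] B i) (a : ∀ i, A i) :
    piMapAlg u (⨂ₜ[ℂ] i, a i) = ⨂ₜ[ℂ] i, u i (a i) :=
  PiTensorProduct.lift.tprod _

lemma piAct_intertwine (F : ∀ i, A i →ₐ[ℂ] Module.End ℂ (W i))
    (F' : ∀ i, B i →ₐ[ℂ] Module.End ℂ (W i)) (u : ∀ i, A i →ₐ[ℂ] B i)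
    (T : ∀ i, W i →ₗ[ℂ] W i) (h : ∀ i a w, T i (F i a w) = F' i (u i a) (T i w))
    (X : ⨂[ℂ] i, A i) (w : ⨂[ℂ] i, W i) :
    PiTensorProduct.map T (piAct F X w) = piAct F' (piMapAlg u X) (PiTensorProduct.map T w) := by
  induction X using PiTensorProduct.induction_on with
  | add X Y hX hY => simp only [map_add, LinearMap.add_apply, hX, hY]
  | smul_tprod r a =>
    induction w using PiTensorProduct.induction_on with
    | add w w' h h' => simp only [map_add, h, h']
    | smul_tprod r' w =>
      simp only [map_smul, LinearMap.smul_apply, piAct_tprod, piMapAlg_tprod,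
        PiTensorProduct.map_tprod, h]

/-- Elements of different factors of a tensor product of algebras commute. -/
lemma commute_singleAlgHom [DecidableEq ι] {i j : ι} (hij : i ≠ j) (a : A i) (b : A j) :
    Commute (PiTensorProduct.singleAlgHom (R := ℂ) i a)
      (PiTensorProduct.singleAlgHom (R := ℂ) j b) := by
  rw [PiTensorProduct.singleAlgHom_apply, PiTensorProduct.singleAlgHom_apply]
  exact Commute.map (Pi.mulSingle_commute hij a b) (PiTensorProduct.tprodMonoidHom ℂ)

/-- Postcomposition with endomorphisms. -/
def postcomp (S W : Type*) [AddCommGroup S] [Module ℂ S] [AddCommGroup W] [Module ℂ W] :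
    Module.End ℂ W →ₐ[ℂ] Module.End ℂ (S →ₗ[ℂ] W) :=
  AlgHom.ofLinearMap (LinearMap.llcomp ℂ S W W) rfl (fun _ _ => rfl)

lemma postcomp_apply {S W : Type*} [AddCommGroup S] [Module ℂ S] [AddCommGroup W] [Module ℂ W]
    (T : Module.End ℂ W) (φ : S →ₗ[ℂ] W) : postcomp S W T φ = T ∘ₗ φ := rfl

end TensorAlgebra

section Local

variable (𝔼 : Type*) [NormedAddCommGroup 𝔼] [NormedSpace ℝ 𝔼] [FiniteDimensional ℝ 𝔼]
  {G : Type*} [TopologicalSpace G] [ChartedSpace 𝔼 G] [Group G] [LieGroup 𝓘(ℝ, 𝔼) ∞ G]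
  {V E : Type*} [Fintype E] [DecidableEq E]
  (s t : E → V) (K : V → Subgroup G)
  {S : V → Type*} [∀ v, AddCommGroup (S v)] [∀ v, Module ℂ (S v)]
  (σ : ∀ v, Representation ℂ (K v) (S v))
  {M : E → Type*} [∀ e, AddCommGroup (M e)] [∀ e, Module ℂ (M e)]
  (π : ∀ e, Representation ℂ G (M e))

/-- The space `⨂_{s(e) = v} M_e^* ⊗ ⨂_{t(e) = v} M_e` attached to the star of the vertex `v`. -/
def StarSpace (M : E → Type*) [∀ e, AddCommGroup (M e)] [∀ e, Module ℂ (M e)] (v : V) :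
    Type _ :=
  (⨂[ℂ] e : {e // s e = v}, Module.Dual ℂ (M e)) ⊗[ℂ] (⨂[ℂ] e : {e // t e = v}, M e)

noncomputable instance instAddCommGroupStarSpace (v : V) : AddCommGroup (StarSpace s t M v) :=
  inferInstanceAs (AddCommGroup
    ((⨂[ℂ] e : {e // s e = v}, Module.Dual ℂ (M e)) ⊗[ℂ] (⨂[ℂ] e : {e // t e = v}, M e)))

noncomputable instance instModuleStarSpace (v : V) : Module ℂ (StarSpace s t M v) :=
  inferInstanceAs (Module ℂ
    ((⨂[ℂ] e : {e // s e = v}, Module.Dual ℂ (M e)) ⊗[ℂ] (⨂[ℂ] e : {e // t e = v}, M e)))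

/-- The identity map between the space attached to a star and the underlying tensor product. -/
noncomputable def starEquiv (M : E → Type*) [∀ e, AddCommGroup (M e)] [∀ e, Module ℂ (M e)]
    (v : V) :
    ((⨂[ℂ] e : {e // s e = v}, Module.Dual ℂ (M e)) ⊗[ℂ] (⨂[ℂ] e : {e // t e = v}, M e)) ≃ₗ[ℂ]
      StarSpace s t M v :=
  LinearEquiv.refl ℂ
    ((⨂[ℂ] e : {e // s e = v}, Module.Dual ℂ (M e)) ⊗[ℂ] (⨂[ℂ] e : {e // t e = v}, M e))

/-- The diagonal action of `K_v` on the space attached to the star of `v`. -/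
noncomputable def starRep (v : V) : Representation ℂ (K v) (StarSpace s t M v) :=
  ((starEquiv s t M v).conjAlgEquiv ℂ : _ →* Module.End ℂ (StarSpace s t M v)).comp
    (Representation.tprod
      ((extTensorRep fun e : {e // s e = v} => (π e).dual).comp
        (MonoidHom.pi fun _ => (K v).subtype))
      ((extTensorRep fun e : {e // t e = v} => π e).comp (MonoidHom.pi fun _ => (K v).subtype)))

/-- The space `Hom(S_v^*, M^{S(v)})`. -/
abbrev StarHom (S : V → Type*) [∀ v, AddCommGroup (S v)] [∀ v, Module ℂ (S v)]
    (M : E → Type*) [∀ e, AddCommGroup (M e)] [∀ e, Module ℂ (M e)] (v : V) : Type _ :=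
  Module.Dual ℂ (S v) →ₗ[ℂ] StarSpace s t M v

/-- The action of `K_v` on `Hom(S_v^*, M^{S(v)})` by conjugation. -/
noncomputable def homRep (v : V) : Representation ℂ (K v) (StarHom s t S M v) :=
  Representation.linHom (σ v).dual (starRep s t K π v)

/-- The local intertwiner space `Hom_{K_v}(S_v^*, M^{S(v)})`. -/
noncomputable def LocalHom (v : V) : Submodule ℂ (StarHom s t S M v) :=
  Representation.invariants (V := StarHom s t S M v) (homRep s t K σ π v)

/-- The algebra `U(𝔤)^{(v)} = ⨂_{s(e) = v} U(𝔤) ⊗ ⨂_{t(e) = v} U(𝔤)`. -/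
def StarEnv (𝔼 : Type*) [NormedAddCommGroup 𝔼] [NormedSpace ℝ 𝔼] [FiniteDimensional ℝ 𝔼]
    (G : Type*) [TopologicalSpace G] [ChartedSpace 𝔼 G] [Group G] [LieGroup 𝓘(ℝ, 𝔼) ∞ G]
    (s t : E → V) (v : V) : Type _ :=
  (⨂[ℂ] _ : {e // s e = v}, EnvG 𝔼 G) ⊗[ℂ] (⨂[ℂ] _ : {e // t e = v}, EnvG 𝔼 G)

noncomputable instance instRingStarEnv (v : V) : Ring (StarEnv 𝔼 G s t v) :=
  inferInstanceAs (Ring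
    ((⨂[ℂ] _ : {e // s e = v}, EnvG 𝔼 G) ⊗[ℂ] (⨂[ℂ] _ : {e // t e = v}, EnvG 𝔼 G)))

noncomputable instance instAlgebraStarEnv (v : V) : Algebra ℂ (StarEnv 𝔼 G s t v) :=
  inferInstanceAs (Algebra ℂ
    ((⨂[ℂ] _ : {e // s e = v}, EnvG 𝔼 G) ⊗[ℂ] (⨂[ℂ] _ : {e // t e = v}, EnvG 𝔼 G)))

/-- The identity map between `U(𝔤)^{(v)}` and the underlying tensor product of algebras. -/
noncomputable def starEnvEquiv (v : V) :
    ((⨂[ℂ] _ : {e // s e = v}, EnvG 𝔼 G) ⊗[ℂ] (⨂[ℂ] _ : {e // t e = v}, EnvG 𝔼 G)) ≃ₐ[ℂ]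
      StarEnv 𝔼 G s t v :=
  AlgEquiv.refl (R := ℂ)
    (A₁ := (⨂[ℂ] _ : {e // s e = v}, EnvG 𝔼 G) ⊗[ℂ] (⨂[ℂ] _ : {e // t e = v}, EnvG 𝔼 G))

/-- The diagonal adjoint action of `k` on `U(𝔤)^{(v)}`. -/
noncomputable def starAd (v : V) (k : K v) : StarEnv 𝔼 G s t v →ₐ[ℂ] StarEnv 𝔼 G s t v :=
  (starEnvEquiv 𝔼 s t v).toAlgHom.comp <|
    (Algebra.TensorProduct.map (piMapAlg fun _ => envAd 𝔼 (k : G))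
      (piMapAlg fun _ => envAd 𝔼 (k : G))).comp (starEnvEquiv 𝔼 s t v).symm.toAlgHom

lemma starAd_tmul (v : V) (k : K v) (X : ⨂[ℂ] _ : {e // s e = v}, EnvG 𝔼 G)
    (Y : ⨂[ℂ] _ : {e // t e = v}, EnvG 𝔼 G) :
    starAd 𝔼 s t K v k (starEnvEquiv 𝔼 s t v (X ⊗ₜ Y)) =
      starEnvEquiv 𝔼 s t v (piMapAlg (fun _ => envAd 𝔼 (k : G)) X ⊗ₜ
        piMapAlg (fun _ => envAd 𝔼 (k : G)) Y) := rfl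

/-- The algebra `(U(𝔤)^{(v)})^{K_v}`. -/
noncomputable def starInv (v : V) : Subalgebra ℂ (StarEnv 𝔼 G s t v) :=
  ⨅ k : K v, AlgHom.equalizer (starAd 𝔼 s t K v k) (AlgHom.id ℂ _)

lemma mem_starInv {v : V} {X : StarEnv 𝔼 G s t v} :
    X ∈ starInv 𝔼 s t K v ↔ ∀ k, starAd 𝔼 s t K v k X = X := by
  simp [starInv, Algebra.mem_iInf]

variable [T2Space G] [CompactSpace G] [∀ e, FiniteDimensional ℂ (M e)]
  [∀ e, IsContinuousRep (π e)]

lemma envRep_intertwine {W : Type*} [AddCommGroup W] [Module ℂ W] [FiniteDimensional ℂ W]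
    (ρ : Representation ℂ G W) [IsContinuousRep ρ] (k : G) (X : EnvG 𝔼 G) (w : W) :
    ρ k (envRep 𝔼 ρ X w) = envRep 𝔼 ρ (envAd 𝔼 k X) (ρ k w) := by
  refine env_intertwine (envRep 𝔼 ρ) (envRep 𝔼 ρ) (envAd 𝔼 k) (ρ k) (fun x w => ?_) X w
  rw [envAd, envLift_ι, LinearMap.comp_apply, envRep, envLift_ι, envLift_ι]
  refine intertwine_diffRepC 𝔼 ρ ρ (ρ k) k (fun h w => ?_) x w
  rw [← Module.End.mul_apply, ← Module.End.mul_apply, ← map_mul, ← map_mul]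
  simp

/-- The factorwise action of `U(𝔤)^{(v)}` on the space attached to the star of `v`. -/
noncomputable def starAct (v : V) : StarEnv 𝔼 G s t v →ₐ[ℂ] Module.End ℂ (StarSpace s t M v) :=
  ((starEquiv s t M v).conjAlgEquiv ℂ).toAlgHom.comp <|
    (Module.endTensorEndAlgHom (R := ℂ) (S := ℂ) (A := ℂ)).comp <|
    (Algebra.TensorProduct.map
      (piAct fun e : {e // s e = v} => envRep 𝔼 (π e).dual)
      (piAct fun e : {e // t e = v} => envRep 𝔼 (π e))).comp (starEnvEquiv 𝔼 s t v).symm.toAlgHom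

lemma starAct_tmul (v : V) (X : ⨂[ℂ] _ : {e // s e = v}, EnvG 𝔼 G)
    (Y : ⨂[ℂ] _ : {e // t e = v}, EnvG 𝔼 G) (a b) :
    starAct 𝔼 s t π v (starEnvEquiv 𝔼 s t v (X ⊗ₜ Y)) (starEquiv s t M v (a ⊗ₜ b)) =
      starEquiv s t M v ((piAct (fun e : {e // s e = v} => envRep 𝔼 (π e).dual) X a) ⊗ₜ
      (piAct (fun e : {e // t e = v} => envRep 𝔼 (π e)) Y b)) := rfl

lemma starAct_intertwine (v : V) (k : K v) (X : StarEnv 𝔼 G s t v) (m : StarSpace s t M v) :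
    starRep s t K π v k (starAct 𝔼 s t π v X m) =
      starAct 𝔼 s t π v (starAd 𝔼 s t K v k X) (starRep s t K π v k m) := by
  obtain ⟨X, rfl⟩ := (starEnvEquiv 𝔼 s t v).surjective X
  induction X using TensorProduct.induction_on with
  | zero => simp
  | add X Y hX hY => simp only [map_add, LinearMap.add_apply, hX, hY]
  | tmul X Y =>
    obtain ⟨m, rfl⟩ := (starEquiv s t M v).surjective m
    induction m using TensorProduct.induction_on with
    | zero => simp
    | add m m' h h' => simp only [map_add, h, h']
    | tmul a b =>
      have h1 := piAct_intertwine (fun e : {e // s e = v} => envRep 𝔼 (π e).dual)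
        (fun e : {e // s e = v} => envRep 𝔼 (π e).dual) (fun _ => envAd 𝔼 (k : G))
        (fun e => (π e).dual (k : G))
        (fun e X w => envRep_intertwine 𝔼 (π e).dual (k : G) X w) X a
      have h2 := piAct_intertwine (fun e : {e // t e = v} => envRep 𝔼 (π e))
        (fun e : {e // t e = v} => envRep 𝔼 (π e)) (fun _ => envAd 𝔼 (k : G))
        (fun e => (π e) (k : G))
        (fun e X w => envRep_intertwine 𝔼 (π e) (k : G) X w) Y b
      exact congrArg₂ (fun p q => starEquiv s t M v (p ⊗ₜ[ℂ] q)) h1 h2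

/-- The action of `U(𝔤)^{(v)}` on `Hom(S_v^*, M^{S(v)})` through the codomain. -/
noncomputable def homAct (S : V → Type*) [∀ v, AddCommGroup (S v)] [∀ v, Module ℂ (S v)] (v : V) :
    StarEnv 𝔼 G s t v →ₐ[ℂ] Module.End ℂ (StarHom s t S M v) :=
  (postcomp (Module.Dual ℂ (S v)) (StarSpace s t M v)).comp (starAct 𝔼 s t π v)

lemma homAct_intertwine (v : V) (k : K v) (X : StarEnv 𝔼 G s t v) (φ : StarHom s t S M v) :
    homRep s t K σ π v k (homAct 𝔼 s t π S v X φ) =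
      homAct 𝔼 s t π S v (starAd 𝔼 s t K v k X) (homRep s t K σ π v k φ) :=
  LinearMap.ext fun u => starAct_intertwine 𝔼 s t K π v k X (φ ((σ v).dual k⁻¹ u))

lemma homAct_mem (v : V) (X : StarEnv 𝔼 G s t v) (hX : X ∈ starInv 𝔼 s t K v)
    (φ : StarHom s t S M v) (hφ : φ ∈ LocalHom s t K σ π v) :
    homAct 𝔼 s t π S v X φ ∈ LocalHom s t K σ π v := by
  intro k
  rw [homAct_intertwine, (mem_starInv 𝔼 s t K).1 hX k, hφ k]

noncomputable instance instModuleLocalHom (v : V) :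
    Module (starInv 𝔼 s t K v) (LocalHom s t K σ π v) :=
  stableModule (homAct 𝔼 s t π S v) (starInv 𝔼 s t K v) (LocalHom s t K σ π v)
    (homAct_mem 𝔼 s t K σ π v)

noncomputable instance instSMulLocalHom (v : V) :
    SMul (starInv 𝔼 s t K v) (LocalHom s t K σ π v) :=
  (instModuleLocalHom 𝔼 s t K σ π v).toSMul

lemma coe_starInv_smul (v : V) (X : starInv 𝔼 s t K v) (φ : LocalHom s t K σ π v) :
    ((X • φ : LocalHom s t K σ π v) : StarHom s t S M v) =
      starAct 𝔼 s t π v (X : StarEnv 𝔼 G s t v) ∘ₗ (φ : StarHom s t S M v) := rfl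

end Local

section InvariantsOfTensors

variable {ι : Type*} [Fintype ι] [DecidableEq ι] {Γ : ι → Type*} [∀ i, Group (Γ i)]
  {W : ι → Type*} [∀ i, AddCommGroup (W i)] [∀ i, Module ℂ (W i)]

lemma dualDistrib_map (T : ∀ i, W i →ₗ[ℂ] W i) (φ : ∀ i, Module.Dual ℂ (W i))
    (z : ⨂[ℂ] i, W i) :
    PiTensorProduct.dualDistrib (⨂ₜ[ℂ] i, φ i) (PiTensorProduct.map T z) =
      PiTensorProduct.dualDistrib (⨂ₜ[ℂ] i, (φ i ∘ₗ T i)) z := by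
  induction z using PiTensorProduct.induction_on with
  | add x y hx hy => simp only [map_add, hx, hy]
  | smul_tprod r w =>
    simp [PiTensorProduct.dualDistrib_apply, PiTensorProduct.map_tprod]

lemma mapIncl_injective (N : ∀ i, Submodule ℂ (W i)) :
    Function.Injective (PiTensorProduct.mapIncl N) := by
  have h : ∀ i, ∃ q : W i →ₗ[ℂ] N i, q ∘ₗ (N i).subtype = LinearMap.id :=
    fun i => (N i).subtype.exists_leftInverse_of_injective (N i).ker_subtype
  choose q hq using h
  have e : PiTensorProduct.map q ∘ₗ PiTensorProduct.mapIncl N = LinearMap.id := by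
    rw [PiTensorProduct.mapIncl, ← PiTensorProduct.map_comp]
    simp only [hq]
    exact PiTensorProduct.map_id
  exact Function.LeftInverse.injective fun x => LinearMap.congr_fun e x

lemma map_mapIncl (N : ∀ i, Submodule ℂ (W i)) (T : ∀ i, W i →ₗ[ℂ] W i)
    (hT : ∀ i, ∀ w ∈ N i, T i w = w) (z : ⨂[ℂ] i, N i) :
    PiTensorProduct.map T (PiTensorProduct.mapIncl N z) = PiTensorProduct.mapIncl N z := by
  rw [PiTensorProduct.mapIncl, ← LinearMap.comp_apply, ← PiTensorProduct.map_comp]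
  congr 2
  ext1 i
  exact LinearMap.ext fun w => hT i w w.2

variable [∀ i, FiniteDimensional ℂ (W i)]

lemma eq_of_dualDistrib {z z' : ⨂[ℂ] i, W i}
    (h : ∀ φ : ∀ i, Module.Dual ℂ (W i), PiTensorProduct.dualDistrib (⨂ₜ[ℂ] i, φ i) z =
      PiTensorProduct.dualDistrib (⨂ₜ[ℂ] i, φ i) z') : z = z' := by
  let b := Basis.piTensorProduct fun i => Module.finBasis ℂ (W i)
  have key : ∀ (p) (z : ⨂[ℂ] i, W i), b.repr z p =
      PiTensorProduct.dualDistrib (⨂ₜ[ℂ] i, (Module.finBasis ℂ (W i)).coord (p i)) z := by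
    intro p z
    induction z using PiTensorProduct.induction_on with
    | add x y hx hy => simp only [map_add, Finsupp.add_apply, hx, hy]
    | smul_tprod r w =>
      simp [b, PiTensorProduct.dualDistrib_apply, Basis.piTensorProduct_repr_tprod_apply]
  exact b.ext_elem fun p => by rw [key, key, h]

/-- The invariants of an exterior tensor product are the tensor product of the invariants. -/
lemma extTensorRep_invariants_le (ρ : ∀ i, Representation ℂ (Γ i) (W i)) (N : ∀ i, Submodule ℂ (W i))
    (hN : ∀ i w, (∀ g, ρ i g w = w) → w ∈ N i) (z : ⨂[ℂ] i, W i)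
    (hz : ∀ g, extTensorRep ρ g z = z) : z ∈ LinearMap.range (PiTensorProduct.mapIncl N) := by
  have h : ∀ i, ∃ q : W i →ₗ[ℂ] N i, q ∘ₗ (N i).subtype = LinearMap.id :=
    fun i => (N i).subtype.exists_leftInverse_of_injective (N i).ker_subtype
  choose q hq using h
  let Q : ∀ i, W i →ₗ[ℂ] W i := fun i => (N i).subtype ∘ₗ q i
  have hQ : ∀ i, ∀ w ∈ N i, Q i w = w := by
    intro i w hw
    have := LinearMap.congr_fun (hq i) ⟨w, hw⟩
    exact congrArg Subtype.val this
  let Φ : MultilinearMap ℂ (fun i => Module.Dual ℂ (W i)) ℂ :=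
    ((LinearMap.applyₗ z).comp PiTensorProduct.dualDistrib).compMultilinearMap
      (PiTensorProduct.tprod ℂ)
  have hΦ : ∀ φ, Φ φ = PiTensorProduct.dualDistrib (⨂ₜ[ℂ] i, φ i) z := fun φ => rfl
  -- one factor can be projected to the invariants
  have step : ∀ (j : ι) (φ : ∀ i, Module.Dual ℂ (W i)),
      Φ (Function.update φ j (φ j ∘ₗ Q j)) = Φ φ := by
    intro j φ
    obtain ⟨w, hw⟩ := (Module.evalEquiv ℂ (W j)).surjective (Φ.toLinearMap φ j)
    have hw' : ∀ ψ : Module.Dual ℂ (W j), ψ w = Φ (Function.update φ j ψ) := fun ψ =>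
      LinearMap.congr_fun hw ψ
    have hinv : w ∈ N j := by
      refine hN j w fun g => ?_
      rw [← sub_eq_zero, ← Module.forall_dual_apply_eq_zero_iff ℂ]
      intro ψ
      rw [map_sub, sub_eq_zero]
      have e1 := hw' (ψ ∘ₗ ρ j g)
      rw [LinearMap.comp_apply] at e1
      rw [e1, hw', hΦ, hΦ]
      conv_rhs => rw [← hz (Pi.mulSingle j g)]
      refine Eq.trans ?_ (dualDistrib_map (fun i => ρ i (Pi.mulSingle (M := Γ) j g i)) _ z).symm
      congr 2
      apply congrArg
      ext1 i
      by_cases hi : i = j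
      · subst hi; simp
      · rw [Function.update_of_ne hi, Function.update_of_ne hi, Pi.mulSingle_eq_of_ne hi, map_one]
        rfl
    rw [← hw', LinearMap.comp_apply, hQ j w hinv, hw', Function.update_eq_self]
  have all : ∀ (s : Finset ι) (φ : ∀ i, Module.Dual ℂ (W i)),
      Φ (fun i => if i ∈ s then φ i ∘ₗ Q i else φ i) = Φ φ := by
    intro s
    induction s using Finset.induction_on with
    | empty => intro φ; simp
    | insert j s hj ih =>
      intro φ
      rw [← step j φ, ← ih (Function.update φ j (φ j ∘ₗ Q j))]
      congr 1
      ext1 i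
      by_cases hi : i = j
      · subst hi; simp [hj]
      · simp [hi]
  have hfix : PiTensorProduct.map Q z = z := by
    refine eq_of_dualDistrib fun φ => ?_
    rw [dualDistrib_map]
    have := all Finset.univ φ
    simpa [hΦ] using this
  rw [← hfix]
  refine ⟨PiTensorProduct.map q z, ?_⟩
  rw [PiTensorProduct.mapIncl, ← LinearMap.comp_apply, ← PiTensorProduct.map_comp]

end InvariantsOfTensors

section PullbackModule

variable {A W N : Type*} [Ring A] [Algebra ℂ A] [AddCommGroup W] [Module ℂ W] [AddCommGroup N]
  [Module ℂ N] (F : A →ₐ[ℂ] Module.End ℂ W) (B : Subalgebra ℂ A) (i : N →ₗ[ℂ] W)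

/-- The action of `b` on `N`, where `N` is embedded by `i` as a `b`-stable subspace. -/
noncomputable def pullbackSMul (h : ∀ b ∈ B, ∀ n, ∃ n', i n' = F b (i n)) (b : B) (n : N) : N :=
  (h b b.2 n).choose

/-- The module structure over a subalgebra `B` on a space `N` that is embedded by `i` as a
`B`-stable subspace. -/
@[reducible]
noncomputable def pullbackModule (hi : Function.Injective i)
    (h : ∀ b ∈ B, ∀ n, ∃ n', i n' = F b (i n)) : Module B N :=
  have key : ∀ (b : B) (n : N), i (pullbackSMul F B i h b n) = F b (i n) := fun b n =>
    (h b b.2 n).choose_spec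
  { smul := pullbackSMul F B i h
    one_smul := fun n => hi ((key 1 n).trans (by simp))
    mul_smul := fun a b n => hi <| by
      refine (key (a * b) n).trans (Eq.trans ?_ (key a (pullbackSMul F B i h b n)).symm)
      rw [key b n]
      simp
    smul_zero := fun a => hi ((key a 0).trans (by simp))
    smul_add := fun a n n' => hi <| by
      refine (key a (n + n')).trans ?_
      rw [map_add, map_add, map_add]
      exact congrArg₂ _ (key a n).symm (key a n').symm
    add_smul := fun a b n => hi <| by
      refine (key (a + b) n).trans ?_
      rw [map_add]
      refine Eq.trans ?_ (congrArg₂ _ (key a n).symm (key b n).symm)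
      simp
    zero_smul := fun n => hi ((key 0 n).trans (by simp)) }

end PullbackModule

section TensorSide

variable (𝔼 : Type*) [NormedAddCommGroup 𝔼] [NormedSpace ℝ 𝔼] [FiniteDimensional ℝ 𝔼]
  {G : Type*} [TopologicalSpace G] [ChartedSpace 𝔼 G] [Group G] [LieGroup 𝓘(ℝ, 𝔼) ∞ G]
  {V E : Type*} [Fintype V] [DecidableEq V] [Fintype E] [DecidableEq E]
  (s t : E → V) (K : V → Subgroup G)
  {S : V → Type*} [∀ v, AddCommGroup (S v)] [∀ v, Module ℂ (S v)]
  (σ : ∀ v, Representation ℂ (K v) (S v))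
  {M : E → Type*} [∀ e, AddCommGroup (M e)] [∀ e, Module ℂ (M e)]
  (π : ∀ e, Representation ℂ G (M e))

lemma piMapAlg_single {ι : Type*} [DecidableEq ι] {A B : ι → Type*} [∀ i, Ring (A i)]
    [∀ i, Algebra ℂ (A i)] [∀ i, Ring (B i)] [∀ i, Algebra ℂ (B i)] (u : ∀ i, A i →ₐ[ℂ] B i)
    (i : ι) (a : A i) :
    piMapAlg u (PiTensorProduct.singleAlgHom (R := ℂ) i a) =
      PiTensorProduct.singleAlgHom (R := ℂ) i (u i a) := by
  rw [PiTensorProduct.singleAlgHom_apply, PiTensorProduct.singleAlgHom_apply, piMapAlg_tprod]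
  congr 1
  ext1 j
  by_cases hj : j = i
  · subst hj; simp
  · simp [Pi.mulSingle_eq_of_ne hj]

/-- The inclusion of `U(𝔤)` in `U(𝔤)^{(v)}` as the factor of an edge that starts at `v`. -/
noncomputable def sourceStar (v : V) (e : {e // s e = v}) : EnvG 𝔼 G →ₐ[ℂ] StarEnv 𝔼 G s t v :=
  (starEnvEquiv 𝔼 s t v).toAlgHom.comp
    ((Algebra.TensorProduct.includeLeft (R := ℂ) (S := ℂ)
        (A := ⨂[ℂ] _ : {e // s e = v}, EnvG 𝔼 G) (B := ⨂[ℂ] _ : {e // t e = v}, EnvG 𝔼 G)).comp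
      (PiTensorProduct.singleAlgHom (R := ℂ) (A := fun _ : {e // s e = v} => EnvG 𝔼 G) e))

/-- The inclusion of `U(𝔤)` in `U(𝔤)^{(v)}` as the factor of an edge that ends at `v`. -/
noncomputable def targetStar (v : V) (e : {e // t e = v}) : EnvG 𝔼 G →ₐ[ℂ] StarEnv 𝔼 G s t v :=
  (starEnvEquiv 𝔼 s t v).toAlgHom.comp
    ((Algebra.TensorProduct.includeRight (R := ℂ)
        (A := ⨂[ℂ] _ : {e // s e = v}, EnvG 𝔼 G) (B := ⨂[ℂ] _ : {e // t e = v}, EnvG 𝔼 G)).comp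
      (PiTensorProduct.singleAlgHom (R := ℂ) (A := fun _ : {e // t e = v} => EnvG 𝔼 G) e))

lemma commute_sourceStar (v : V) {e e' : {e // s e = v}} (he : e ≠ e') (X Y : EnvG 𝔼 G) :
    Commute (sourceStar 𝔼 s t v e X) (sourceStar 𝔼 s t v e' Y) := by
  have h := commute_singleAlgHom (A := fun _ : {e // s e = v} => EnvG 𝔼 G) he X Y
  have h2 := h.map (Algebra.TensorProduct.includeLeft (R := ℂ) (S := ℂ)
    (A := ⨂[ℂ] _ : {e // s e = v}, EnvG 𝔼 G) (B := ⨂[ℂ] _ : {e // t e = v}, EnvG 𝔼 G))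
  exact h2.map (starEnvEquiv 𝔼 s t v)

lemma commute_targetStar (v : V) {e e' : {e // t e = v}} (he : e ≠ e') (X Y : EnvG 𝔼 G) :
    Commute (targetStar 𝔼 s t v e X) (targetStar 𝔼 s t v e' Y) := by
  have h := commute_singleAlgHom (A := fun _ : {e // t e = v} => EnvG 𝔼 G) he X Y
  have h2 := h.map (Algebra.TensorProduct.includeRight (R := ℂ)
    (A := ⨂[ℂ] _ : {e // s e = v}, EnvG 𝔼 G) (B := ⨂[ℂ] _ : {e // t e = v}, EnvG 𝔼 G))
  exact h2.map (starEnvEquiv 𝔼 s t v)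

lemma commute_sourceStar_targetStar (v : V) (e : {e // s e = v}) (e' : {e // t e = v})
    (X Y : EnvG 𝔼 G) : Commute (sourceStar 𝔼 s t v e X) (targetStar 𝔼 s t v e' Y) := by
  have h : ∀ (a : ⨂[ℂ] _ : {e // s e = v}, EnvG 𝔼 G) (b : ⨂[ℂ] _ : {e // t e = v}, EnvG 𝔼 G),
      Commute (a ⊗ₜ[ℂ] (1 : ⨂[ℂ] _ : {e // t e = v}, EnvG 𝔼 G))
        ((1 : ⨂[ℂ] _ : {e // s e = v}, EnvG 𝔼 G) ⊗ₜ[ℂ] b) := by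
    intro a b
    show _ * _ = _ * _
    rw [Algebra.TensorProduct.tmul_mul_tmul, Algebra.TensorProduct.tmul_mul_tmul, one_mul, mul_one,
      one_mul, mul_one]
  exact (h _ _).map (starEnvEquiv 𝔼 s t v)

/-- The inclusion of `U(𝔤)` in `⨂_v U(𝔤)^{(v)}` as the factor of an edge that starts at `v`. -/
noncomputable def sourceIncl (v : V) (e : {e // s e = v}) :
    EnvG 𝔼 G →ₐ[ℂ] ⨂[ℂ] v, StarEnv 𝔼 G s t v :=
  (PiTensorProduct.singleAlgHom (R := ℂ) (A := fun v => StarEnv 𝔼 G s t v) v).comp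
    (sourceStar 𝔼 s t v e)

/-- The inclusion of `U(𝔤)` in `⨂_v U(𝔤)^{(v)}` as the factor of an edge that ends at `v`. -/
noncomputable def targetIncl (v : V) (e : {e // t e = v}) :
    EnvG 𝔼 G →ₐ[ℂ] ⨂[ℂ] v, StarEnv 𝔼 G s t v :=
  (PiTensorProduct.singleAlgHom (R := ℂ) (A := fun v => StarEnv 𝔼 G s t v) v).comp
    (targetStar 𝔼 s t v e)

/-- The map `𝔤^E × 𝔤^E → ⨂_v U(𝔤)^{(v)}` that sends the `e`-th component of the first (second)
argument to the factor of `e` in the star of `s(e)` (of `t(e)`). -/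
noncomputable def distribLie : LieE 𝔼 G E →ₗ[ℂ] ⨂[ℂ] v, StarEnv 𝔼 G s t v :=
  (sumMap fun e => (sourceIncl 𝔼 (G := G) s t (s e) ⟨e, rfl⟩).toLinearMap ∘ₗ envι _).coprod
    (sumMap fun e => (targetIncl 𝔼 (G := G) s t (t e) ⟨e, rfl⟩).toLinearMap ∘ₗ envι _)

lemma isLieMap_distribLie : IsLieMap (R := ℂ) (L := LieE 𝔼 G E)
    (A := ⨂[ℂ] v, StarEnv 𝔼 G s t v) (distribLie 𝔼 s t) := by
  have hS : ∀ (v v' : V) (e : {e // s e = v}) (e' : {e // s e = v'}), e.1 ≠ e'.1 →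
      ∀ X Y : EnvG 𝔼 G, Commute (sourceIncl 𝔼 s t v e X) (sourceIncl 𝔼 s t v' e' Y) := by
    intro v v' e e' he X Y
    by_cases hv : v = v'
    · subst hv
      exact (commute_sourceStar 𝔼 s t v (fun h => he (congrArg Subtype.val h)) X Y).map
        (PiTensorProduct.singleAlgHom (R := ℂ) (A := fun v => StarEnv 𝔼 G s t v) v)
    · exact commute_singleAlgHom (A := fun v => StarEnv 𝔼 G s t v) hv
        (sourceStar 𝔼 s t v e X) (sourceStar 𝔼 s t v' e' Y)
  have hT : ∀ (v v' : V) (e : {e // t e = v}) (e' : {e // t e = v'}), e.1 ≠ e'.1 →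
      ∀ X Y : EnvG 𝔼 G, Commute (targetIncl 𝔼 s t v e X) (targetIncl 𝔼 s t v' e' Y) := by
    intro v v' e e' he X Y
    by_cases hv : v = v'
    · subst hv
      exact (commute_targetStar 𝔼 s t v (fun h => he (congrArg Subtype.val h)) X Y).map
        (PiTensorProduct.singleAlgHom (R := ℂ) (A := fun v => StarEnv 𝔼 G s t v) v)
    · exact commute_singleAlgHom (A := fun v => StarEnv 𝔼 G s t v) hv
        (targetStar 𝔼 s t v e X) (targetStar 𝔼 s t v' e' Y)
  have hST : ∀ (v v' : V) (e : {e // s e = v}) (e' : {e // t e = v'}),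
      ∀ X Y : EnvG 𝔼 G, Commute (sourceIncl 𝔼 s t v e X) (targetIncl 𝔼 s t v' e' Y) := by
    intro v v' e e' X Y
    by_cases hv : v = v'
    · subst hv
      exact (commute_sourceStar_targetStar 𝔼 s t v e e' X Y).map
        (PiTensorProduct.singleAlgHom (R := ℂ) (A := fun v => StarEnv 𝔼 G s t v) v)
    · exact commute_singleAlgHom (A := fun v => StarEnv 𝔼 G s t v) hv
        (sourceStar 𝔼 s t v e X) (targetStar 𝔼 s t v' e' Y)
  refine IsLieMap.coprod
    (IsLieMap.sumMap (fun e => (isLieMap_envι _).algHom_comp _)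
      fun e e' he x y => hS _ _ ⟨e, rfl⟩ ⟨e', rfl⟩ he _ _)
    (IsLieMap.sumMap (fun e => (isLieMap_envι _).algHom_comp _)
      fun e e' he x y => hT _ _ ⟨e, rfl⟩ ⟨e', rfl⟩ he _ _) fun x y => ?_
  rw [sumMap_apply, sumMap_apply]
  exact Commute.sum_left _ _ _ fun i _ => Commute.sum_right _ _ _ fun j _ => hST _ _ _ _ _ _

/-- The canonical isomorphism `U(𝔤^E × 𝔤^E) → ⨂_v U(𝔤)^{(v)}`, as a homomorphism. -/
noncomputable def distrib : EnvE 𝔼 G E →ₐ[ℂ] ⨂[ℂ] v, StarEnv 𝔼 G s t v :=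
  envLift (L := LieE 𝔼 G E) (A := ⨂[ℂ] v, StarEnv 𝔼 G s t v) (distribLie 𝔼 s t)
    (isLieMap_distribLie 𝔼 s t)

lemma distrib_envGauge (k : ∀ v, K v) (X : EnvE 𝔼 G E) :
    distrib 𝔼 s t (envGauge 𝔼 s t K k X) =
      piMapAlg (fun v => starAd 𝔼 s t K v (k v)) (distrib 𝔼 s t X) := by
  have hs : ∀ v (e : {e // s e = v}) (X : EnvG 𝔼 G),
      piMapAlg (fun v => starAd 𝔼 s t K v (k v)) (sourceIncl 𝔼 s t v e X) =
        sourceIncl 𝔼 s t v e (envAd 𝔼 (k v : G) X) := by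
    intro v e X
    rw [sourceIncl, AlgHom.comp_apply, AlgHom.comp_apply, piMapAlg_single]
    congr 1
    refine (starAd_tmul 𝔼 s t K v (k v) _ _).trans ?_
    have h1 := piMapAlg_single (A := fun _ : {e // s e = v} => EnvG 𝔼 G)
      (fun _ => envAd 𝔼 (k v : G)) e X
    exact congrArg₂ (fun p q => starEnvEquiv 𝔼 s t v (p ⊗ₜ[ℂ] q)) h1 (map_one _)
  have ht : ∀ v (e : {e // t e = v}) (X : EnvG 𝔼 G),
      piMapAlg (fun v => starAd 𝔼 s t K v (k v)) (targetIncl 𝔼 s t v e X) =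
        targetIncl 𝔼 s t v e (envAd 𝔼 (k v : G) X) := by
    intro v e X
    rw [targetIncl, AlgHom.comp_apply, AlgHom.comp_apply, piMapAlg_single]
    congr 1
    refine (starAd_tmul 𝔼 s t K v (k v) _ _).trans ?_
    have h1 := piMapAlg_single (A := fun _ : {e // t e = v} => EnvG 𝔼 G)
      (fun _ => envAd 𝔼 (k v : G)) e X
    exact congrArg₂ (fun p q => starEnvEquiv 𝔼 s t v (p ⊗ₜ[ℂ] q)) (map_one _) h1
  have e : (distrib 𝔼 s t).comp (envGauge 𝔼 s t K k) =
      (piMapAlg (fun v => starAd 𝔼 s t K v (k v))).comp (distrib 𝔼 (G := G) s t) := by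
    apply env_hom_ext
    rintro ⟨x, y⟩
    rw [AlgHom.comp_apply, AlgHom.comp_apply, envGauge, envLift_ι, LinearMap.comp_apply, distrib,
      envLift_ι, envLift_ι]
    simp only [distribLie, LinearMap.coprod_apply, sumMap_apply, map_add, map_sum,
      LinearMap.comp_apply, AlgHom.toLinearMap_apply, hs, ht, envAd, envLift_ι]
    rfl
  exact congrArg (fun F : _ →ₐ[ℂ] _ => F X) e

variable [T2Space G] [CompactSpace G] [∀ e, FiniteDimensional ℂ (M e)]
  [∀ e, IsContinuousRep (π e)]

/-- The action of `U(𝔤^E × 𝔤^E) ≅ ⨂_v U(𝔤)^{(v)}` on `⨂_v Hom(S_v^*, M^{S(v)})`. -/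
noncomputable def tensorHomAct (S : V → Type*) [∀ v, AddCommGroup (S v)] [∀ v, Module ℂ (S v)] :
    EnvE 𝔼 G E →ₐ[ℂ] Module.End ℂ (⨂[ℂ] v, StarHom s t S M v) :=
  (piAct fun v => homAct 𝔼 s t π S v).comp (distrib 𝔼 s t)

/-- The tensor product `⨂_v Hom_{K_v}(S_v^*, M^{S(v)})` of the local intertwiner spaces. -/
def IntertwinerTensor : Type _ := ⨂[ℂ] v, LocalHom s t K σ π v

noncomputable instance instAddCommGroupIntertwinerTensor :
    AddCommGroup (IntertwinerTensor s t K σ π) :=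
  inferInstanceAs (AddCommGroup (⨂[ℂ] v, LocalHom s t K σ π v))

noncomputable instance instModuleComplexIntertwinerTensor :
    Module ℂ (IntertwinerTensor s t K σ π) :=
  inferInstanceAs (Module ℂ (⨂[ℂ] v, LocalHom s t K σ π v))

/-- The inclusion of `⨂_v Hom_{K_v}(S_v^*, M^{S(v)})` in `⨂_v Hom(S_v^*, M^{S(v)})`. -/
noncomputable def intertwinerIncl :
    IntertwinerTensor s t K σ π →ₗ[ℂ] ⨂[ℂ] v, StarHom s t S M v :=
  PiTensorProduct.mapIncl fun v => LocalHom s t K σ π v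

lemma intertwinerIncl_injective : Function.Injective (intertwinerIncl s t K σ π) :=
  mapIncl_injective fun v => LocalHom s t K σ π v

lemma intertwinerIncl_invariant (k : ∀ v, K v) (z : IntertwinerTensor s t K σ π) :
    extTensorRep (fun v => homRep s t K σ π v) k (intertwinerIncl s t K σ π z) =
      intertwinerIncl s t K σ π z :=
  map_mapIncl (fun v => LocalHom s t K σ π v) (fun v => homRep s t K σ π v (k v))
    (fun v _ hφ => hφ (k v)) z

variable [∀ v, FiniteDimensional ℂ (S v)]

instance instFiniteDimensionalStarSpace (v : V) : FiniteDimensional ℂ (StarSpace s t M v) :=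
  Module.Finite.equiv (starEquiv s t M v)

lemma tensorHomAct_stable (X : EnvE 𝔼 G E) (hX : X ∈ envInv 𝔼 s t K)
    (z : IntertwinerTensor s t K σ π) :
    ∃ z' : IntertwinerTensor s t K σ π, intertwinerIncl s t K σ π z' =
      tensorHomAct 𝔼 s t π S X (intertwinerIncl s t K σ π z) := by
  refine extTensorRep_invariants_le (fun v => homRep s t K σ π v)
    (fun v => LocalHom s t K σ π v) (fun v φ h => h) _ fun k => ?_
  have h1 := piAct_intertwine (fun v => homAct 𝔼 s t π S v) (fun v => homAct 𝔼 s t π S v)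
    (fun v => starAd 𝔼 s t K v (k v)) (fun v => homRep s t K σ π v (k v))
    (fun v => homAct_intertwine 𝔼 s t K σ π v (k v)) (distrib 𝔼 s t X)
    (intertwinerIncl s t K σ π z)
  rw [← distrib_envGauge, (mem_envInv 𝔼 s t K).1 hX k] at h1
  refine h1.trans ?_
  exact congrArg _ (intertwinerIncl_invariant s t K σ π k z)

noncomputable instance instModuleIntertwinerTensor :
    Module (envInv 𝔼 s t K) (IntertwinerTensor s t K σ π) :=
  pullbackModule (tensorHomAct 𝔼 s t π S) (envInv 𝔼 s t K) (intertwinerIncl s t K σ π)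
    (intertwinerIncl_injective s t K σ π) (tensorHomAct_stable 𝔼 s t K σ π)

noncomputable instance instSMulIntertwinerTensor :
    SMul (envInv 𝔼 s t K) (IntertwinerTensor s t K σ π) :=
  (instModuleIntertwinerTensor 𝔼 s t K σ π).toSMul

/-- The action on `⨂_v Hom_{K_v}(S_v^*, M^{S(v)})` is the restriction of the action on
`⨂_v Hom(S_v^*, M^{S(v)})`. -/
lemma intertwinerIncl_smul (X : envInv 𝔼 s t K) (z : IntertwinerTensor s t K σ π) :
    intertwinerIncl s t K σ π (X • z) =
      tensorHomAct 𝔼 s t π S (X : EnvE 𝔼 G E) (intertwinerIncl s t K σ π z) :=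
  (tensorHomAct_stable 𝔼 s t K σ π X X.2 z).choose_spec

end TensorSide

section Isomorphism

variable {G : Type*} [TopologicalSpace G] [Group G]
  {V E : Type*} [Fintype V] [DecidableEq V] [Fintype E] [DecidableEq E]
  (s t : E → V)
  {S : V → Type*} [∀ v, AddCommGroup (S v)] [∀ v, Module ℂ (S v)]
  {M : E → Type*} [∀ e, AddCommGroup (M e)] [∀ e, Module ℂ (M e)]
  (π : ∀ e, Representation ℂ G (M e))

/-- The representation `⨂_e π_e` of `G^E` on `⨂_e M_e`. -/
noncomputable def edgeTensorRep : Representation ℂ (E → G) (⨂[ℂ] e, M e) :=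
  extTensorRep (Γ := fun _ : E => G) π

variable [∀ e, FiniteDimensional ℂ (M e)]

instance instIsContinuousRepEdgeTensorRep [∀ e, IsContinuousRep (π e)] :
    IsContinuousRep (edgeTensorRep π) := by
  unfold edgeTensorRep; infer_instance

/-- Indices of the basis of `⨂_e M_e` that consists of tensor products of basis vectors. -/
abbrev TensorIndex (M : E → Type*) [∀ e, AddCommGroup (M e)] [∀ e, Module ℂ (M e)] : Type _ :=
  ∀ e, Fin (Module.finrank ℂ (M e))

/-- Coordinates on the space attached to the star of `v`: the functional
`(⨂ φ_e) ⊗ (⨂ m_e) ↦ ∏_{s(e) = v} φ_e(b_{e,i(e)}) ∏_{t(e) = v} b_{e,j(e)}^*(m_e)`. -/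
noncomputable def starCoord (v : V) (i j : TensorIndex M) : StarSpace s t M v →ₗ[ℂ] ℂ :=
  (TensorProduct.dualDistrib ℂ (⨂[ℂ] e : {e // s e = v}, Module.Dual ℂ (M e))
    (⨂[ℂ] e : {e // t e = v}, M e)
    (PiTensorProduct.dualDistrib
        (⨂ₜ[ℂ] e : {e // s e = v}, Module.Dual.eval ℂ (M e) (Module.finBasis ℂ (M e) (i e))) ⊗ₜ[ℂ]
      PiTensorProduct.dualDistrib
        (⨂ₜ[ℂ] e : {e // t e = v}, (Module.finBasis ℂ (M e)).coord (j e)))) ∘ₗ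
    (starEquiv s t M v).symm.toLinearMap

lemma starCoord_apply (v : V) (i j : TensorIndex M)
    (φ : ∀ e : {e // s e = v}, Module.Dual ℂ (M e)) (m : ∀ e : {e // t e = v}, M e) :
    starCoord s t v i j (starEquiv s t M v ((⨂ₜ[ℂ] e, φ e) ⊗ₜ[ℂ] (⨂ₜ[ℂ] e, m e))) =
      (∏ e, φ e (Module.finBasis ℂ (M e) (i e))) *
        ∏ e : {e // t e = v}, (Module.finBasis ℂ (M e)).coord (j e) (m e) := by
  show TensorProduct.dualDistrib ℂ _ _ (_ ⊗ₜ[ℂ] _) ((⨂ₜ[ℂ] e, φ e) ⊗ₜ[ℂ] (⨂ₜ[ℂ] e, m e)) = _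
  rw [TensorProduct.dualDistrib_apply, PiTensorProduct.dualDistrib_apply,
    PiTensorProduct.dualDistrib_apply]
  rfl

/-- The matrix coefficient of `⨂_e π_e` for the basis vectors with indices `i` and `j`. -/
noncomputable def basisCoeff (i j : TensorIndex M) : reprFun (edgeTensorRep π) :=
  coeffMap (edgeTensorRep π)
    (PiTensorProduct.dualDistrib (⨂ₜ[ℂ] e, (Module.finBasis ℂ (M e)).coord (i e)))
    (⨂ₜ[ℂ] e, Module.finBasis ℂ (M e) (j e))

/-- The linear map `Ψ^π : ⨂_v (M^{S(v)} ⊗ S_v) → R^π ⊗ ⨂_v S_v` given by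
`⨂_v ((⨂_{s(e) = v} φ_e) ⊗ (⨂_{t(e) = v} m_e) ⊗ u_v) ↦ c_{⨂ φ_e, ⨂ m_e} ⊗ (⨂_v u_v)`. -/
noncomputable def Psi (S : V → Type*) [∀ v, AddCommGroup (S v)] [∀ v, Module ℂ (S v)] :
    (⨂[ℂ] v, StarSpace s t M v ⊗[ℂ] S v) →ₗ[ℂ] SpinSpace (edgeTensorRep π) S :=
  ∑ i : TensorIndex M, ∑ j : TensorIndex M,
    (spinEquiv (edgeTensorRep π) S).toLinearMap ∘ₗ
    (TensorProduct.mk ℂ (reprFun (edgeTensorRep π)) (⨂[ℂ] v, S v) (basisCoeff π i j)) ∘ₗ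
      PiTensorProduct.map fun v =>
        (TensorProduct.lid ℂ (S v)).toLinearMap ∘ₗ (starCoord s t v i j).rTensor (S v)

lemma prod_fiber (f : E → V) (c : E → ℂ) :
    ∏ v, ∏ e : {e // f e = v}, c e = ∏ e, c e := by
  rw [← Finset.prod_fiberwise (s := Finset.univ) (g := f)]
  refine Finset.prod_congr rfl fun v _ => ?_
  exact (Finset.prod_subtype _ (by simp) c).symm

/-- The value of `Ψ^π` on pure tensors. -/
lemma Psi_tprod (φ : ∀ e, Module.Dual ℂ (M e)) (m : ∀ e, M e) (u : ∀ v, S v) :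
    Psi s t π S (⨂ₜ[ℂ] v, starEquiv s t M v ((⨂ₜ[ℂ] e : {e // s e = v}, φ e) ⊗ₜ[ℂ]
        (⨂ₜ[ℂ] e : {e // t e = v}, m e)) ⊗ₜ[ℂ] u v) =
      spinEquiv (edgeTensorRep π) S
        (coeffMap (edgeTensorRep π) (PiTensorProduct.dualDistrib (⨂ₜ[ℂ] e, φ e)) (⨂ₜ[ℂ] e, m e)
          ⊗ₜ[ℂ] (⨂ₜ[ℂ] v, u v)) := by
  have e1 : (PiTensorProduct.dualDistrib (⨂ₜ[ℂ] e, φ e) : Module.Dual ℂ (⨂[ℂ] e, M e)) =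
      ∑ i : TensorIndex M, (∏ e, φ e (Module.finBasis ℂ (M e) (i e))) •
        PiTensorProduct.dualDistrib (⨂ₜ[ℂ] e, (Module.finBasis ℂ (M e)).coord (i e)) := by
    have : φ = fun e => ∑ i, φ e (Module.finBasis ℂ (M e) i) •
        (Module.finBasis ℂ (M e)).coord i := by
      ext1 e
      refine (Module.finBasis ℂ (M e)).ext fun j => ?_
      simp
    conv_lhs => rw [this, MultilinearMap.map_sum, map_sum]
    refine Finset.sum_congr rfl fun i _ => ?_
    rw [MultilinearMap.map_smul_univ, map_smul]
  have e2 : (⨂ₜ[ℂ] e, m e) = ∑ j : TensorIndex M,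
      (∏ e, (Module.finBasis ℂ (M e)).coord (j e) (m e)) •
        ⨂ₜ[ℂ] e, Module.finBasis ℂ (M e) (j e) := by
    have : m = fun e => ∑ j, (Module.finBasis ℂ (M e)).coord j (m e) •
        Module.finBasis ℂ (M e) j := by
      ext1 e
      exact ((Module.finBasis ℂ (M e)).sum_repr _).symm
    conv_lhs => rw [this, MultilinearMap.map_sum]
    refine Finset.sum_congr rfl fun i _ => ?_
    rw [MultilinearMap.map_smul_univ]
  rw [e1, e2]
  simp only [Psi, LinearMap.sum_apply, LinearMap.comp_apply, map_sum, map_smul,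
    LinearMap.smul_apply, TensorProduct.sum_tmul, PiTensorProduct.map_tprod,
    LinearMap.rTensor_tmul, LinearEquiv.coe_coe, TensorProduct.lid_tmul, starCoord_apply,
    TensorProduct.mk_apply, MultilinearMap.map_smul_univ, Finset.prod_mul_distrib]
  rw [Finset.sum_comm]
  refine Finset.sum_congr rfl fun j _ => ?_
  rw [Finset.smul_sum, TensorProduct.sum_tmul]
  refine Finset.sum_congr rfl fun i _ => ?_
  rw [prod_fiber s fun e => φ e (Module.finBasis ℂ (M e) (i e)),
    prod_fiber t fun e => (Module.finBasis ℂ (M e)).coord (j e) (m e),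
    smul_smul, ← TensorProduct.smul_tmul', mul_comm]
  rfl

/-- The linear map `τ_v : Hom(S_v^*, M^{S(v)}) → M^{S(v)} ⊗ S_v`, `φ ↦ ∑_t φ(u_t^*) ⊗ u_t`, for a
basis `(u_t)` of `S_v` and the dual basis `(u_t^*)`. -/
noncomputable def tau (v : V) [FiniteDimensional ℂ (S v)] :
    StarHom s t S M v →ₗ[ℂ] StarSpace s t M v ⊗[ℂ] S v :=
  ∑ r, ((TensorProduct.mk ℂ (StarSpace s t M v) (S v)).flip (Module.finBasis ℂ (S v) r)) ∘ₗ
    LinearMap.applyₗ ((Module.finBasis ℂ (S v)).coord r)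

lemma tau_apply (v : V) [FiniteDimensional ℂ (S v)] (φ : StarHom s t S M v) :
    tau s t v φ = ∑ r, φ ((Module.finBasis ℂ (S v)).coord r) ⊗ₜ[ℂ] Module.finBasis ℂ (S v) r := by
  simp [tau]

/-- The linear map `Υ^π = Ψ^π ∘ ⨂_v τ_v`. -/
noncomputable def Upsilon (S : V → Type*) [∀ v, AddCommGroup (S v)] [∀ v, Module ℂ (S v)]
    [∀ v, FiniteDimensional ℂ (S v)] :
    (⨂[ℂ] v, StarHom s t S M v) →ₗ[ℂ] SpinSpace (edgeTensorRep π) S :=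
  Psi s t π S ∘ₗ PiTensorProduct.map fun v => tau s t v

/-- The space `H^π = (R^π ⊗ ⨂_v S_v)^K` of `π`-elementary spin graph functions. -/
noncomputable abbrev spinGraphFunctions (K : V → Subgroup G)
    (σ : ∀ v, Representation ℂ (K v) (S v)) :
    Submodule ℂ (SpinSpace (edgeTensorRep π) S) :=
  gaugeInvariants s t K (edgeTensorRep π) σ

end Isomorphism

end SpinGraph

open SpinGraph

/-!
The map `Υ^π` sends the tensor of data `φ_e ∈ M_e^*`, `m_e ∈ M_e`, `u_v ∈ S_v` attached to the edges
and vertices of the graph (`graphPure`) to the matrix coefficient of `⨂_e π_e` at `⨂ φ_e`, `⨂ m_e`,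
tensored with `⨂ u_v` (`Upsilon_graphPure`). Such tensors span the domain, and their images span
`R^π ⊗ S`, so `Υ^π` is surjective. It is bijective by a count of dimensions: as the `π_e` are
irreducible, Burnside's theorem makes the matrix entries of `⨂_e π_e` linearly independent
(`linearIndependent_basisCoeff`), so `dim R^π ≥ (∏_e dim M_e)²`.

On the spanning tensors one reads off that `Υ^π` intertwines the gauge actions (`Upsilon_gauge`) and
the actions of `U(𝔤^E × 𝔤^E)` (`Upsilon_envAct`); for the latter only the Lie algebra at one edge has
to be checked, where both sides differentiate `φ_e` or `m_e`. Since the gauge group is the product of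
the groups `K_v`, its invariants in a tensor product are the tensor product of the invariants, and no
averaging is needed. This gives the isomorphism of modules (`exists_intertwiner_equiv`).

For the irreducibility criterion let `A_v = (U(𝔤)^{(v)})^{K_v}` and let `W_v` be the local intertwiner
space. The algebra `U(𝔤^E × 𝔤^E)^K` acts on `⨂_v W_v` exactly as `⨂_v A_v` does. On the one hand, an
invariant element lies in `⨂_v A_v` (`distrib_mem_range_mapIncl`); the factors have infinite
dimension, so this uses `mem_range_mapIncl_of_fixed`. On the other hand, every element of one `A_v`
lifts to an invariant element of `U(𝔤^E × 𝔤^E)` (`starLift`). A proper nonzero submodule of one `W_v`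
then gives one of the tensor product (`isSimpleModule_of_tensor`). Conversely, if all `W_v` are
simple, the density theorem shows that a submodule of `⨂_v W_v` is stable under all tensor products
of operators of rank one, so that it is zero or everything (`isSimpleModule_tensor`).
-/

namespace SpinGraph

/-! ### Density and Burnside's theorem -/

section Density

/-- Burnside's theorem, from the Jacobson density theorem and Schur's lemma: every operator on a
simple module of finite complex dimension is the action of an element of the algebra. -/
lemma exists_smul_eq_of_isSimpleModule {A W : Type*} [Ring A] [Algebra ℂ A] [AddCommGroup W]
    [Module ℂ W] [FiniteDimensional ℂ W] [Module A W] [IsScalarTower ℂ A W] [IsSimpleModule A W]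
    (T : Module.End ℂ W) : ∃ a : A, ∀ w : W, a • w = T w := by
  have hs := (IsSimpleModule.algebraMap_end_bijective_of_isAlgClosed (A := A) (V := W) ℂ).2
  -- by Schur's lemma the `A`-linear operators are scalars, so `T` commutes with them
  let f : Module.End (Module.End A W) W :=
    { toFun := T
      map_add' := map_add T
      map_smul' := by
        intro c w
        obtain ⟨r, rfl⟩ := hs c
        exact map_smul T r w }
  classical
  obtain ⟨a, ha⟩ := jacobson_density (R := A) f (Finset.univ.image (Module.finBasis ℂ W))
  refine ⟨a, fun w => ?_⟩
  have e : Algebra.lsmul ℂ ℂ W a = T :=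
    (Module.finBasis ℂ W).ext fun i => (ha _ (by simp)).symm
  exact LinearMap.congr_fun e w

/-- The operators of an irreducible representation span the full operator algebra. -/
lemma span_range_eq_top_of_isIrreducible {Γ W : Type*} [Group Γ] [AddCommGroup W] [Module ℂ W]
    [FiniteDimensional ℂ W] (ρ : Representation ℂ Γ W) (hρ : ρ.IsIrreducible) :
    Submodule.span ℂ (Set.range ρ) = ⊤ := by
  have hs := (Representation.irreducible_iff_isSimpleModule_asModule ρ).1 hρ
  have : FiniteDimensional ℂ ρ.asModule := Module.Finite.equiv ρ.asModuleEquiv.symm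
  rw [eq_top_iff]
  rintro T -
  obtain ⟨a, ha⟩ := exists_smul_eq_of_isSimpleModule (A := MonoidAlgebra ℂ Γ) (W := ρ.asModule)
    (ρ.asModuleEquiv.symm.conj T)
  have e : T = ρ.asAlgebraHom a := by
    ext w
    have h := congrArg ρ.asModuleEquiv (ha (ρ.asModuleEquiv.symm w))
    rw [Representation.asModuleEquiv_map_smul] at h
    simpa [LinearEquiv.conj_apply] using h.symm
  rw [e]
  clear e ha
  induction a using MonoidAlgebra.induction_on with
  | of g => exact Submodule.subset_span ⟨g, by simp⟩
  | add a b ha hb => rw [map_add]; exact Submodule.add_mem _ ha hb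
  | smul r a ha => rw [map_smul]; exact Submodule.smul_mem _ r ha

end Density

/-! ### Tensor products of vector spaces of arbitrary dimension -/

section TensorProducts

variable {ι : Type*} [Fintype ι] [DecidableEq ι] {W : ι → Type*} [∀ i, AddCommGroup (W i)]
  [∀ i, Module ℂ (W i)]

/-- Products of functionals separate the points of a tensor product, also in infinite dimension. -/
lemma ext_dualDistrib {z z' : ⨂[ℂ] i, W i}
    (h : ∀ φ : ∀ i, Module.Dual ℂ (W i), PiTensorProduct.dualDistrib (⨂ₜ[ℂ] i, φ i) z =
      PiTensorProduct.dualDistrib (⨂ₜ[ℂ] i, φ i) z') : z = z' := by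
  let b := Basis.piTensorProduct fun i => Module.Basis.ofVectorSpace ℂ (W i)
  have key : ∀ (p) (z : ⨂[ℂ] i, W i), b.repr z p =
      PiTensorProduct.dualDistrib
        (⨂ₜ[ℂ] i, (Module.Basis.ofVectorSpace ℂ (W i)).coord (p i)) z := by
    intro p z
    induction z using PiTensorProduct.induction_on with
    | add x y hx hy => simp only [map_add, Finsupp.add_apply, hx, hy]
    | smul_tprod r w =>
      simp [b, PiTensorProduct.dualDistrib_apply, Basis.piTensorProduct_repr_tprod_apply]
  exact b.ext_elem fun p => by rw [key, key, h]

lemma tprod_ne_zero {w : ∀ i, W i} (hw : ∀ i, w i ≠ 0) : (⨂ₜ[ℂ] i, w i) ≠ 0 := by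
  have h : ∀ i, ∃ φ : Module.Dual ℂ (W i), φ (w i) ≠ 0 := fun i => by
    by_contra! h
    exact hw i ((Module.forall_dual_apply_eq_zero_iff ℂ _).1 h)
  choose φ hφ using h
  intro h0
  have := congrArg (PiTensorProduct.dualDistrib (⨂ₜ[ℂ] i, φ i)) h0
  rw [PiTensorProduct.dualDistrib_apply, map_zero] at this
  exact Finset.prod_ne_zero_iff.2 (fun i _ => hφ i) this

/-- Contracting a tensor with functionals in all factors but one gives a vector of the remaining
factor, without any finiteness assumption. -/
lemma exists_contraction (z : ⨂[ℂ] i, W i) (φ : ∀ i, Module.Dual ℂ (W i)) (j : ι) :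
    ∃ w : W j, ∀ ψ : Module.Dual ℂ (W j), ψ w =
      PiTensorProduct.dualDistrib (⨂ₜ[ℂ] i, Function.update φ j ψ i) z := by
  induction z using PiTensorProduct.induction_on with
  | add x y hx hy =>
    obtain ⟨a, ha⟩ := hx
    obtain ⟨b, hb⟩ := hy
    exact ⟨a + b, fun ψ => by rw [map_add, map_add, ha, hb]⟩
  | smul_tprod r w =>
    refine ⟨(r * ∏ i ∈ Finset.univ.erase j, φ i (w i)) • w j, fun ψ => ?_⟩
    rw [map_smul, map_smul, PiTensorProduct.dualDistrib_apply,
      ← Finset.mul_prod_erase _ _ (Finset.mem_univ j), Function.update_self]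
    have : ∏ i ∈ Finset.univ.erase j, Function.update φ j ψ i (w i) =
        ∏ i ∈ Finset.univ.erase j, φ i (w i) :=
      Finset.prod_congr rfl fun i hi => by rw [Function.update_of_ne (Finset.ne_of_mem_erase hi)]
    rw [this, smul_eq_mul, smul_eq_mul]
    ring

/-- A tensor that is fixed by a family of operators in each factor separately is a tensor in the
fixed vectors. The factors may have infinite dimension. -/
lemma mem_range_mapIncl_of_fixed {Γ : ι → Type*} [∀ i, One (Γ i)]
    (T : ∀ i, Γ i → W i →ₗ[ℂ] W i) (hT : ∀ i, T i 1 = LinearMap.id) (N : ∀ i, Submodule ℂ (W i))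
    (hN : ∀ i w, (∀ g, T i g w = w) → w ∈ N i) (z : ⨂[ℂ] i, W i)
    (hz : ∀ g : ∀ i, Γ i, PiTensorProduct.map (fun i => T i (g i)) z = z) :
    z ∈ LinearMap.range (PiTensorProduct.mapIncl N) := by
  have h : ∀ i, ∃ q : W i →ₗ[ℂ] N i, q ∘ₗ (N i).subtype = LinearMap.id :=
    fun i => (N i).subtype.exists_leftInverse_of_injective (N i).ker_subtype
  choose q hq using h
  let Q : ∀ i, W i →ₗ[ℂ] W i := fun i => (N i).subtype ∘ₗ q i
  have hQ : ∀ i, ∀ w ∈ N i, Q i w = w := fun i w hw =>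
    congrArg Subtype.val (LinearMap.congr_fun (hq i) ⟨w, hw⟩)
  let Φ : (∀ i, Module.Dual ℂ (W i)) → ℂ := fun φ =>
    PiTensorProduct.dualDistrib (⨂ₜ[ℂ] i, φ i) z
  -- one factor can be projected to the fixed vectors
  have step : ∀ (j : ι) (φ : ∀ i, Module.Dual ℂ (W i)),
      Φ (Function.update φ j (φ j ∘ₗ Q j)) = Φ φ := by
    intro j φ
    obtain ⟨w, hw⟩ := exists_contraction z φ j
    have hinv : w ∈ N j := by
      refine hN j w fun g => ?_
      rw [← sub_eq_zero, ← Module.forall_dual_apply_eq_zero_iff ℂ]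
      intro ψ
      rw [map_sub, sub_eq_zero, ← LinearMap.comp_apply, hw, hw]
      conv_rhs => rw [← hz (Pi.mulSingle j g), dualDistrib_map]
      congr 2
      apply congrArg
      ext1 i
      by_cases hi : i = j
      · subst hi; simp
      · rw [Function.update_of_ne hi, Function.update_of_ne hi, Pi.mulSingle_eq_of_ne hi, hT]
        rfl
    refine (hw _).symm.trans ?_
    rw [LinearMap.comp_apply, hQ j w hinv, hw, Function.update_eq_self]
  have all : ∀ (s : Finset ι) (φ : ∀ i, Module.Dual ℂ (W i)),
      Φ (fun i => if i ∈ s then φ i ∘ₗ Q i else φ i) = Φ φ := by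
    intro s
    induction s using Finset.induction_on with
    | empty => intro φ; simp
    | insert j s hj ih =>
      intro φ
      rw [← step j φ, ← ih (Function.update φ j (φ j ∘ₗ Q j))]
      congr 1
      ext1 i
      by_cases hi : i = j
      · subst hi; simp [hj]
      · simp [hi]
  have hfix : PiTensorProduct.map Q z = z := by
    refine ext_dualDistrib fun φ => ?_
    rw [dualDistrib_map]
    simpa [Φ] using all Finset.univ φ
  rw [← hfix]
  refine ⟨PiTensorProduct.map q z, ?_⟩
  rw [PiTensorProduct.mapIncl, ← LinearMap.comp_apply, ← PiTensorProduct.map_comp]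

end TensorProducts

/-! ### Linear maps out of a tensor product of algebras -/

section OrderedProducts

variable {ι : Type*} [Fintype ι] [DecidableEq ι]

/-- A list of the elements of a finite type, without repetitions. -/
noncomputable def elems (ι : Type*) [Fintype ι] : List ι := List.ofFn (Fintype.equivFin ι).symm

lemma nodup_elems : (elems ι).Nodup := List.nodup_ofFn.2 (Fintype.equivFin ι).symm.injective

lemma mem_elems (i : ι) : i ∈ elems ι :=
  List.mem_ofFn.2 ((Fintype.equivFin ι).symm.surjective i)

/-- The linear map `⨂ₜ x_i ↦ ∏ f_i(x_i)`, where the factors of the product are taken in the order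
of the list `elems ι`. It is a homomorphism of algebras only if the images of the `f_i` commute. -/
noncomputable def orderedProd {A : ι → Type*} {B : Type*} [∀ i, AddCommGroup (A i)]
    [∀ i, Module ℂ (A i)] [Ring B] [Algebra ℂ B] (f : ∀ i, A i →ₗ[ℂ] B) :
    (⨂[ℂ] i, A i) →ₗ[ℂ] B :=
  PiTensorProduct.lift (((MultilinearMap.mkPiAlgebraFin ℂ (Fintype.card ι) B).domDomCongr
    (Fintype.equivFin ι).symm).compLinearMap f)

lemma orderedProd_tprod {A : ι → Type*} {B : Type*} [∀ i, AddCommGroup (A i)]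
    [∀ i, Module ℂ (A i)] [Ring B] [Algebra ℂ B] (f : ∀ i, A i →ₗ[ℂ] B) (x : ∀ i, A i) :
    orderedProd f (⨂ₜ[ℂ] i, x i) = ((elems ι).map fun i => f i (x i)).prod := by
  rw [orderedProd, PiTensorProduct.lift.tprod, elems, List.map_ofFn]
  simp [MultilinearMap.mkPiAlgebraFin_apply, Function.comp_def]

lemma prod_map_mulSingle {A : ι → Type*} [∀ i, Monoid (A i)] (x : ∀ i, A i) (l : List ι)
    (hl : l.Nodup) (j : ι) :
    (l.map fun i => Pi.mulSingle i (x i)).prod j = if j ∈ l then x j else 1 := by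
  induction l with
  | nil => simp
  | cons a l ih =>
    rw [List.nodup_cons] at hl
    rw [List.map_cons, List.prod_cons, Pi.mul_apply, ih hl.2]
    by_cases h : j = a
    · subst h; simp [hl.1]
    · simp [h]

/-- A pure tensor is the product of its components in the single factors. -/
lemma orderedProd_single {A : ι → Type*} [∀ i, Ring (A i)] [∀ i, Algebra ℂ (A i)]
    (X : ⨂[ℂ] i, A i) :
    orderedProd (fun i => (PiTensorProduct.singleAlgHom (R := ℂ) (A := A) i).toLinearMap) X =
      X := by
  induction X using PiTensorProduct.induction_on with
  | add X Y hX hY => rw [map_add, hX, hY]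
  | smul_tprod r x =>
    rw [map_smul, orderedProd_tprod]
    congr 1
    have h : ((elems ι).map fun i => Pi.mulSingle i (x i)).prod = x := by
      ext j
      rw [prod_map_mulSingle x _ nodup_elems, if_pos (mem_elems j)]
    conv_rhs => rw [← h]
    rw [← PiTensorProduct.tprodMonoidHom_apply, map_list_prod, List.map_map]
    rfl

lemma map_orderedProd {A : ι → Type*} {B C : Type*} [∀ i, AddCommGroup (A i)]
    [∀ i, Module ℂ (A i)] [Ring B] [Algebra ℂ B] [Ring C] [Algebra ℂ C] (f : ∀ i, A i →ₗ[ℂ] B)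
    (F : B →ₐ[ℂ] C) (X : ⨂[ℂ] i, A i) :
    F (orderedProd f X) = orderedProd (fun i => F.toLinearMap ∘ₗ f i) X := by
  induction X using PiTensorProduct.induction_on with
  | add X Y hX hY => simp only [map_add, hX, hY]
  | smul_tprod r x =>
    rw [map_smul, map_smul, map_smul, orderedProd_tprod, orderedProd_tprod, map_list_prod,
      List.map_map]
    rfl

lemma orderedProd_piMapAlg {A A' : ι → Type*} {B : Type*} [∀ i, Ring (A i)]
    [∀ i, Algebra ℂ (A i)] [∀ i, Ring (A' i)] [∀ i, Algebra ℂ (A' i)] [Ring B] [Algebra ℂ B]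
    (f : ∀ i, A' i →ₗ[ℂ] B) (u : ∀ i, A i →ₐ[ℂ] A' i) (X : ⨂[ℂ] i, A i) :
    orderedProd f (piMapAlg u X) = orderedProd (fun i => f i ∘ₗ (u i).toLinearMap) X := by
  induction X using PiTensorProduct.induction_on with
  | add X Y hX hY => simp only [map_add, hX, hY]
  | smul_tprod r x =>
    rw [map_smul, map_smul, map_smul, piMapAlg_tprod, orderedProd_tprod, orderedProd_tprod]
    rfl

end OrderedProducts

/-! ### Simplicity of tensor products of modules -/

section SimpleTensors

variable {ι : Type*} [Fintype ι] [DecidableEq ι] {W : ι → Type*} [∀ i, AddCommGroup (W i)]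
  [∀ i, Module ℂ (W i)] {A : ι → Type*} [∀ i, Ring (A i)] [∀ i, Algebra ℂ (A i)]
  [∀ i, Module (A i) (W i)] [∀ i, IsScalarTower ℂ (A i) (W i)]
  {B T : Type*} [Ring B] [Algebra ℂ B] [AddCommGroup T] [Module ℂ T] [Module B T]
  [IsScalarTower ℂ B T] (e : T ≃ₗ[ℂ] ⨂[ℂ] i, W i)

lemma map_mem_range_mapIncl {N : ∀ i, Submodule ℂ (W i)} {F : ∀ i, W i →ₗ[ℂ] W i}
    (hF : ∀ i, ∀ w ∈ N i, F i w ∈ N i) {z : ⨂[ℂ] i, W i}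
    (hz : z ∈ LinearMap.range (PiTensorProduct.mapIncl N)) :
    PiTensorProduct.map F z ∈ LinearMap.range (PiTensorProduct.mapIncl N) := by
  obtain ⟨y, rfl⟩ := hz
  refine ⟨PiTensorProduct.map (fun i => (F i).restrict (hF i)) y, ?_⟩
  rw [PiTensorProduct.mapIncl, ← LinearMap.comp_apply, ← LinearMap.comp_apply,
    ← PiTensorProduct.map_comp, ← PiTensorProduct.map_comp]
  rfl

lemma piAct_mem_range_mapIncl {N : ∀ i, Submodule ℂ (W i)} {F : ∀ i, A i →ₐ[ℂ] Module.End ℂ (W i)}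
    (hF : ∀ i a, ∀ w ∈ N i, F i a w ∈ N i) (X : ⨂[ℂ] i, A i) {z : ⨂[ℂ] i, W i}
    (hz : z ∈ LinearMap.range (PiTensorProduct.mapIncl N)) :
    piAct F X z ∈ LinearMap.range (PiTensorProduct.mapIncl N) := by
  induction X using PiTensorProduct.induction_on with
  | add X Y hX hY => rw [map_add]; exact Submodule.add_mem _ hX hY
  | smul_tprod r a =>
    rw [map_smul]
    refine Submodule.smul_mem _ r ?_
    have : piAct F (⨂ₜ[ℂ] i, a i) = PiTensorProduct.map fun i => F i (a i) :=
      PiTensorProduct.ext (MultilinearMap.ext fun w => by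
        simp [piAct_tprod, PiTensorProduct.map_tprod])
    rw [this]
    exact map_mem_range_mapIncl (fun i => hF i (a i)) hz

/-- If `B` acts on `⨂ W_i` through `⨂ A_i`, then a proper nonzero submodule of one factor gives a
proper nonzero submodule of the tensor product. -/
lemma isSimpleModule_of_tensor
    (h : ∀ b : B, ∃ X : ⨂[ℂ] i, A i, ∀ z : T,
      e (b • z) = piAct (fun i => Algebra.lsmul ℂ ℂ (W i)) X (e z))
    (hT : IsSimpleModule B T) (j : ι) : IsSimpleModule (A j) (W j) := by
  have : Nontrivial (⨂[ℂ] i, W i) :=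
    have : Nontrivial T := IsSimpleModule.nontrivial B T
    e.symm.toEquiv.nontrivial
  -- a zero factor would make the tensor product zero
  have hW : ∀ i, Nontrivial (W i) := by
    intro i
    by_contra hi
    rw [not_nontrivial_iff_subsingleton] at hi
    obtain ⟨z, hz⟩ := exists_ne (0 : ⨂[ℂ] i, W i)
    refine hz ?_
    induction z using PiTensorProduct.induction_on with
    | add x y hx hy =>
      by_cases h1 : x = 0
      · by_cases h2 : y = 0
        · rw [h1, h2, add_zero]
        · exact absurd (hy h2) h2
      · exact absurd (hx h1) h1
    | smul_tprod r w =>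
      rw [(PiTensorProduct.tprod ℂ).map_coord_zero i (Subsingleton.elim _ _), smul_zero]
  choose x hx using fun i => exists_ne (0 : W i)
  rw [isSimpleModule_iff]
  refine { toNontrivial := inferInstance, eq_bot_or_eq_top := fun N => ?_ }
  let N' : ∀ i, Submodule ℂ (W i) := Function.update (fun _ => ⊤) j (N.restrictScalars ℂ)
  let R := LinearMap.range (PiTensorProduct.mapIncl N')
  have hN' : ∀ i (a : A i), ∀ w ∈ N' i, Algebra.lsmul ℂ ℂ (W i) a w ∈ N' i := by
    intro i a w hw
    by_cases hi : i = j
    · subst hi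
      simp only [N', Function.update_self] at hw ⊢
      exact N.smul_mem a hw
    · simp [N', Function.update_of_ne hi]
  have hmem : ∀ w : ∀ i, W i, w j ∈ N →
      (⨂ₜ[ℂ] i, w i) ∈ LinearMap.range (PiTensorProduct.mapIncl N') := by
    intro w hw
    have hw' : ∀ i, w i ∈ N' i := by
      intro i
      by_cases hi : i = j
      · subst hi; simpa [N'] using hw
      · simp [N', Function.update_of_ne hi]
    exact ⟨⨂ₜ[ℂ] i, ⟨w i, hw' i⟩, PiTensorProduct.map_tprod _ _⟩
  let P : Submodule B T :=
    { carrier := {z | e z ∈ R}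
      add_mem' := fun {a b} ha hb => by
        show e (a + b) ∈ R
        rw [map_add]; exact Submodule.add_mem _ ha hb
      zero_mem' := by
        show e 0 ∈ R
        rw [map_zero]; exact Submodule.zero_mem _
      smul_mem' := fun b z hz => by
        obtain ⟨X, hX⟩ := h b
        show e (b • z) ∈ R
        rw [hX]
        exact piAct_mem_range_mapIncl hN' X hz }
  rcases hT.1.eq_bot_or_eq_top P with hP | hP
  · left
    rw [Submodule.eq_bot_iff]
    intro w hw
    by_contra hw0
    have h1 : e.symm (⨂ₜ[ℂ] i, Function.update x j w i) ∈ P := by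
      show e (e.symm _) ∈ R
      rw [e.apply_symm_apply]
      exact hmem _ (by simpa using hw)
    rw [hP, Submodule.mem_bot, LinearEquiv.map_eq_zero_iff] at h1
    refine tprod_ne_zero (fun i => ?_) h1
    by_cases hi : i = j
    · subst hi; simpa using hw0
    · simpa [Function.update_of_ne hi] using hx i
  · right
    rw [eq_top_iff]
    rintro w -
    by_contra hw
    -- a functional that vanishes on `N` but not at `w`
    obtain ⟨φ, hφw, hφN⟩ := Submodule.exists_le_ker_of_notMem
      (K := ℂ) (p := N.restrictScalars ℂ) (v := w) hw
    have hψ : ∀ i, ∃ ψ : Module.Dual ℂ (W i), ψ (x i) ≠ 0 := fun i => by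
      by_contra! h'
      exact hx i ((Module.forall_dual_apply_eq_zero_iff ℂ _).1 h')
    choose ψ hψ using hψ
    have h0 : ∀ z ∈ LinearMap.range (PiTensorProduct.mapIncl N'),
        PiTensorProduct.dualDistrib (⨂ₜ[ℂ] i, Function.update ψ j φ i) z = 0 := by
      rintro _ ⟨y, rfl⟩
      induction y using PiTensorProduct.induction_on with
      | add a b ha hb => rw [map_add, map_add, ha, hb, add_zero]
      | smul_tprod r y =>
        rw [map_smul, map_smul, PiTensorProduct.mapIncl, PiTensorProduct.map_tprod,
          PiTensorProduct.dualDistrib_apply, Finset.prod_eq_zero (Finset.mem_univ j), smul_zero]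
        have hy := (y j).2
        have : N' j = N.restrictScalars ℂ := Function.update_self ..
        rw [Function.update_self]
        exact hφN (this ▸ hy)
    have h1 : e.symm (⨂ₜ[ℂ] i, Function.update x j w i) ∈ P := hP ▸ Submodule.mem_top
    have h2 := h0 _ h1
    rw [e.apply_symm_apply, PiTensorProduct.dualDistrib_apply] at h2
    obtain ⟨i, -, hi⟩ := Finset.prod_eq_zero_iff.1 h2
    by_cases hij : i = j
    · subst hij; simp [hφw] at hi
    · simp [Function.update_of_ne hij, hψ] at hi

variable [∀ i, FiniteDimensional ℂ (W i)]

/-- If `B` contains the actions of every `A_i` on its factor, then the tensor product of simple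
modules is simple: by the density theorem a submodule is stable under all operators of rank one
`⨂ (φ_i ⊗ w_i)`, so that it contains every pure tensor as soon as it is nonzero. -/
lemma isSimpleModule_tensor
    (h : ∀ i (a : A i), ∃ b : B, ∀ z : T, e (b • z) =
      PiTensorProduct.map (Function.update (fun _ => LinearMap.id) i (Algebra.lsmul ℂ ℂ (W i) a))
        (e z))
    (hW : ∀ i, IsSimpleModule (A i) (W i)) : IsSimpleModule B T := by
  have hnt : ∀ i, Nontrivial (W i) := fun i => IsSimpleModule.nontrivial (A i) (W i)
  choose x hx using fun i => exists_ne (0 : W i)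
  have : Nontrivial T := e.toEquiv.nontrivial_congr.2 ⟨_, 0, tprod_ne_zero hx⟩
  rw [isSimpleModule_iff]
  refine { toNontrivial := inferInstance, eq_bot_or_eq_top := fun P => ?_ }
  refine or_iff_not_imp_left.2 fun hP => ?_
  obtain ⟨z, hzP, hz⟩ := (Submodule.ne_bot_iff _).1 hP
  have hone : ∀ i (F : Module.End ℂ (W i)), ∀ y ∈ P, e.symm (PiTensorProduct.map
      (Function.update (fun _ => LinearMap.id) i F) (e y)) ∈ P := by
    intro i F y hy
    obtain ⟨a, ha⟩ := exists_smul_eq_of_isSimpleModule (A := A i) F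
    obtain ⟨b, hb⟩ := h i a
    have : Algebra.lsmul ℂ ℂ (W i) a = F := LinearMap.ext ha
    rw [← this, ← hb, e.symm_apply_apply]
    exact P.smul_mem b hy
  -- composing over the factors, `P` is stable under tensor products of operators
  have hall : ∀ (F : ∀ i, Module.End ℂ (W i)) (s : Finset ι), ∀ y ∈ P,
      e.symm (PiTensorProduct.map (fun i => if i ∈ s then F i else LinearMap.id) (e y)) ∈ P := by
    intro F s y hy
    induction s using Finset.induction_on with
    | empty =>
      simp only [Finset.notMem_empty, if_false, PiTensorProduct.map_id, LinearMap.id_apply,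
        e.symm_apply_apply]
      exact hy
    | insert j s hj ih =>
      have := hone j (F j) _ ih
      rw [e.apply_symm_apply, ← LinearMap.comp_apply, ← PiTensorProduct.map_comp] at this
      convert this using 4
      ext1 i
      by_cases hi : i = j
      · subst hi; simp [hj]
      · simp [hi]
  obtain ⟨φ, hφ⟩ : ∃ φ : ∀ i, Module.Dual ℂ (W i),
      PiTensorProduct.dualDistrib (⨂ₜ[ℂ] i, φ i) (e z) ≠ 0 := by
    by_contra! h'
    exact hz (e.map_eq_zero_iff.1 (ext_dualDistrib fun φ => by rw [h', map_zero]))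
  have hrank : ∀ (w : ∀ i, W i) (y : ⨂[ℂ] i, W i),
      PiTensorProduct.map (fun i => (φ i).smulRight (w i)) y =
        PiTensorProduct.dualDistrib (⨂ₜ[ℂ] i, φ i) y • ⨂ₜ[ℂ] i, w i := by
    intro w y
    induction y using PiTensorProduct.induction_on with
    | add a b ha hb => rw [map_add, ha, hb, map_add, add_smul]
    | smul_tprod r y =>
      simp [PiTensorProduct.map_tprod, PiTensorProduct.dualDistrib_apply,
        MultilinearMap.map_smul_univ, smul_smul]
  have hsmul : ∀ (c : ℂ), ∀ y ∈ P, c • y ∈ P := fun c y hy => by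
    rw [← algebraMap_smul B c y]; exact P.smul_mem _ hy
  have htprod : ∀ w : ∀ i, W i, e.symm (⨂ₜ[ℂ] i, w i) ∈ P := by
    intro w
    have h1 := hall (fun i => (φ i).smulRight (w i)) Finset.univ z hzP
    simp only [Finset.mem_univ, if_true] at h1
    rw [hrank, map_smul] at h1
    have h2 := hsmul (PiTensorProduct.dualDistrib (⨂ₜ[ℂ] i, φ i) (e z))⁻¹ _ h1
    rwa [smul_smul, inv_mul_cancel₀ hφ, one_smul] at h2
  rw [eq_top_iff]
  rintro y -
  rw [← e.symm_apply_apply y]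
  generalize e y = y
  induction y using PiTensorProduct.induction_on with
  | add a b ha hb => rw [map_add]; exact P.add_mem ha hb
  | smul_tprod r w => rw [map_smul]; exact hsmul r _ (htprod w)

end SimpleTensors

/-! ### Bijectivity of `Υ^π` -/

lemma finrank_piTensorProduct {ι : Type*} [Fintype ι] {W : ι → Type*} [∀ i, AddCommGroup (W i)]
    [∀ i, Module ℂ (W i)] [∀ i, FiniteDimensional ℂ (W i)] :
    Module.finrank ℂ (⨂[ℂ] i, W i) = ∏ i, Module.finrank ℂ (W i) := by
  classical
  rw [Module.finrank_eq_card_basis (Basis.piTensorProduct fun i => Module.finBasis ℂ (W i))]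
  simp

section Pure

variable {G : Type*} [TopologicalSpace G] [Group G]
  {V E : Type*} [Fintype V] [DecidableEq V] [Fintype E] [DecidableEq E]
  (s t : E → V)
  {S : V → Type*} [∀ v, AddCommGroup (S v)] [∀ v, Module ℂ (S v)]
  {M : E → Type*} [∀ e, AddCommGroup (M e)] [∀ e, Module ℂ (M e)]
  (π : ∀ e, Representation ℂ G (M e))

/-- The homomorphism `ξ ↦ ξ(u) • (⨂ φ_e) ⊗ (⨂ m_e)` in `Hom(S_v^*, M^{S(v)})`. -/
noncomputable def localPure (v : V) (φ : ∀ e : {e // s e = v}, Module.Dual ℂ (M e))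
    (m : ∀ e : {e // t e = v}, M e) (u : S v) : StarHom s t S M v :=
  (Module.Dual.eval ℂ (S v) u).smulRight
    (starEquiv s t M v ((⨂ₜ[ℂ] e, φ e) ⊗ₜ[ℂ] (⨂ₜ[ℂ] e, m e)))

/-- The tensor product over the vertices of the homomorphisms `localPure`, for functionals `φ_e`
and vectors `m_e` attached to the edges and vectors `u_v` attached to the vertices. -/
noncomputable def graphPure (φ : ∀ e, Module.Dual ℂ (M e)) (m : ∀ e, M e) (u : ∀ v, S v) :
    ⨂[ℂ] v, StarHom s t S M v :=
  ⨂ₜ[ℂ] v, localPure s t v (fun e => φ e) (fun e => m e) (u v)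

lemma span_localPure (v : V) [FiniteDimensional ℂ (S v)] :
    Submodule.span ℂ (Set.range fun p : (∀ e : {e // s e = v}, Module.Dual ℂ (M e)) ×
      (∀ e : {e // t e = v}, M e) × S v => localPure s t v p.1 p.2.1 p.2.2) = ⊤ := by
  rw [eq_top_iff]
  rintro T -
  set R := Submodule.span ℂ (Set.range fun p : (∀ e : {e // s e = v}, Module.Dual ℂ (M e)) ×
      (∀ e : {e // t e = v}, M e) × S v => localPure s t v p.1 p.2.1 p.2.2) with hR
  have hx : ∀ (u : S v) (x : StarSpace s t M v),
      LinearMap.smulRightₗ (Module.Dual.eval ℂ (S v) u) x ∈ R := by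
    intro u x
    obtain ⟨x, rfl⟩ := (starEquiv s t M v).surjective x
    induction x using TensorProduct.induction_on with
    | zero => simp
    | add x y hx hy => rw [map_add, map_add]; exact R.add_mem hx hy
    | tmul a b =>
      induction a using PiTensorProduct.induction_on with
      | add a a' h h' => rw [TensorProduct.add_tmul, map_add, map_add]; exact R.add_mem h h'
      | smul_tprod r φ =>
        rw [← TensorProduct.smul_tmul', map_smul, map_smul]
        refine R.smul_mem r ?_
        induction b using PiTensorProduct.induction_on with
        | add b b' h h' => rw [TensorProduct.tmul_add, map_add, map_add]; exact R.add_mem h h'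
        | smul_tprod r m =>
          rw [TensorProduct.tmul_smul, map_smul, map_smul]
          exact R.smul_mem r (Submodule.subset_span ⟨(φ, m, u), rfl⟩)
  -- the expansion of `T` in a basis of `S_v` and the dual basis
  have hT : T = ∑ r, LinearMap.smulRightₗ (Module.Dual.eval ℂ (S v) (Module.finBasis ℂ (S v) r))
      (T ((Module.finBasis ℂ (S v)).coord r)) := by
    refine LinearMap.ext fun ξ => ?_
    have hξ : ξ = ∑ r, ξ (Module.finBasis ℂ (S v) r) • (Module.finBasis ℂ (S v)).coord r :=
      (Module.finBasis ℂ (S v)).ext fun j => by simp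
    conv_lhs => rw [hξ, map_sum]
    simp [LinearMap.sum_apply]
  rw [hT]
  exact R.sum_mem fun r _ => hx _ _

/-- Linear maps out of `⨂_v Hom(S_v^*, M^{S(v)})` are determined by their values on the tensors
`graphPure`. -/
lemma graphPure_ext [∀ v, FiniteDimensional ℂ (S v)] {N : Type*} [AddCommGroup N] [Module ℂ N]
    {F F' : (⨂[ℂ] v, StarHom s t S M v) →ₗ[ℂ] N}
    (h : ∀ φ m u, F (graphPure s t φ m u) = F' (graphPure s t φ m u)) : F = F' := by
  refine PiTensorProduct.ext_of_span_eq_top (fun v => span_localPure s t v) fun p => ?_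
  have e : (fun v => localPure s t v (p v).1 (p v).2.1 (p v).2.2 : ∀ v, StarHom s t S M v) =
      fun v => localPure s t v (fun e => (p (s e)).1 ⟨e, rfl⟩)
        (fun e => (p (t e)).2.1 ⟨e, rfl⟩) (p v).2.2 := by
    ext1 v
    congr 1
    · ext1 ⟨e, he⟩; subst he; rfl
    · ext1 ⟨e, he⟩; subst he; rfl
  rw [e]
  exact h (fun e => (p (s e)).1 ⟨e, rfl⟩) (fun e => (p (t e)).2.1 ⟨e, rfl⟩) fun v => (p v).2.2

variable [∀ e, FiniteDimensional ℂ (M e)]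

lemma tau_localPure (v : V) [FiniteDimensional ℂ (S v)]
    (φ : ∀ e : {e // s e = v}, Module.Dual ℂ (M e)) (m : ∀ e : {e // t e = v}, M e) (u : S v) :
    tau s t v (localPure s t v φ m u) =
      starEquiv s t M v ((⨂ₜ[ℂ] e, φ e) ⊗ₜ[ℂ] (⨂ₜ[ℂ] e, m e)) ⊗ₜ[ℂ] u := by
  rw [tau_apply]
  conv_rhs => rw [← (Module.finBasis ℂ (S v)).sum_repr u, TensorProduct.tmul_sum]
  refine Finset.sum_congr rfl fun r _ => ?_
  rw [localPure, LinearMap.smulRight_apply, TensorProduct.tmul_smul, TensorProduct.smul_tmul']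
  rfl

variable [∀ v, FiniteDimensional ℂ (S v)]

lemma Upsilon_graphPure (φ : ∀ e, Module.Dual ℂ (M e)) (m : ∀ e, M e) (u : ∀ v, S v) :
    Upsilon s t π S (graphPure s t φ m u) = spinEquiv (edgeTensorRep π) S
      (coeffMap (edgeTensorRep π) (PiTensorProduct.dualDistrib (⨂ₜ[ℂ] e, φ e)) (⨂ₜ[ℂ] e, m e)
        ⊗ₜ[ℂ] (⨂ₜ[ℂ] v, u v)) := by
  rw [Upsilon, LinearMap.comp_apply, graphPure, PiTensorProduct.map_tprod]
  simp only [tau_localPure]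
  exact Psi_tprod s t π φ m u

lemma Upsilon_surjective : Function.Surjective (Upsilon s t π S) := by
  rw [← LinearMap.range_eq_top, eq_top_iff]
  rintro y -
  set R := LinearMap.range (Upsilon s t π S)
  obtain ⟨y, rfl⟩ := (spinEquiv (edgeTensorRep π) S).surjective y
  induction y using TensorProduct.induction_on with
  | zero => simp
  | add x y hx hy => rw [map_add]; exact R.add_mem hx hy
  | tmul f u =>
    refine reprFun_induction (edgeTensorRep π)
      (p := fun f => spinEquiv (edgeTensorRep π) S (f ⊗ₜ[ℂ] u) ∈ R) f ?_ ?_ ?_ ?_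
    · intro Φ w
      obtain ⟨Φ, rfl⟩ := (PiTensorProduct.dualDistribEquiv (R := ℂ) (M := M)).surjective Φ
      show spinEquiv (edgeTensorRep π) S
        (coeffMap (edgeTensorRep π) (PiTensorProduct.dualDistrib Φ) w ⊗ₜ[ℂ] u) ∈ R
      induction Φ using PiTensorProduct.induction_on with
      | add a b ha hb =>
        rw [map_add, map_add, LinearMap.add_apply, TensorProduct.add_tmul, map_add]
        exact R.add_mem ha hb
      | smul_tprod r φ =>
        rw [map_smul, map_smul, LinearMap.smul_apply, ← TensorProduct.smul_tmul', map_smul]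
        refine R.smul_mem r ?_
        induction w using PiTensorProduct.induction_on with
        | add a b ha hb =>
          rw [map_add, TensorProduct.add_tmul, map_add]
          exact R.add_mem ha hb
        | smul_tprod r m =>
          rw [map_smul, ← TensorProduct.smul_tmul', map_smul]
          refine R.smul_mem r ?_
          induction u using PiTensorProduct.induction_on with
          | add a b ha hb =>
            rw [TensorProduct.tmul_add, map_add]
            exact R.add_mem ha hb
          | smul_tprod r u =>
            rw [TensorProduct.tmul_smul, map_smul]
            exact R.smul_mem r ⟨_, Upsilon_graphPure s t π φ m u⟩
    · rw [TensorProduct.zero_tmul, map_zero]; exact R.zero_mem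
    · intro f f' h h'
      rw [TensorProduct.add_tmul, map_add]; exact R.add_mem h h'
    · intro c f h
      rw [← TensorProduct.smul_tmul', map_smul]; exact R.smul_mem c h

/-- Orthogonality of matrix coefficients in algebraic form: as each `π_e` is irreducible, its
operators span `End(M_e)`, so a linear relation between the products of matrix entries of the
`π_e(g_e)` holds for arbitrary operators in place of the `π_e(g_e)`, in particular for matrix
units. -/
lemma linearIndependent_basisCoeff (hπ : ∀ e, (π e).IsIrreducible) :
    LinearIndependent ℂ fun p : TensorIndex M × TensorIndex M => basisCoeff π p.1 p.2 := by
  rw [Fintype.linearIndependent_iff]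
  intro c hc p
  let b := fun e => Module.finBasis ℂ (M e)
  let L : (⨂[ℂ] e, Module.End ℂ (M e)) →ₗ[ℂ] ℂ :=
    ∑ p : TensorIndex M × TensorIndex M, c p • PiTensorProduct.dualDistrib
      (⨂ₜ[ℂ] e, ((b e).coord (p.1 e)) ∘ₗ (LinearMap.applyₗ (b e (p.2 e))))
  have hL : ∀ T : ∀ e, Module.End ℂ (M e), L (⨂ₜ[ℂ] e, T e) =
      ∑ p : TensorIndex M × TensorIndex M,
        c p * ∏ e, (b e).coord (p.1 e) (T e (b e (p.2 e))) := by
    intro T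
    simp [L, LinearMap.sum_apply, PiTensorProduct.dualDistrib_apply]
  have hL0 : L = 0 := by
    refine PiTensorProduct.ext_of_span_eq_top
      (fun e => span_range_eq_top_of_isIrreducible (π e) (hπ e)) fun g => ?_
    rw [hL, LinearMap.zero_apply]
    have := congrArg (fun f : reprFun (edgeTensorRep π) => (f : (E → G) → ℂ) g) hc
    simp only [Submodule.coe_sum, Submodule.coe_smul, Finset.sum_apply, Pi.smul_apply,
      smul_eq_mul, Submodule.coe_zero, Pi.zero_apply] at this
    rw [← this]
    refine Finset.sum_congr rfl fun p _ => ?_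
    rw [basisCoeff, coeffMap_apply, edgeTensorRep, extTensorRep_tprod,
      PiTensorProduct.dualDistrib_apply]
  -- matrix units pick out the coefficient `c p`
  have h := hL fun e => ((b e).coord (p.2 e)).smulRight (b e (p.1 e))
  rw [hL0, LinearMap.zero_apply, Finset.sum_eq_single p] at h
  · simpa using h.symm
  · intro q _ hq
    by_contra hne
    refine hq ?_
    have hne' := Finset.prod_ne_zero_iff.1 (right_ne_zero_of_mul hne)
    have hcomp : ∀ e, q.1 e = p.1 e ∧ q.2 e = p.2 e := by
      intro e
      have := hne' e (Finset.mem_univ e)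
      simp only [LinearMap.smulRight_apply, map_smul, smul_eq_mul, Module.Basis.coord_apply,
        Module.Basis.repr_self] at this
      have h1 := left_ne_zero_of_mul this
      have h2 := right_ne_zero_of_mul this
      rw [Finsupp.single_apply_ne_zero] at h1 h2
      exact ⟨h2.1, h1.1.symm⟩
    exact Prod.ext (funext fun e => (hcomp e).1) (funext fun e => (hcomp e).2)
  · simp

/-- Surjectivity comes from the spanning tensors; the dimension of the domain is at most that of the
codomain by the linear independence of the matrix entries. -/
lemma Upsilon_bijective (hπ : ∀ e, (π e).IsIrreducible) :
    Function.Bijective (Upsilon s t π S) := by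
  have : FiniteDimensional ℂ (SpinSpace (edgeTensorRep π) S) :=
    Module.Finite.equiv (spinEquiv (edgeTensorRep π) S)
  have hstar : ∀ v, Module.finrank ℂ (StarSpace s t M v) =
      (∏ e : {e // s e = v}, Module.finrank ℂ (M e)) *
        ∏ e : {e // t e = v}, Module.finrank ℂ (M e) := by
    intro v
    rw [← (starEquiv s t M v).finrank_eq, Module.finrank_tensorProduct, finrank_piTensorProduct,
      finrank_piTensorProduct]
    simp only [Subspace.dual_finrank_eq]
  have hfin : ∀ v, FiniteDimensional ℂ (StarSpace s t M v) := fun v =>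
    Module.Finite.equiv (starEquiv s t M v)
  have hdom : Module.finrank ℂ (⨂[ℂ] v, StarHom s t S M v) =
      ((∏ e, Module.finrank ℂ (M e)) * ∏ e, Module.finrank ℂ (M e)) *
        ∏ v, Module.finrank ℂ (S v) := by
    rw [finrank_piTensorProduct]
    simp only [Module.finrank_linearMap, Module.finrank_self, hstar, Finset.prod_mul_distrib,
      mul_one]
    rw [Fintype.prod_fiberwise s fun e => Module.finrank ℂ (M e),
      Fintype.prod_fiberwise t fun e => Module.finrank ℂ (M e), mul_comm]
  have hcod : Module.finrank ℂ (SpinSpace (edgeTensorRep π) S) =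
      Module.finrank ℂ (reprFun (edgeTensorRep π)) * ∏ v, Module.finrank ℂ (S v) := by
    rw [← (spinEquiv (edgeTensorRep π) S).finrank_eq, Module.finrank_tensorProduct,
      finrank_piTensorProduct]
  have hrepr : (∏ e, Module.finrank ℂ (M e)) * ∏ e, Module.finrank ℂ (M e) ≤
      Module.finrank ℂ (reprFun (edgeTensorRep π)) := by
    have := (linearIndependent_basisCoeff π hπ).fintype_card_le_finrank
    simpa using this
  have hsurj := Upsilon_surjective s t π (S := S)
  have hle : Module.finrank ℂ (⨂[ℂ] v, StarHom s t S M v) ≤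
      Module.finrank ℂ (SpinSpace (edgeTensorRep π) S) := by
    rw [hdom, hcod]
    exact Nat.mul_le_mul_right _ hrepr
  have heq := le_antisymm hle (LinearMap.finrank_le_finrank_of_surjective hsurj)
  exact ⟨(LinearMap.injective_iff_surjective_of_finrank_eq_finrank heq).2 hsurj, hsurj⟩

end Pure

/-! ### Action of a single factor -/

section SingleFactor

variable {ι : Type*} [DecidableEq ι] {A : ι → Type*} [∀ i, Ring (A i)] [∀ i, Algebra ℂ (A i)]
  {W : ι → Type*} [∀ i, AddCommGroup (W i)] [∀ i, Module ℂ (W i)]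

lemma piAct_single (F : ∀ i, A i →ₐ[ℂ] Module.End ℂ (W i)) (i : ι) (a : A i) :
    piAct F (PiTensorProduct.singleAlgHom (R := ℂ) i a) =
      PiTensorProduct.map (Function.update (fun _ => LinearMap.id) i (F i a)) := by
  refine PiTensorProduct.ext (MultilinearMap.ext fun w => ?_)
  rw [LinearMap.compMultilinearMap_apply, LinearMap.compMultilinearMap_apply,
    PiTensorProduct.singleAlgHom_apply, piAct_tprod, PiTensorProduct.map_tprod]
  congr 1
  ext1 j
  by_cases hj : j = i
  · subst hj; simp
  · simp [Pi.mulSingle_eq_of_ne hj, Function.update_of_ne hj]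

lemma piAct_single_tprod (F : ∀ i, A i →ₐ[ℂ] Module.End ℂ (W i)) (i : ι) (a : A i)
    (w : ∀ i, W i) :
    piAct F (PiTensorProduct.singleAlgHom (R := ℂ) i a) (⨂ₜ[ℂ] i, w i) =
      ⨂ₜ[ℂ] j, Function.update w i (F i a (w i)) j := by
  rw [piAct_single, PiTensorProduct.map_tprod]
  congr 1
  ext1 j
  by_cases hj : j = i
  · subst hj; simp
  · simp [Function.update_of_ne hj]

end SingleFactor

/-! ### Gauge equivariance of `Υ^π` -/

section Gauge

variable {G : Type*} [TopologicalSpace G] [Group G]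
  {V E : Type*} [Fintype V] [DecidableEq V] [Fintype E] [DecidableEq E]
  (s t : E → V) (K : V → Subgroup G)
  {S : V → Type*} [∀ v, AddCommGroup (S v)] [∀ v, Module ℂ (S v)]
  (σ : ∀ v, Representation ℂ (K v) (S v))
  {M : E → Type*} [∀ e, AddCommGroup (M e)] [∀ e, Module ℂ (M e)]
  (π : ∀ e, Representation ℂ G (M e))

lemma dual_edgeTensorRep (g : E → G) (φ : ∀ e, Module.Dual ℂ (M e)) :
    (edgeTensorRep π).dual g (PiTensorProduct.dualDistrib (⨂ₜ[ℂ] e, φ e)) =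
      PiTensorProduct.dualDistrib (⨂ₜ[ℂ] e, (π e).dual (g e) (φ e)) :=
  LinearMap.ext fun z => dualDistrib_map (fun e => π e ((g e)⁻¹)) φ z

lemma biReg_edgeTensorRep (h : (E → G) × (E → G)) (φ : ∀ e, Module.Dual ℂ (M e))
    (m : ∀ e, M e) :
    biReg (edgeTensorRep π) h
        (coeffMap (edgeTensorRep π) (PiTensorProduct.dualDistrib (⨂ₜ[ℂ] e, φ e)) (⨂ₜ[ℂ] e, m e)) =
      coeffMap (edgeTensorRep π)
        (PiTensorProduct.dualDistrib (⨂ₜ[ℂ] e, (π e).dual (h.1 e) (φ e)))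
        (⨂ₜ[ℂ] e, π e (h.2 e) (m e)) := by
  rw [biReg_coeffMap, dual_edgeTensorRep]
  congr 1
  exact extTensorRep_tprod π h.2 m

lemma homRep_localPure (v : V) (k : K v) (φ : ∀ e : {e // s e = v}, Module.Dual ℂ (M e))
    (m : ∀ e : {e // t e = v}, M e) (u : S v) :
    homRep s t K σ π v k (localPure s t v φ m u) =
      localPure s t v (fun e => (π e).dual (k : G) (φ e)) (fun e => π e (k : G) (m e))
        (σ v k u) := by
  have hstar : starRep s t K π v k
      (starEquiv s t M v ((⨂ₜ[ℂ] e, φ e) ⊗ₜ[ℂ] (⨂ₜ[ℂ] e, m e))) =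
      starEquiv s t M v ((⨂ₜ[ℂ] e, (π e).dual (k : G) (φ e)) ⊗ₜ[ℂ]
        (⨂ₜ[ℂ] e, π e (k : G) (m e))) :=
    congrArg₂ (fun p q => starEquiv s t M v (p ⊗ₜ[ℂ] q))
      (extTensorRep_tprod (fun e : {e // s e = v} => (π e).dual) (fun _ => (k : G)) φ)
      (extTensorRep_tprod (fun e : {e // t e = v} => π e) (fun _ => (k : G)) m)
  refine LinearMap.ext fun ξ => ?_
  show starRep s t K π v k (localPure s t v φ m u ((σ v).dual k⁻¹ ξ)) = _
  rw [localPure, localPure, LinearMap.smulRight_apply, LinearMap.smulRight_apply, map_smul, hstar]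
  congr 1
  simp [Module.Dual.transpose_apply]

lemma extTensorRep_graphPure (k : ∀ v, K v) (φ : ∀ e, Module.Dual ℂ (M e)) (m : ∀ e, M e)
    (u : ∀ v, S v) :
    extTensorRep (fun v => homRep s t K σ π v) k (graphPure s t φ m u) =
      graphPure s t (fun e => (π e).dual (k (s e) : G) (φ e)) (fun e => π e (k (t e) : G) (m e))
        (fun v => σ v (k v) (u v)) := by
  rw [graphPure, extTensorRep_tprod]
  simp only [homRep_localPure]
  have hv : ∀ v, localPure s t v (fun e : {e // s e = v} => (π e).dual (k v : G) (φ e))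
      (fun e : {e // t e = v} => π e (k v : G) (m e)) (σ v (k v) (u v)) =
      localPure s t v (fun e : {e // s e = v} => (π e).dual (k (s e) : G) (φ e))
        (fun e : {e // t e = v} => π e (k (t e) : G) (m e)) (σ v (k v) (u v)) := by
    intro v
    congr 1
    · ext1 ⟨e, he⟩; subst he; rfl
    · ext1 ⟨e, he⟩; subst he; rfl
  simp only [hv]
  rfl

variable [T2Space G] [CompactSpace G] [∀ e, FiniteDimensional ℂ (M e)]
  [∀ e, IsContinuousRep (π e)] [∀ v, FiniteDimensional ℂ (S v)]

lemma Upsilon_gauge (k : ∀ v, K v) (z : ⨂[ℂ] v, StarHom s t S M v) :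
    Upsilon s t π S (extTensorRep (fun v => homRep s t K σ π v) k z) =
      gaugeSpinRep s t K (edgeTensorRep π) σ k (Upsilon s t π S z) := by
  have h : Upsilon s t π S ∘ₗ extTensorRep (fun v => homRep s t K σ π v) k =
      gaugeSpinRep s t K (edgeTensorRep π) σ k ∘ₗ Upsilon s t π S := by
    refine graphPure_ext s t fun φ m u => ?_
    rw [LinearMap.comp_apply, LinearMap.comp_apply, extTensorRep_graphPure, Upsilon_graphPure,
      Upsilon_graphPure, gaugeSpinRep_tmul, extTensorRep_tprod]
    congr 2
    exact (biReg_edgeTensorRep π (gaugePair s t K k) φ m).symm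
  exact LinearMap.congr_fun h z

end Gauge

/-! ### Equivariance of `Υ^π` under the enveloping algebra -/

section Enveloping

variable (𝔼 : Type*) [NormedAddCommGroup 𝔼] [NormedSpace ℝ 𝔼] [FiniteDimensional ℝ 𝔼]
  {G : Type*} [TopologicalSpace G] [ChartedSpace 𝔼 G] [Group G] [LieGroup 𝓘(ℝ, 𝔼) ∞ G]

lemma adC_one (x : LieC 𝔼 G) : adC 𝔼 (1 : G) x = x := by
  have e : (mfderiv 𝓘(ℝ, 𝔼) 𝓘(ℝ, 𝔼) (fun g : G => 1 * g * 1⁻¹) 1 : 𝔼 →L[ℝ] 𝔼) =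
      ContinuousLinearMap.id ℝ 𝔼 := by
    have e : (fun g : G => 1 * g * 1⁻¹) = id := by ext; simp
    rw [e]; exact mfderiv_id
  have : adLin (𝔼 := 𝔼) (1 : G) = LinearMap.id :=
    LinearMap.ext fun x => congrArg (fun T : 𝔼 →L[ℝ] 𝔼 => T x) e
  rw [adC, this]
  simp

lemma envAd_one : envAd 𝔼 (1 : G) = AlgHom.id ℂ (EnvG 𝔼 G) := by
  apply env_hom_ext
  intro x
  rw [envAd, envLift_ι, LinearMap.comp_apply, adC_one]
  rfl

variable [T2Space G] [CompactSpace G]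

lemma intertwine_diffRepC_one {W W' : Type*} [AddCommGroup W] [Module ℂ W]
    [FiniteDimensional ℂ W] [AddCommGroup W'] [Module ℂ W'] [FiniteDimensional ℂ W']
    (ρ : Representation ℂ G W) [IsContinuousRep ρ] (ρ' : Representation ℂ G W')
    [IsContinuousRep ρ'] (T : W →ₗ[ℂ] W') (hT : ∀ h w, T (ρ h w) = ρ' h (T w)) (x : LieC 𝔼 G)
    (w : W) : T (diffRepC 𝔼 ρ x w) = diffRepC 𝔼 ρ' x (T w) := by
  rw [intertwine_diffRepC 𝔼 ρ ρ' T 1 (fun h w => by simpa using hT h w), adC_one]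

variable {V E : Type*} [Fintype V] [DecidableEq V] [Fintype E] [DecidableEq E]
  (s t : E → V)
  {S : V → Type*} [∀ v, AddCommGroup (S v)] [∀ v, Module ℂ (S v)]
  {M : E → Type*} [∀ e, AddCommGroup (M e)] [∀ e, Module ℂ (M e)]
  [∀ e, FiniteDimensional ℂ (M e)] (π : ∀ e, Representation ℂ G (M e))
  [∀ e, IsContinuousRep (π e)]

lemma diffRepC_leftEdgeRep (e : E) (x : LieC 𝔼 G) (φ : ∀ e, Module.Dual ℂ (M e)) (m : ∀ e, M e) :
    diffRepC 𝔼 (leftEdgeRep (edgeTensorRep π) e) x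
        (coeffMap (edgeTensorRep π) (PiTensorProduct.dualDistrib (⨂ₜ[ℂ] e, φ e)) (⨂ₜ[ℂ] e, m e)) =
      coeffMap (edgeTensorRep π) (PiTensorProduct.dualDistrib
        (⨂ₜ[ℂ] e', Function.update φ e (diffRepC 𝔼 (π e).dual x (φ e)) e')) (⨂ₜ[ℂ] e, m e) := by
  let T : Module.Dual ℂ (M e) →ₗ[ℂ] reprFun (edgeTensorRep π) :=
    (coeffMap (edgeTensorRep π)).flip (⨂ₜ[ℂ] e, m e) ∘ₗ PiTensorProduct.dualDistrib ∘ₗ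
      (PiTensorProduct.tprod ℂ).toLinearMap φ e
  have hTa : ∀ ψ, T ψ = coeffMap (edgeTensorRep π) (PiTensorProduct.dualDistrib
    (⨂ₜ[ℂ] e', Function.update φ e ψ e')) (⨂ₜ[ℂ] e, m e) := fun ψ => rfl
  have hT : ∀ h ψ, T ((π e).dual h ψ) = leftEdgeRep (edgeTensorRep π) e h (T ψ) := by
    intro h ψ
    rw [hTa, hTa]
    refine Eq.trans ?_ (biReg_edgeTensorRep π (Pi.mulSingle e h, 1) _ m).symm
    congr 2
    · congr 2
      ext1 e'
      by_cases he : e' = e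
      · subst he; simp
      · dsimp only
        rw [Function.update_of_ne he, Function.update_of_ne he, Pi.mulSingle_eq_of_ne he, map_one]
        rfl
    · simp
  have := intertwine_diffRepC_one 𝔼 (π e).dual (leftEdgeRep (edgeTensorRep π) e) T hT x (φ e)
  rw [hTa, hTa, Function.update_eq_self] at this
  exact this.symm

lemma diffRepC_rightEdgeRep (e : E) (x : LieC 𝔼 G) (φ : ∀ e, Module.Dual ℂ (M e))
    (m : ∀ e, M e) :
    diffRepC 𝔼 (rightEdgeRep (edgeTensorRep π) e) x
        (coeffMap (edgeTensorRep π) (PiTensorProduct.dualDistrib (⨂ₜ[ℂ] e, φ e)) (⨂ₜ[ℂ] e, m e)) =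
      coeffMap (edgeTensorRep π) (PiTensorProduct.dualDistrib (⨂ₜ[ℂ] e, φ e))
        (⨂ₜ[ℂ] e', Function.update m e (diffRepC 𝔼 (π e) x (m e)) e') := by
  let T : M e →ₗ[ℂ] reprFun (edgeTensorRep π) :=
    coeffMap (edgeTensorRep π) (PiTensorProduct.dualDistrib (⨂ₜ[ℂ] e, φ e)) ∘ₗ
      (PiTensorProduct.tprod ℂ).toLinearMap m e
  have hTa : ∀ w, T w = coeffMap (edgeTensorRep π) (PiTensorProduct.dualDistrib
    (⨂ₜ[ℂ] e, φ e)) (⨂ₜ[ℂ] e', Function.update m e w e') := fun w => rfl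
  have hT : ∀ h w, T (π e h w) = rightEdgeRep (edgeTensorRep π) e h (T w) := by
    intro h w
    rw [hTa, hTa]
    refine Eq.trans ?_ (biReg_edgeTensorRep π (1, Pi.mulSingle e h) φ _).symm
    congr 2
    · congr 2
      ext1 e'
      dsimp only
      rw [Pi.one_apply, map_one]
      rfl
    · ext1 e'
      by_cases he : e' = e
      · subst he; simp
      · simp [Function.update_of_ne he, Pi.mulSingle_eq_of_ne he]
  have := intertwine_diffRepC_one 𝔼 (π e) (rightEdgeRep (edgeTensorRep π) e) T hT x (m e)
  rw [hTa, hTa, Function.update_eq_self] at this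
  exact this.symm

lemma homAct_sourceStar (v : V) (e : {e // s e = v}) (X : EnvG 𝔼 G)
    (φ : ∀ e : {e // s e = v}, Module.Dual ℂ (M e)) (m : ∀ e : {e // t e = v}, M e) (u : S v) :
    homAct 𝔼 s t π S v (sourceStar 𝔼 s t v e X) (localPure s t v φ m u) =
      localPure s t v (Function.update φ e (envRep 𝔼 (π e).dual X (φ e))) m u := by
  refine LinearMap.ext fun ξ => ?_
  rw [homAct, AlgHom.comp_apply, postcomp_apply, LinearMap.comp_apply]
  rw [localPure, localPure, LinearMap.smulRight_apply, LinearMap.smulRight_apply, map_smul]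
  congr 1
  refine (starAct_tmul 𝔼 s t π v _ _ _ _).trans ?_
  have h1 := piAct_single_tprod (A := fun _ : {e // s e = v} => EnvG 𝔼 G)
    (fun e : {e // s e = v} => envRep 𝔼 (π e).dual) e X φ
  exact congrArg₂ (fun p q => starEquiv s t M v (p ⊗ₜ[ℂ] q)) h1
    (by rw [map_one, Module.End.one_apply])

lemma homAct_targetStar (v : V) (e : {e // t e = v}) (X : EnvG 𝔼 G)
    (φ : ∀ e : {e // s e = v}, Module.Dual ℂ (M e)) (m : ∀ e : {e // t e = v}, M e) (u : S v) :
    homAct 𝔼 s t π S v (targetStar 𝔼 s t v e X) (localPure s t v φ m u) =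
      localPure s t v φ (Function.update m e (envRep 𝔼 (π e) X (m e))) u := by
  refine LinearMap.ext fun ξ => ?_
  rw [homAct, AlgHom.comp_apply, postcomp_apply, LinearMap.comp_apply]
  rw [localPure, localPure, LinearMap.smulRight_apply, LinearMap.smulRight_apply, map_smul]
  congr 1
  refine (starAct_tmul 𝔼 s t π v _ _ _ _).trans ?_
  have h1 := piAct_single_tprod (A := fun _ : {e // t e = v} => EnvG 𝔼 G)
    (fun e : {e // t e = v} => envRep 𝔼 (π e)) e X m
  exact congrArg₂ (fun p q => starEquiv s t M v (p ⊗ₜ[ℂ] q))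
    (by rw [map_one, Module.End.one_apply]) h1

lemma piAct_sourceIncl_graphPure (e : E) (X : EnvG 𝔼 G) (φ : ∀ e, Module.Dual ℂ (M e))
    (m : ∀ e, M e) (u : ∀ v, S v) :
    piAct (fun v => homAct 𝔼 s t π S v) (sourceIncl 𝔼 s t (s e) ⟨e, rfl⟩ X)
        (graphPure s t φ m u) =
      graphPure s t (Function.update φ e (envRep 𝔼 (π e).dual X (φ e))) m u := by
  refine (piAct_single_tprod (fun v => homAct 𝔼 s t π S v) (s e)
    (sourceStar 𝔼 s t (s e) ⟨e, rfl⟩ X) _).trans ?_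
  rw [homAct_sourceStar, graphPure]
  congr 1
  ext1 v
  by_cases hv : v = s e
  · subst hv
    rw [Function.update_self]
    congr 1
    ext1 ⟨e', he'⟩
    by_cases h : e' = e
    · subst h; simp
    · rw [Function.update_of_ne h, Function.update_of_ne fun h' => h (congrArg Subtype.val h')]
  · rw [Function.update_of_ne hv]
    congr 1
    ext1 ⟨e', he'⟩
    rw [Function.update_of_ne]
    rintro rfl
    exact hv he'.symm

lemma piAct_targetIncl_graphPure (e : E) (X : EnvG 𝔼 G) (φ : ∀ e, Module.Dual ℂ (M e))
    (m : ∀ e, M e) (u : ∀ v, S v) :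
    piAct (fun v => homAct 𝔼 s t π S v) (targetIncl 𝔼 s t (t e) ⟨e, rfl⟩ X)
        (graphPure s t φ m u) =
      graphPure s t φ (Function.update m e (envRep 𝔼 (π e) X (m e))) u := by
  refine (piAct_single_tprod (fun v => homAct 𝔼 s t π S v) (t e)
    (targetStar 𝔼 s t (t e) ⟨e, rfl⟩ X) _).trans ?_
  rw [homAct_targetStar, graphPure]
  congr 1
  ext1 v
  by_cases hv : v = t e
  · subst hv
    rw [Function.update_self]
    congr 1
    ext1 ⟨e', he'⟩
    by_cases h : e' = e
    · subst h; simp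
    · rw [Function.update_of_ne h, Function.update_of_ne fun h' => h (congrArg Subtype.val h')]
  · rw [Function.update_of_ne hv]
    congr 1
    ext1 ⟨e', he'⟩
    rw [Function.update_of_ne]
    rintro rfl
    exact hv he'.symm

variable [∀ v, FiniteDimensional ℂ (S v)]

/-- `Υ^π` intertwines the actions of `U(𝔤^E × 𝔤^E)`: on a component of the Lie algebra at one edge
both actions differentiate the functional, or the vector, attached to that edge. -/
lemma Upsilon_envAct (X : EnvE 𝔼 G E) (z : ⨂[ℂ] v, StarHom s t S M v) :
    Upsilon s t π S (tensorHomAct 𝔼 s t π S X z) =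
      envFunTensor 𝔼 (edgeTensorRep π) S X (Upsilon s t π S z) := by
  refine env_intertwine (tensorHomAct 𝔼 s t π S) (envFunTensor 𝔼 (edgeTensorRep π) S)
    (AlgHom.id ℂ (EnvE 𝔼 G E)) (Upsilon s t π S) ?_ X z
  rintro ⟨x, y⟩ z
  have h : Upsilon s t π S ∘ₗ tensorHomAct 𝔼 s t π S (envι (LieE 𝔼 G E) (x, y)) =
      envFunTensor 𝔼 (edgeTensorRep π) S (envι (LieE 𝔼 G E) (x, y)) ∘ₗ Upsilon s t π S := by
    refine graphPure_ext s t fun φ m u => ?_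
    rw [LinearMap.comp_apply, LinearMap.comp_apply, Upsilon_graphPure, envFunTensor_tmul, envFun,
      envLift_ι, tensorHomAct, AlgHom.comp_apply, distrib, envLift_ι]
    simp only [distribLie, twoSidedDeriv, LinearMap.coprod_apply, sumMap_apply, map_add, map_sum,
      LinearMap.comp_apply, AlgHom.toLinearMap_apply, LinearMap.add_apply, LinearMap.sum_apply,
      TensorProduct.add_tmul, TensorProduct.sum_tmul, diffRepC_leftEdgeRep,
      diffRepC_rightEdgeRep, piAct_sourceIncl_graphPure, piAct_targetIncl_graphPure,
      Upsilon_graphPure, envRep, envLift_ι]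
  exact LinearMap.congr_fun h z

end Enveloping

/-! ### Invariants in the enveloping algebra -/

section Invariants

variable (𝔼 : Type*) [NormedAddCommGroup 𝔼] [NormedSpace ℝ 𝔼] [FiniteDimensional ℝ 𝔼]
  {G : Type*} [TopologicalSpace G] [ChartedSpace 𝔼 G] [Group G] [LieGroup 𝓘(ℝ, 𝔼) ∞ G]
  {V E : Type*} [Fintype V] [DecidableEq V] [Fintype E] [DecidableEq E]
  (s t : E → V) (K : V → Subgroup G)

lemma piMapAlg_apply {ι : Type*} {A B : ι → Type*} [∀ i, Ring (A i)] [∀ i, Algebra ℂ (A i)]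
    [∀ i, Ring (B i)] [∀ i, Algebra ℂ (B i)] (u : ∀ i, A i →ₐ[ℂ] B i) (X : ⨂[ℂ] i, A i) :
    piMapAlg u X = PiTensorProduct.map (fun i => (u i).toLinearMap) X := rfl

lemma starAd_one (v : V) (X : StarEnv 𝔼 G s t v) : starAd 𝔼 s t K v 1 X = X := by
  obtain ⟨X, rfl⟩ := (starEnvEquiv 𝔼 s t v).surjective X
  have hid : ∀ {ι : Type _} (Y : ⨂[ℂ] _ : ι, EnvG 𝔼 G),
      piMapAlg (fun _ => envAd 𝔼 (((1 : K v) : G))) Y = Y := by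
    intro ι Y
    rw [OneMemClass.coe_one, envAd_one, piMapAlg_apply]
    exact LinearMap.congr_fun PiTensorProduct.map_id Y
  induction X using TensorProduct.induction_on with
  | zero => simp
  | add X Y hX hY => rw [map_add, map_add, hX, hY]
  | tmul X Y => rw [starAd_tmul, hid, hid]

/-- A gauge invariant element of `U(𝔤^E × 𝔤^E) ≅ ⨂_v U(𝔤)^{(v)}` is a tensor in the invariants of
the factors, since the gauge group is the product of the groups `K_v`. -/
lemma distrib_mem_range_mapIncl (X : EnvE 𝔼 G E) (hX : X ∈ envInv 𝔼 s t K) :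
    distrib 𝔼 s t X ∈ LinearMap.range (PiTensorProduct.mapIncl fun v =>
      Subalgebra.toSubmodule (starInv 𝔼 (G := G) s t K v)) := by
  refine mem_range_mapIncl_of_fixed (Γ := fun v => K v)
    (fun v k => (starAd 𝔼 s t K v k).toLinearMap)
    (fun v => LinearMap.ext fun X => starAd_one 𝔼 s t K v X) _
    (fun v X hX => (mem_starInv 𝔼 s t K).2 hX) _ fun k => ?_
  rw [← piMapAlg_apply, ← distrib_envGauge, (mem_envInv 𝔼 s t K).1 hX k]

/-- The inclusion of `U(𝔤)` in `U(𝔤^E × 𝔤^E)` as the component of `e` in the first argument. -/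
noncomputable def envLeft (e : E) : EnvG 𝔼 G →ₐ[ℂ] EnvE 𝔼 G E :=
  envLift (envι (LieE 𝔼 G E) ∘ₗ LinearMap.inl ℂ (E → LieC 𝔼 G) (E → LieC 𝔼 G) ∘ₗ
      LinearMap.single ℂ (fun _ => LieC 𝔼 G) e)
    ((isLieMap_envι (LieE 𝔼 G E)).comp_lie _ fun x y => by
      refine Prod.ext (funext fun e' => ?_) (funext fun e' => (lie_self (0 : LieC 𝔼 G)).symm)
      show Pi.single (M := fun _ => LieC 𝔼 G) e ⁅x, y⁆ e' =
        ⁅Pi.single (M := fun _ => LieC 𝔼 G) e x e', Pi.single (M := fun _ => LieC 𝔼 G) e y e'⁆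
      by_cases h : e' = e
      · subst h; simp only [Pi.single_eq_same]
      · simp only [Pi.single_eq_of_ne h, lie_self])

/-- The inclusion of `U(𝔤)` in `U(𝔤^E × 𝔤^E)` as the component of `e` in the second argument. -/
noncomputable def envRight (e : E) : EnvG 𝔼 G →ₐ[ℂ] EnvE 𝔼 G E :=
  envLift (envι (LieE 𝔼 G E) ∘ₗ LinearMap.inr ℂ (E → LieC 𝔼 G) (E → LieC 𝔼 G) ∘ₗ
      LinearMap.single ℂ (fun _ => LieC 𝔼 G) e)
    ((isLieMap_envι (LieE 𝔼 G E)).comp_lie _ fun x y => by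
      refine Prod.ext (funext fun e' => (lie_self (0 : LieC 𝔼 G)).symm) (funext fun e' => ?_)
      show Pi.single (M := fun _ => LieC 𝔼 G) e ⁅x, y⁆ e' =
        ⁅Pi.single (M := fun _ => LieC 𝔼 G) e x e', Pi.single (M := fun _ => LieC 𝔼 G) e y e'⁆
      by_cases h : e' = e
      · subst h; simp only [Pi.single_eq_same]
      · simp only [Pi.single_eq_of_ne h, lie_self])

lemma envLeft_ι (e : E) (x : LieC 𝔼 G) :
    envLeft 𝔼 e (envι _ x) = envι (LieE 𝔼 G E) (Pi.single e x, 0) :=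
  envLift_ι _ _ x

lemma envRight_ι (e : E) (x : LieC 𝔼 G) :
    envRight 𝔼 e (envι _ x) = envι (LieE 𝔼 G E) (0, Pi.single e x) :=
  envLift_ι _ _ x

lemma sumMap_single {ι A : Type*} [Fintype ι] [DecidableEq ι] {L : Type*} [AddCommGroup L]
    [Module ℂ L] [AddCommGroup A] [Module ℂ A] (f : ι → L →ₗ[ℂ] A) (i : ι) (x : L) :
    sumMap f (Pi.single i x) = f i x := by
  rw [sumMap_apply, Finset.sum_eq_single i, Pi.single_eq_same]
  · intro j _ hj
    rw [Pi.single_eq_of_ne hj, map_zero]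
  · simp

lemma distrib_envLeft (v : V) (e : {e // s e = v}) (X : EnvG 𝔼 G) :
    distrib 𝔼 s t (envLeft 𝔼 (e : E) X) = sourceIncl 𝔼 s t v e X := by
  obtain ⟨e, rfl⟩ := e
  have h : (distrib 𝔼 s t).comp (envLeft 𝔼 e) = sourceIncl 𝔼 (G := G) s t (s e) ⟨e, rfl⟩ := by
    apply env_hom_ext
    intro x
    rw [AlgHom.comp_apply, envLeft_ι, distrib, envLift_ι, distribLie, LinearMap.coprod_apply,
      sumMap_single, map_zero, add_zero]
    rfl
  exact congrArg (fun F : _ →ₐ[ℂ] _ => F X) h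

lemma distrib_envRight (v : V) (e : {e // t e = v}) (X : EnvG 𝔼 G) :
    distrib 𝔼 s t (envRight 𝔼 (e : E) X) = targetIncl 𝔼 s t v e X := by
  obtain ⟨e, rfl⟩ := e
  have h : (distrib 𝔼 s t).comp (envRight 𝔼 e) = targetIncl 𝔼 (G := G) s t (t e) ⟨e, rfl⟩ := by
    apply env_hom_ext
    intro x
    rw [AlgHom.comp_apply, envRight_ι, distrib, envLift_ι, distribLie, LinearMap.coprod_apply,
      sumMap_single, map_zero, zero_add]
    rfl
  exact congrArg (fun F : _ →ₐ[ℂ] _ => F X) h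

lemma envGauge_envLeft (k : ∀ v, K v) (e : E) (X : EnvG 𝔼 G) :
    envGauge 𝔼 s t K k (envLeft 𝔼 e X) = envLeft 𝔼 e (envAd 𝔼 (k (s e) : G) X) := by
  have h : (envGauge 𝔼 s t K k).comp (envLeft 𝔼 e) =
      (envLeft 𝔼 e).comp (envAd 𝔼 (k (s e) : G)) := by
    apply env_hom_ext
    intro x
    rw [AlgHom.comp_apply, AlgHom.comp_apply, envLeft_ι, envGauge, envLift_ι, envAd, envLift_ι,
      LinearMap.comp_apply, LinearMap.comp_apply, envLeft_ι]
    refine congrArg _ (Prod.ext (funext fun e' => ?_)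
      (funext fun e' => map_zero (adC 𝔼 (k (t e') : G))))
    show adC 𝔼 (k (s e') : G) (Pi.single (M := fun _ => LieC 𝔼 G) e x e') =
      Pi.single (M := fun _ => LieC 𝔼 G) e (adC 𝔼 (k (s e) : G) x) e'
    by_cases h : e' = e
    · subst h; simp only [Pi.single_eq_same]
    · simp only [Pi.single_eq_of_ne h, map_zero]
  exact congrArg (fun F : _ →ₐ[ℂ] _ => F X) h

lemma envGauge_envRight (k : ∀ v, K v) (e : E) (X : EnvG 𝔼 G) :
    envGauge 𝔼 s t K k (envRight 𝔼 e X) = envRight 𝔼 e (envAd 𝔼 (k (t e) : G) X) := by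
  have h : (envGauge 𝔼 s t K k).comp (envRight 𝔼 e) =
      (envRight 𝔼 e).comp (envAd 𝔼 (k (t e) : G)) := by
    apply env_hom_ext
    intro x
    rw [AlgHom.comp_apply, AlgHom.comp_apply, envRight_ι, envGauge, envLift_ι, envAd, envLift_ι,
      LinearMap.comp_apply, LinearMap.comp_apply, envRight_ι]
    refine congrArg _ (Prod.ext (funext fun e' => map_zero (adC 𝔼 (k (s e') : G)))
      (funext fun e' => ?_))
    show adC 𝔼 (k (t e') : G) (Pi.single (M := fun _ => LieC 𝔼 G) e x e') =
      Pi.single (M := fun _ => LieC 𝔼 G) e (adC 𝔼 (k (t e) : G) x) e'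
    by_cases h : e' = e
    · subst h; simp only [Pi.single_eq_same]
    · simp only [Pi.single_eq_of_ne h, map_zero]
  exact congrArg (fun F : _ →ₐ[ℂ] _ => F X) h

/-- The inclusion of `U(𝔤)^{(v)}` in `U(𝔤^E × 𝔤^E)`, as a linear map: the components at the edges
are multiplied in a fixed order. The factors commute, so that this is a homomorphism of algebras,
but only `distrib_starLift` and `envGauge_starLift` matter. -/
noncomputable def starLift (v : V) : StarEnv 𝔼 G s t v →ₗ[ℂ] EnvE 𝔼 G E :=
  TensorProduct.lift ((LinearMap.mul ℂ (EnvE 𝔼 G E)).compl₁₂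
      (orderedProd fun e : {e // s e = v} => (envLeft 𝔼 (G := G) (e : E)).toLinearMap)
      (orderedProd fun e : {e // t e = v} => (envRight 𝔼 (G := G) (e : E)).toLinearMap)) ∘ₗ
    (starEnvEquiv 𝔼 s t v).symm.toLinearMap

lemma starLift_tmul (v : V) (X : ⨂[ℂ] _ : {e // s e = v}, EnvG 𝔼 G)
    (Y : ⨂[ℂ] _ : {e // t e = v}, EnvG 𝔼 G) :
    starLift 𝔼 s t v (starEnvEquiv 𝔼 s t v (X ⊗ₜ Y)) =
      orderedProd (fun e : {e // s e = v} => (envLeft 𝔼 (e : E)).toLinearMap) X *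
        orderedProd (fun e : {e // t e = v} => (envRight 𝔼 (e : E)).toLinearMap) Y := rfl

/-- The inclusion of `U(𝔤)^{(v)}` in `U(𝔤^E × 𝔤^E)` is a section of the isomorphism with
`⨂_v U(𝔤)^{(v)}` over the factor of `v`. -/
lemma distrib_starLift (v : V) (Z : StarEnv 𝔼 G s t v) :
    distrib 𝔼 s t (starLift 𝔼 s t v Z) =
      PiTensorProduct.singleAlgHom (R := ℂ) (A := fun v => StarEnv 𝔼 G s t v) v Z := by
  obtain ⟨Z, rfl⟩ := (starEnvEquiv 𝔼 s t v).surjective Z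
  induction Z using TensorProduct.induction_on with
  | zero => simp only [map_zero]
  | add X Y hX hY => simp only [map_add, hX, hY]
  | tmul X Y =>
    let ψ := (PiTensorProduct.singleAlgHom (R := ℂ) (A := fun v => StarEnv 𝔼 G s t v) v).comp
      (starEnvEquiv 𝔼 s t v).toAlgHom
    have hX : distrib 𝔼 s t (orderedProd
        (fun e : {e // s e = v} => (envLeft 𝔼 (G := G) (e : E)).toLinearMap) X) =
        ψ (X ⊗ₜ[ℂ] (1 : ⨂[ℂ] _ : {e // t e = v}, EnvG 𝔼 G)) := by
      have h1 := map_orderedProd (fun e : {e // s e = v} =>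
          (PiTensorProduct.singleAlgHom (R := ℂ)
            (A := fun _ : {e // s e = v} => EnvG 𝔼 G) e).toLinearMap)
        (ψ.comp (Algebra.TensorProduct.includeLeft (R := ℂ) (S := ℂ)
          (A := ⨂[ℂ] _ : {e // s e = v}, EnvG 𝔼 G) (B := ⨂[ℂ] _ : {e // t e = v}, EnvG 𝔼 G))) X
      rw [orderedProd_single] at h1
      refine Eq.trans ?_ h1.symm
      rw [map_orderedProd]
      congr 2
      ext1 e
      exact LinearMap.ext fun x => distrib_envLeft 𝔼 s t v e x
    have hY : distrib 𝔼 s t (orderedProd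
        (fun e : {e // t e = v} => (envRight 𝔼 (G := G) (e : E)).toLinearMap) Y) =
        ψ ((1 : ⨂[ℂ] _ : {e // s e = v}, EnvG 𝔼 G) ⊗ₜ[ℂ] Y) := by
      have h1 := map_orderedProd (fun e : {e // t e = v} =>
          (PiTensorProduct.singleAlgHom (R := ℂ)
            (A := fun _ : {e // t e = v} => EnvG 𝔼 G) e).toLinearMap)
        (ψ.comp (Algebra.TensorProduct.includeRight (R := ℂ)
          (A := ⨂[ℂ] _ : {e // s e = v}, EnvG 𝔼 G) (B := ⨂[ℂ] _ : {e // t e = v}, EnvG 𝔼 G))) Y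
      rw [orderedProd_single] at h1
      refine Eq.trans ?_ h1.symm
      rw [map_orderedProd]
      congr 2
      ext1 e
      exact LinearMap.ext fun x => distrib_envRight 𝔼 s t v e x
    rw [starLift_tmul, map_mul, hX, hY, ← map_mul, Algebra.TensorProduct.tmul_mul_tmul, one_mul,
      mul_one]
    rfl

lemma envGauge_starLift (v : V) (k : ∀ v, K v) (Z : StarEnv 𝔼 G s t v) :
    envGauge 𝔼 s t K k (starLift 𝔼 s t v Z) =
      starLift 𝔼 s t v (starAd 𝔼 s t K v (k v) Z) := by
  obtain ⟨Z, rfl⟩ := (starEnvEquiv 𝔼 s t v).surjective Z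
  induction Z using TensorProduct.induction_on with
  | zero => simp
  | add X Y hX hY => simp only [map_add, hX, hY]
  | tmul X Y =>
    rw [starAd_tmul, starLift_tmul, starLift_tmul, map_mul, map_orderedProd, map_orderedProd,
      orderedProd_piMapAlg, orderedProd_piMapAlg]
    congr 3
    · ext1 ⟨e, he⟩
      subst he
      exact LinearMap.ext fun x => envGauge_envLeft 𝔼 s t K k e x
    · ext1 ⟨e, he⟩
      subst he
      exact LinearMap.ext fun x => envGauge_envRight 𝔼 s t K k e x

lemma starLift_mem_envInv (v : V) {Z : StarEnv 𝔼 G s t v} (hZ : Z ∈ starInv 𝔼 s t K v) :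
    starLift 𝔼 s t v Z ∈ envInv 𝔼 s t K :=
  (mem_envInv 𝔼 s t K).2 fun k => by
    rw [envGauge_starLift, (mem_starInv 𝔼 s t K).1 hZ]

end Invariants

/-! ### The module isomorphism and irreducibility -/

section Modules

variable (𝔼 : Type*) [NormedAddCommGroup 𝔼] [NormedSpace ℝ 𝔼] [FiniteDimensional ℝ 𝔼]
  {G : Type*} [TopologicalSpace G] [ChartedSpace 𝔼 G] [Group G] [LieGroup 𝓘(ℝ, 𝔼) ∞ G]
  [T2Space G] [CompactSpace G]
  {V E : Type*} [Fintype V] [DecidableEq V] [Fintype E] [DecidableEq E]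
  (s t : E → V) (K : V → Subgroup G)
  {S : V → Type*} [∀ v, AddCommGroup (S v)] [∀ v, Module ℂ (S v)]
  [∀ v, FiniteDimensional ℂ (S v)] (σ : ∀ v, Representation ℂ (K v) (S v))
  {M : E → Type*} [∀ e, AddCommGroup (M e)] [∀ e, Module ℂ (M e)]
  [∀ e, FiniteDimensional ℂ (M e)] (π : ∀ e, Representation ℂ G (M e))
  [∀ e, IsContinuousRep (π e)]

instance isScalarTower_localHom (v : V) :
    IsScalarTower ℂ (starInv 𝔼 s t K v) (LocalHom s t K σ π v) := by
  refine ⟨fun c a φ => Subtype.ext ?_⟩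
  show homAct 𝔼 s t π S v (c • (a : StarEnv 𝔼 G s t v)) φ =
    c • homAct 𝔼 s t π S v (a : StarEnv 𝔼 G s t v) φ
  rw [map_smul]
  rfl

instance isScalarTower_intertwinerTensor :
    IsScalarTower ℂ (envInv 𝔼 s t K) (IntertwinerTensor s t K σ π) := by
  refine ⟨fun c a z => intertwinerIncl_injective s t K σ π ?_⟩
  rw [intertwinerIncl_smul, (intertwinerIncl s t K σ π).map_smul c (a • z), intertwinerIncl_smul,
    Subalgebra.coe_smul, map_smul]
  rfl

/-- The identity map between the tensor product of the local intertwiner spaces and the underlying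
tensor product. -/
noncomputable def intertwinerEquiv :
    IntertwinerTensor s t K σ π ≃ₗ[ℂ] ⨂[ℂ] v, LocalHom s t K σ π v :=
  LinearEquiv.refl ℂ (⨂[ℂ] v, LocalHom s t K σ π v)

lemma mapIncl_intertwinerEquiv (z : IntertwinerTensor s t K σ π) :
    PiTensorProduct.mapIncl (fun v => LocalHom s t K σ π v) (intertwinerEquiv s t K σ π z) =
      intertwinerIncl s t K σ π z := rfl

/-- The factorwise action of `⨂_v (U(𝔤)^{(v)})^{K_v}` on the tensor product of the local intertwiner
spaces is the restriction of the action of `⨂_v U(𝔤)^{(v)}`. -/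
lemma mapIncl_piAct (X : ⨂[ℂ] v, starInv 𝔼 (G := G) s t K v) (z : ⨂[ℂ] v, LocalHom s t K σ π v) :
    PiTensorProduct.mapIncl (fun v => LocalHom s t K σ π v)
        (piAct (fun v => Algebra.lsmul ℂ ℂ (LocalHom s t K σ π v)) X z) =
      piAct (fun v => homAct 𝔼 s t π S v) (piMapAlg (fun v => (starInv 𝔼 s t K v).val) X)
        (PiTensorProduct.mapIncl (fun v => LocalHom s t K σ π v) z) := by
  induction X using PiTensorProduct.induction_on with
  | add X Y hX hY => simp only [map_add, LinearMap.add_apply, hX, hY]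
  | smul_tprod r a =>
    induction z using PiTensorProduct.induction_on with
    | add w w' h h' => simp only [map_add, h, h']
    | smul_tprod r' w =>
      simp only [map_smul, LinearMap.smul_apply, piAct_tprod, piMapAlg_tprod,
        PiTensorProduct.mapIncl, PiTensorProduct.map_tprod]
      rfl

lemma isSimpleModule_intertwinerTensor_iff :
    IsSimpleModule (envInv 𝔼 s t K) (IntertwinerTensor s t K σ π) ↔
      ∀ v, IsSimpleModule (starInv 𝔼 s t K v) (LocalHom s t K σ π v) := by
  have hinj := mapIncl_injective fun v => LocalHom s t K σ π v
  constructor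
  · refine isSimpleModule_of_tensor (intertwinerEquiv s t K σ π) fun b => ?_
    obtain ⟨X, hX⟩ := distrib_mem_range_mapIncl 𝔼 s t K b b.2
    refine ⟨X, fun z => hinj ?_⟩
    rw [mapIncl_intertwinerEquiv, intertwinerIncl_smul, tensorHomAct, AlgHom.comp_apply, ← hX]
    exact (mapIncl_piAct 𝔼 s t K σ π X z).symm
  · refine isSimpleModule_tensor (intertwinerEquiv s t K σ π) fun v a => ?_
    refine ⟨⟨starLift 𝔼 s t v a, starLift_mem_envInv 𝔼 s t K v a.2⟩, fun z => hinj ?_⟩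
    rw [mapIncl_intertwinerEquiv, intertwinerIncl_smul, tensorHomAct, AlgHom.comp_apply,
      distrib_starLift, ← piAct_single (A := fun v => starInv 𝔼 (G := G) s t K v)
        (fun v => Algebra.lsmul ℂ ℂ (LocalHom s t K σ π v)), mapIncl_piAct, piMapAlg_single]
    rfl

/-- The restriction of `Υ^π` to the tensor product of the local intertwiner spaces. Its image is
`H^π` because `Υ^π` is an equivariant bijection and the invariants of the product of the groups
`K_v` in a tensor product are the tensor product of the invariants. -/
lemma exists_intertwiner_equiv (hπ : ∀ e, (π e).IsIrreducible) :
    ∃ Υ : IntertwinerTensor s t K σ π ≃ₗ[envInv 𝔼 s t K] spinGraphFunctions s t π K σ,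
      ∀ z : IntertwinerTensor s t K σ π,
        (Υ z : SpinSpace (edgeTensorRep π) S) =
          Upsilon s t π S (intertwinerIncl s t K σ π z) := by
  have hbij := Upsilon_bijective s t π (S := S) hπ
  let f : IntertwinerTensor s t K σ π →ₗ[envInv 𝔼 s t K] spinGraphFunctions s t π K σ :=
    { toFun := fun z => ⟨Upsilon s t π S (intertwinerIncl s t K σ π z), fun k => by
        rw [← Upsilon_gauge, intertwinerIncl_invariant]⟩
      map_add' := fun z z' => Subtype.ext (by simp)
      map_smul' := fun X z => Subtype.ext (by
        rw [RingHom.id_apply, coe_envInv_smul]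
        show Upsilon s t π S (intertwinerIncl s t K σ π (X • z)) = _
        rw [intertwinerIncl_smul, Upsilon_envAct]) }
  refine ⟨LinearEquiv.ofBijective f ⟨fun z z' h => ?_, fun y => ?_⟩, fun z => rfl⟩
  · exact intertwinerIncl_injective s t K σ π (hbij.1 (congrArg Subtype.val h))
  · obtain ⟨x, hx⟩ := hbij.2 y
    obtain ⟨z, hz⟩ := extTensorRep_invariants_le (fun v => homRep s t K σ π v)
      (fun v => LocalHom s t K σ π v) (fun v φ h => h) x fun k => hbij.1 (by
        rw [Upsilon_gauge, hx]
        exact y.2 k)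
    exact ⟨z, Subtype.ext ((congrArg (Upsilon s t π S) hz).trans hx)⟩

end Modules

end SpinGraph

theorem mainTheorem2
    {𝔼 : Type*} [NormedAddCommGroup 𝔼] [NormedSpace ℝ 𝔼] [FiniteDimensional ℝ 𝔼]
    {G : Type*} [TopologicalSpace G] [ChartedSpace 𝔼 G] [Group G] [LieGroup 𝓘(ℝ, 𝔼) ∞ G]
    [T2Space G] [CompactSpace G] [ConnectedSpace G]
    {V E : Type*} [Fintype V] [DecidableEq V] [Fintype E] [DecidableEq E] (s t : E → V)
    (K : V → Subgroup G)
    {S : V → Type*} [∀ v, AddCommGroup (S v)] [∀ v, Module ℂ (S v)]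
    [∀ v, FiniteDimensional ℂ (S v)] (σ : ∀ v, Representation ℂ (K v) (S v))
    {M : E → Type*} [∀ e, AddCommGroup (M e)] [∀ e, Module ℂ (M e)]
    [∀ e, FiniteDimensional ℂ (M e)] (π : ∀ e, Representation ℂ G (M e))
    [∀ e, IsContinuousRep (π e)] (hπ : ∀ e, (π e).IsIrreducible) :
    Function.Bijective (Upsilon s t π S) ∧
    (∃ Υ : IntertwinerTensor s t K σ π ≃ₗ[envInv 𝔼 s t K] spinGraphFunctions s t π K σ,
      ∀ z : IntertwinerTensor s t K σ π,
        (Υ z : SpinSpace (edgeTensorRep π) S) =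
          Upsilon s t π S (intertwinerIncl s t K σ π z)) ∧
    (IsSimpleModule (envInv 𝔼 s t K) (spinGraphFunctions s t π K σ) ↔
      ∀ v, IsSimpleModule (starInv 𝔼 s t K v) (LocalHom s t K σ π v)) := by
  obtain ⟨Υ, hΥ⟩ := exists_intertwiner_equiv 𝔼 s t K σ π hπ
  refine ⟨Upsilon_bijective s t π hπ, ⟨Υ, hΥ⟩, ?_⟩
  rw [← isSimpleModule_intertwinerTensor_iff 𝔼 s t K σ π]
  exact ⟨fun _ => IsSimpleModule.congr Υ, fun _ => IsSimpleModule.congr Υ.symm⟩
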